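/- Let $\mathcal G$ be a finite-dimensional complex Lie algebra with a nondegenerate, symmetric, invariant bilinear form $B$, let $N\ge 1$, and let $\mu$ be an automorphism of $\mathcal G$ with $\mu^N=\mathrm{id}$ and $B(\mu\xi,\mu\eta)=B(\xi,\eta)$. For $0\le a<N$ put $\mathcal G_a=\{\xi:\mu\xi=e^{2\pi i a/N}\xi\}$, so that $\mathcal G=\bigoplus_a\mathcal G_a$, and for $\omega\in\mathcal G_0$ let $(\mathrm{ad}\,\omega)_a=\mathrm{ad}\,\omega|_{\mathcal G_a}$. Fix $\tau$ with $\operatorname{Im}\tau>0$, and put $\Omega=\mathbb Z+\tau\mathbb Z$, $\Omega_a=(\Omega-\frac aN\tau)\setminus\{0\}$, $$\theta_1(z)=-\sum_{j\in\mathbb Z}\exp\big(\pi i(j+\tfrac12)^2\tau+2\pi i(j+\tfrac12)(z+\tfrac12)\big),\qquad \chi(w,z)=\frac1{2\pi i}\,\frac{\theta_1(\frac w{2\pi i}+z)\,\theta_1'(0)}{\theta_1(z)\,\theta_1(\frac w{2\pi i})},$$ $$\chi_a(w,z)=e^{2\pi i a z/N}\Big(\chi\big(w+2\pi i\tfrac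 aN\tau,z\big)-\frac{\delta_{a,0}}w\Big),$$ where for $a=0$ the removable singularity at $w=0$ is removed. Let $\mathcal B^\tau$ be the set of $\omega\in\mathcal G_0$ such that, for every $0\le a<N$, no eigenvalue of $(\mathrm{ad}\,\omega)_a$ lies in $2\pi i\,\Omega_a$. For $\omega\in\mathcal B^\tau$ and $z\in\mathbb C\setminus\Omega$ let $\mathcal R_\tau(\omega,z)\in\mathrm{End}(\mathcal G)$ be the operator with $\mathcal R_\tau(\omega,z)|_{\mathcal G_a}=\chi_a((\mathrm{ad}\,\omega)_a,z)$ for all $a$, defined by holomorphic functional calculus in $w$, and put $$r^\tau(\omega,z)=\sum_{\alpha,\beta}B(T_\alpha,\mathcal R_\tau(\omega,z)T_\beta)\,T^\alpha\otimes T^\beta,\qquad \big(r^\tau(\omega,z)\big)^T=\sum_{\alpha,\beta}B(T_\alpha,\mathcal R_\tau(\omega,z)T_\beta)\,T^\beta\otimes T^\alpha,$$ where $(T_\alpha),(T^\alpha)$ are bases of $\mathcal G$ with $B(T_\alpha,T^\beta)=\delta_\alpha^\beta$. Let $(T_j)$ be a basis of $\mathcal G_0$, and let $\omega_j=B(\omega,T_j)$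 be the corresponding linear coordinates on $\mathcal G_0$. Then for every $\omega\in\mathcal B^\tau$ the following hold. 1. For all $z_1,z_2,z_3\in\mathbb C$ such that $z_{12},z_{13},z_{23}\notin\Omega$, where $z_{\alpha\beta}=z_\alpha-z_\beta$, the partial derivatives below exist, and $$[r^\tau_{12}(\omega,z_{12}),r^\tau_{13}(\omega,z_{13})]+[r^\tau_{12}(\omega,z_{12}),r^\tau_{23}(\omega,z_{23})]+[r^\tau_{13}(\omega,z_{13}),r^\tau_{23}(\omega,z_{23})]$$ $$+\sum_j\Big(T_j^1\,\frac{\partial}{\partial\omega_j}r^\tau_{23}(\omega,z_{23})-T_j^2\,\frac{\partial}{\partial\omega_j}r^\tau_{13}(\omega,z_{13})+T_j^3\,\frac{\partial}{\partial\omega_j}r^\tau_{12}(\omega,z_{12})\Big)=0$$ in $\mathcal G\otimes\mathcal G\otimes\mathcal G$, with the usual notation $r_{12}=r\otimes1$, $T_j^1=T_j\otimes1\otimes1$, etc. 2. $\displaystyle \operatorname{Res}_{z=0}r^\tau(\omega,z)=\frac1{2\pi i}\sum_\alpha T^\alpha\otimes T_\alpha$. 3. $\big(r^\tau(\omega,z)\big)^T+r^\tau(\omega,-z)=0$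 for all $z\in\mathbb C\setminus\Omega$. 4. For all $T\in\mathcal G_0$ and $z\in\mathbb C\setminus\Omega$, $$\frac{d}{dx}\,r^\tau\big(e^{x\,\mathrm{ad}\,T}(\omega),z\big)\Big|_{x=0}=[T\otimes1+1\otimes T,\;r^\tau(\omega,z)].$$ -/

import Mathlib

open scoped TensorProduct Topology
open Filter

noncomputable section

namespace EllipticRMatrix

/-! ### Theta function and the kernels -/

/-- The theta function
`θ₁(z|τ) = -∑_{j ∈ ℤ} exp (π i (j + 1/2)² τ + 2 π i (j + 1/2) (z + 1/2))`. -/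
def theta1 (τ z : ℂ) : ℂ :=
  -∑' j : ℤ, Complex.exp (Real.pi * Complex.I * ((j : ℂ) + 1 / 2) ^ 2 * τ
    + 2 * Real.pi * Complex.I * ((j : ℂ) + 1 / 2) * (z + 1 / 2))

/-- The lattice `Ω = ℤ + τ ℤ`. -/
def lattice (τ : ℂ) : Set ℂ := {x | ∃ m n : ℤ, x = m + n * τ}

/-- `Ω_a = (Ω - (a/N) τ) \ {0}`. -/
def latticeShift (τ : ℂ) (N a : ℕ) : Set ℂ :=
  {x | x + (a : ℂ) / N * τ ∈ lattice τ ∧ x ≠ 0}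

/-- `χ(w,z|τ) = (2πi)⁻¹ θ₁(w/(2πi) + z) θ₁'(0) / (θ₁(z) θ₁(w/(2πi)))`. -/
def chi (τ w z : ℂ) : ℂ :=
  1 / (2 * Real.pi * Complex.I) *
    (theta1 τ (w / (2 * Real.pi * Complex.I) + z) * deriv (theta1 τ) 0 /
      (theta1 τ z * theta1 τ (w / (2 * Real.pi * Complex.I))))

/-- The function `w ↦ χ(w,z|τ) - 1/w`, with its removable singularity at `w = 0` removed. -/
def chiReg (τ w z : ℂ) : ℂ :=
  if w = 0 then limUnder (𝓝[≠] (0 : ℂ)) (fun u => chi τ u z - 1 / u)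
  else chi τ w z - 1 / w

/-- `χ_a(w,z|τ) = exp (2πi a z / N) (χ(w + 2πi (a/N) τ, z|τ) - δ_{a,0} / w)`. -/
def chiA (τ : ℂ) (N a : ℕ) (w z : ℂ) : ℂ :=
  Complex.exp (2 * Real.pi * Complex.I * a * z / N) *
    (if a = 0 then chiReg τ w z
     else chi τ (w + 2 * Real.pi * Complex.I * ((a : ℂ) / N) * τ) z)

/-! ### Linear algebra over `ℂ` -/

section LinearAlgebra

variable {V : Type*} [AddCommGroup V] [Module ℂ V] [FiniteDimensional ℂ V]

/-- The holomorphic functional calculus on a finite-dimensional complex vector space: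
`H(A) = (2πi)⁻¹ ∮_Γ H(ζ) (ζ - A)⁻¹ dζ`, where `Γ` is the union of the positively oriented circles
of radius `ε` around the eigenvalues of `A`. If `H` is holomorphic near the spectrum of `A`, the
integral does not depend on `ε` once `ε > 0` is small, and its value is the limit for `ε → 0+`.
The operator-valued integral is computed entrywise in a basis of `V`. -/
def holCalc (H : ℂ → ℂ) (A : Module.End ℂ V) : Module.End ℂ V :=
  Matrix.toLin (Module.finBasis ℂ V) (Module.finBasis ℂ V) (Matrix.of fun i j =>
    limUnder (𝓝[>] (0 : ℝ)) fun ε : ℝ =>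
      ∑ l ∈ (Module.End.finite_spectrum A).toFinset,
        (2 * Real.pi * Complex.I : ℂ)⁻¹ * ∮ ζ in C(l, ε),
          H ζ * LinearMap.toMatrix (Module.finBasis ℂ V) (Module.finBasis ℂ V)
            (resolvent A ζ) i j)

/-- The exponential `e^A = ∑ Aⁿ / n!` of an endomorphism of a finite-dimensional space. -/
def endExp (A : Module.End ℂ V) : Module.End ℂ V :=
  Matrix.toLin (Module.finBasis ℂ V) (Module.finBasis ℂ V)
    (NormedSpace.exp (LinearMap.toMatrix (Module.finBasis ℂ V) (Module.finBasis ℂ V) A))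

end LinearAlgebra

/-- `f : ℂ → V` has derivative `v` at `t₀`, where `V` is a finite-dimensional complex vector space
with its usual topology: this is tested on all linear functionals. -/
def HasVecDerivAt {V : Type*} [AddCommGroup V] [Module ℂ V] (f : ℂ → V) (v : V) (t₀ : ℂ) : Prop :=
  ∀ φ : Module.Dual ℂ V, HasDerivAt (fun t => φ (f t)) (φ v) t₀

/-- The function `f` is holomorphic on a punctured neighbourhood of `z₀` and has residue `c`
there. -/
def HasResidueAt (f : ℂ → ℂ) (c z₀ : ℂ) : Prop :=
  ∃ ρ > 0, DifferentiableOn ℂ f (Metric.ball z₀ ρ \ {z₀}) ∧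
    ∀ ε : ℝ, 0 < ε → ε < ρ → (2 * Real.pi * Complex.I : ℂ)⁻¹ * (∮ z in C(z₀, ε), f z) = c

/-- Residue of a function with values in a finite-dimensional complex vector space. -/
def HasVecResidueAt {V : Type*} [AddCommGroup V] [Module ℂ V]
    (f : ℂ → V) (v : V) (z₀ : ℂ) : Prop :=
  ∀ φ : Module.Dual ℂ V, HasResidueAt (fun z => φ (f z)) (φ v) z₀

/-! ### The grading defined by an automorphism of finite order -/

section Lie

variable {G : Type*} [LieRing G] [LieAlgebra ℂ G]

/-- The eigensubspace `G_a = {ξ | μ ξ = exp (2πi a / N) ξ}`. -/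
def grade (μ : G ≃ₗ⁅ℂ⁆ G) (N a : ℕ) : Submodule ℂ G :=
  Module.End.eigenspace (μ : G →ₗ[ℂ] G) (Complex.exp (2 * Real.pi * Complex.I * a / N))

theorem mem_grade {μ : G ≃ₗ⁅ℂ⁆ G} {N a : ℕ} {x : G} :
    x ∈ grade μ N a ↔ μ x = Complex.exp (2 * Real.pi * Complex.I * a / N) • x :=
  Module.End.mem_eigenspace_iff

theorem lie_mem_grade {μ : G ≃ₗ⁅ℂ⁆ G} {N a : ℕ} {ω x : G} (hω : ω ∈ grade μ N 0)
    (hx : x ∈ grade μ N a) : ⁅ω, x⁆ ∈ grade μ N a := by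
  rw [mem_grade] at *
  rw [LieEquiv.map_lie, hω, hx]
  simp

/-- `(ad ω)_a`, the restriction of `ad ω` to `G_a`, for `ω ∈ G_0`. -/
def adGrade (μ : G ≃ₗ⁅ℂ⁆ G) (N a : ℕ) (ω : grade μ N 0) : Module.End ℂ (grade μ N a) :=
  (LieAlgebra.ad ℂ G (ω : G)).restrict fun _ hx => lie_mem_grade ω.2 hx

/-- The projection of `G` onto `G_a`, as an endomorphism of `G`: it is
`N⁻¹ ∑_{k < N} exp (-2πi a k / N) μ^k`. -/
def gradeProjFun (μ : G ≃ₗ⁅ℂ⁆ G) (N a : ℕ) : G →ₗ[ℂ] G :=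
  (N : ℂ)⁻¹ • ∑ k ∈ Finset.range N,
    Complex.exp (-(2 * Real.pi * Complex.I * a / N)) ^ k • (μ : G →ₗ[ℂ] G) ^ k

theorem gradeProjFun_apply (μ : G ≃ₗ⁅ℂ⁆ G) (N a : ℕ) (x : G) :
    gradeProjFun μ N a x = (N : ℂ)⁻¹ • ∑ k ∈ Finset.range N,
      Complex.exp (-(2 * Real.pi * Complex.I * a / N)) ^ k • (⇑μ)^[k] x := by
  simp [gradeProjFun, Module.End.pow_apply]

theorem gradeProjFun_mem {μ : G ≃ₗ⁅ℂ⁆ G} {N : ℕ} (hμ : ∀ x, (⇑μ)^[N] x = x) (a : ℕ) (x : G) :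
    gradeProjFun μ N a x ∈ grade μ N a := by
  rcases Nat.eq_zero_or_pos N with rfl | hN
  · simp [gradeProjFun]
  have hN' : (N : ℂ) ≠ 0 := by exact_mod_cast hN.ne'
  rw [mem_grade, gradeProjFun_apply, map_smul, map_sum, smul_comm _ (N : ℂ)⁻¹]
  congr 1
  have hq : Complex.exp (-(2 * Real.pi * Complex.I * a / N)) ^ N = 1 := by
    rw [← Complex.exp_nat_mul, Complex.exp_eq_one_iff]
    exact ⟨-a, by push_cast; field_simp⟩
  have hp : Complex.exp (2 * Real.pi * Complex.I * a / N) =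
      (Complex.exp (-(2 * Real.pi * Complex.I * a / N)))⁻¹ := by
    rw [Complex.exp_neg, inv_inv]
  rw [hp]
  set q := Complex.exp (-(2 * Real.pi * Complex.I * a / N)) with hqdef
  have hq0 : q ≠ 0 := Complex.exp_ne_zero _
  have key : ∑ k ∈ Finset.range N, q ^ (k + 1) • (⇑μ)^[k + 1] x =
      ∑ k ∈ Finset.range N, q ^ k • (⇑μ)^[k] x := by
    have h1 := Finset.sum_range_succ (fun k => q ^ k • (⇑μ)^[k] x) N
    have h2 := Finset.sum_range_succ' (fun k => q ^ k • (⇑μ)^[k] x) N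
    rw [h1] at h2
    simp only [hq, hμ, pow_zero, Function.iterate_zero, id_eq, one_smul] at h2
    exact (add_right_cancel h2).symm
  rw [← key, Finset.smul_sum]
  refine Finset.sum_congr rfl fun k _ => ?_
  rw [map_smul, smul_smul, pow_succ', inv_mul_cancel_left₀ hq0, Function.iterate_succ_apply']

/-- The projection of `G` onto `G_a` along the other eigensubspaces of `μ`. -/
def gradeProj (μ : G ≃ₗ⁅ℂ⁆ G) (N : ℕ) (hμ : ∀ x, (⇑μ)^[N] x = x) (a : ℕ) :
    G →ₗ[ℂ] grade μ N a :=
  (gradeProjFun μ N a).codRestrict (grade μ N a) (gradeProjFun_mem hμ a)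

theorem gradeProj_apply_self {μ : G ≃ₗ⁅ℂ⁆ G} {N : ℕ} (hN : 0 < N) (hμ : ∀ x, (⇑μ)^[N] x = x)
    {a : ℕ} (x : grade μ N a) : gradeProj μ N hμ a x = x := by
  have hN' : (N : ℂ) ≠ 0 := by exact_mod_cast hN.ne'
  apply Subtype.ext
  change gradeProjFun μ N a x = x
  have hit : ∀ k : ℕ, (⇑μ)^[k] (x : G) =
      Complex.exp (2 * Real.pi * Complex.I * a / N) ^ k • (x : G) := by
    intro k
    induction k with
    | zero => simp
    | succ k ih =>
      rw [Function.iterate_succ_apply', ih, map_smul, mem_grade.1 x.2, smul_smul, pow_succ]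
  have : ∀ k ∈ Finset.range N,
      Complex.exp (-(2 * Real.pi * Complex.I * a / N)) ^ k • (⇑μ)^[k] (x : G) = (x : G) := by
    intro k _
    rw [hit, smul_smul, ← mul_pow, ← Complex.exp_add]
    simp
  rw [gradeProjFun_apply, Finset.sum_congr rfl this, Finset.sum_const, Finset.card_range,
    ← Nat.cast_smul_eq_nsmul ℂ, smul_smul, inv_mul_cancel₀ hN', one_smul]

theorem gradeProj_apply_of_ne {μ : G ≃ₗ⁅ℂ⁆ G} {N : ℕ} (hμ : ∀ x, (⇑μ)^[N] x = x)
    {a b : ℕ} (ha : a < N) (hb : b < N) (hab : a ≠ b) (x : grade μ N b) :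
    gradeProj μ N hμ a x = 0 := by
  have hN' : (N : ℂ) ≠ 0 := by exact_mod_cast (Nat.zero_lt_of_lt ha).ne'
  apply Subtype.ext
  change gradeProjFun μ N a x = 0
  have h1 : (gradeProjFun μ N a x : G) ∈ grade μ N a := gradeProjFun_mem hμ a x
  have h2 : (gradeProjFun μ N a x : G) ∈ grade μ N b := by
    rw [gradeProjFun_apply]
    refine Submodule.smul_mem _ _ (Submodule.sum_mem _ fun k hk => Submodule.smul_mem _ _ ?_)
    clear hk
    induction k with
    | zero => simp
    | succ k ih =>
      rw [Function.iterate_succ_apply', mem_grade.1 ih]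
      exact Submodule.smul_mem _ _ ih
  have hne : Complex.exp (2 * Real.pi * Complex.I * a / N) ≠
      Complex.exp (2 * Real.pi * Complex.I * b / N) := by
    intro h
    obtain ⟨n, hn⟩ := Complex.exp_eq_exp_iff_exists_int.1 h
    have hpi : (2 * Real.pi * Complex.I : ℂ) ≠ 0 := Complex.two_pi_I_ne_zero
    have h3 : (a : ℂ) = b + n * N := by
      field_simp at hn
      linear_combination hn
    have h4 : (a : ℤ) = b + n * N := by exact_mod_cast h3
    have h5 : (a : ℤ) % N = b % N := by rw [h4]; simp
    rw [Int.emod_eq_of_lt (by positivity) (by exact_mod_cast ha),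
      Int.emod_eq_of_lt (by positivity) (by exact_mod_cast hb)] at h5
    exact hab (by exact_mod_cast h5)
  rw [mem_grade] at h1 h2
  rw [h1, ← sub_eq_zero, ← sub_smul] at h2
  exact (smul_eq_zero.1 h2).resolve_left (sub_ne_zero.2 hne)

/-- `B^τ`: the set of those `ω ∈ G_0` for which no `(ad ω)_a` has an eigenvalue
in `2πi Ω_a`. -/
def admissible (μ : G ≃ₗ⁅ℂ⁆ G) (N : ℕ) (τ : ℂ) : Set (grade μ N 0) :=
  {ω | ∀ a < N, ∀ l ∈ spectrum ℂ (adGrade μ N a ω), ∀ x ∈ latticeShift τ N a,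
    l ≠ 2 * Real.pi * Complex.I * x}

variable [FiniteDimensional ℂ G]

/-- The operator `R_τ(ω,z)` on `G`, equal to `χ_a((ad ω)_a, z|τ)` on every `G_a`, `0 ≤ a < N`. -/
def ROp (μ : G ≃ₗ⁅ℂ⁆ G) (N : ℕ) (hμ : ∀ x, (⇑μ)^[N] x = x) (τ : ℂ) (ω : grade μ N 0) (z : ℂ) :
    Module.End ℂ G :=
  ∑ a ∈ Finset.range N, (grade μ N a).subtype ∘ₗ
    holCalc (fun w => chiA τ N a w z) (adGrade μ N a ω) ∘ₗ gradeProj μ N hμ a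

theorem ROp_apply_grade (μ : G ≃ₗ⁅ℂ⁆ G) (N : ℕ) (hμ : ∀ x, (⇑μ)^[N] x = x) (τ : ℂ)
    (ω : grade μ N 0) (z : ℂ) {a : ℕ} (ha : a < N) (x : grade μ N a) :
    ROp μ N hμ τ ω z x = holCalc (fun w => chiA τ N a w z) (adGrade μ N a ω) x := by
  rw [ROp, LinearMap.sum_apply, Finset.sum_eq_single a]
  · simp [gradeProj_apply_self (Nat.zero_lt_of_lt ha) hμ]
  · intro b hb hba
    simp [gradeProj_apply_of_ne hμ (Finset.mem_range.1 hb) ha hba]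
  · intro h
    exact absurd (Finset.mem_range.2 ha) h

variable {ι : Type*} [Fintype ι]

/-- `r^τ(ω,z) = ∑ B(T_α, R_τ(ω,z) T_β) T^α ⊗ T^β`, where `T = (T_α)` and `T' = (T^α)` are dual
bases of `G`. -/
def rMat (B : LinearMap.BilinForm ℂ G) (μ : G ≃ₗ⁅ℂ⁆ G) (N : ℕ) (hμ : ∀ x, (⇑μ)^[N] x = x)
    (T T' : ι → G) (τ : ℂ) (ω : grade μ N 0) (z : ℂ) : G ⊗[ℂ] G :=
  ∑ α, ∑ β, B (T α) (ROp μ N hμ τ ω z (T β)) • (T' α ⊗ₜ[ℂ] T' β)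

/-- The transposed `r`-matrix `∑ B(T_α, R_τ(ω,z) T_β) T^β ⊗ T^α`. -/
def rMatTransposed (B : LinearMap.BilinForm ℂ G) (μ : G ≃ₗ⁅ℂ⁆ G) (N : ℕ)
    (hμ : ∀ x, (⇑μ)^[N] x = x)
    (T T' : ι → G) (τ : ℂ) (ω : grade μ N 0) (z : ℂ) : G ⊗[ℂ] G :=
  ∑ α, ∑ β, B (T α) (ROp μ N hμ τ ω z (T β)) • (T' β ⊗ₜ[ℂ] T' α)

end Lie

/-! ### Operations in `G ⊗ G ⊗ G`

The terms `[r₁₂, s₁₃]`, `t¹ s₂₃` etc. (with `r₁₂ = r ⊗ 1`, `t¹ = t ⊗ 1 ⊗ 1`, ...) all lie in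
`G ⊗ G ⊗ G`, and are defined there directly. -/

section Tensor

variable {G : Type*} [LieRing G] [LieAlgebra ℂ G]

/-- The bracket of `G` as a linear map `G ⊗ G → G`. -/
def brk : G ⊗[ℂ] G →ₗ[ℂ] G :=
  TensorProduct.lift (LieModule.toEnd ℂ G G : G →ₗ[ℂ] Module.End ℂ G)

/-- `[r₁₂, s₁₃]`: on pure tensors `(a ⊗ b, c ⊗ d) ↦ [a, c] ⊗ b ⊗ d`. -/
def brk1213 (r s : G ⊗[ℂ] G) : G ⊗[ℂ] (G ⊗[ℂ] G) :=
  TensorProduct.map brk LinearMap.id (TensorProduct.tensorTensorTensorComm ℂ G G G G (r ⊗ₜ[ℂ] s))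

/-- `[r₁₂, s₂₃]`: on pure tensors `(a ⊗ b, c ⊗ d) ↦ a ⊗ [b, c] ⊗ d`. -/
def brk1223 (r s : G ⊗[ℂ] G) : G ⊗[ℂ] (G ⊗[ℂ] G) :=
  TensorProduct.map LinearMap.id
    (TensorProduct.map brk LinearMap.id ∘ₗ (TensorProduct.assoc ℂ G G G).symm.toLinearMap)
    (TensorProduct.assoc ℂ G G (G ⊗[ℂ] G) (r ⊗ₜ[ℂ] s))

/-- `[r₁₃, s₂₃]`: on pure tensors `(a ⊗ b, c ⊗ d) ↦ a ⊗ c ⊗ [b, d]`. -/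
def brk1323 (r s : G ⊗[ℂ] G) : G ⊗[ℂ] (G ⊗[ℂ] G) :=
  TensorProduct.assoc ℂ G G G
    (TensorProduct.map LinearMap.id brk
      (TensorProduct.tensorTensorTensorComm ℂ G G G G (r ⊗ₜ[ℂ] s)))

/-- `t¹ s₂₃`: on pure tensors `a ⊗ b ↦ t ⊗ a ⊗ b`. -/
def ins1 (t : G) (s : G ⊗[ℂ] G) : G ⊗[ℂ] (G ⊗[ℂ] G) := t ⊗ₜ[ℂ] s

/-- `t² s₁₃`: on pure tensors `a ⊗ b ↦ a ⊗ t ⊗ b`. -/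
def ins2 (t : G) (s : G ⊗[ℂ] G) : G ⊗[ℂ] (G ⊗[ℂ] G) :=
  TensorProduct.map LinearMap.id (TensorProduct.mk ℂ G G t) s

/-- `t³ s₁₂`: on pure tensors `a ⊗ b ↦ a ⊗ b ⊗ t`. -/
def ins3 (t : G) (s : G ⊗[ℂ] G) : G ⊗[ℂ] (G ⊗[ℂ] G) :=
  TensorProduct.assoc ℂ G G G (s ⊗ₜ[ℂ] t)

theorem brk1213_tmul (a b c d : G) :
    brk1213 (a ⊗ₜ[ℂ] b) (c ⊗ₜ[ℂ] d) = ⁅a, c⁆ ⊗ₜ[ℂ] (b ⊗ₜ[ℂ] d) := rfl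

theorem brk1223_tmul (a b c d : G) :
    brk1223 (a ⊗ₜ[ℂ] b) (c ⊗ₜ[ℂ] d) = a ⊗ₜ[ℂ] (⁅b, c⁆ ⊗ₜ[ℂ] d) := rfl

theorem brk1323_tmul (a b c d : G) :
    brk1323 (a ⊗ₜ[ℂ] b) (c ⊗ₜ[ℂ] d) = a ⊗ₜ[ℂ] (c ⊗ₜ[ℂ] ⁅b, d⁆) := rfl

theorem ins2_tmul (t a b : G) : ins2 t (a ⊗ₜ[ℂ] b) = a ⊗ₜ[ℂ] (t ⊗ₜ[ℂ] b) := rfl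

theorem ins3_tmul (t a b : G) : ins3 t (a ⊗ₜ[ℂ] b) = a ⊗ₜ[ℂ] (b ⊗ₜ[ℂ] t) := rfl

end Tensor

end EllipticRMatrix

end

/-! Contracting tensor legs with `B` turns the four claims into statements about the operator R =
R_τ(ω, ·). Since μ preserves `B`, the space G_a pairs only with G_{-a}, indices being taken mod N,
and ad ω is skew for `B`. So unitarity is the oddness χ_b(-w, z) = -χ_a(w, -z) for a + b ≡ 0
(`chiA_neg`, `ROp_skew`). The residue is a multiple of the identity because z χ_a(w, z) tends to
1/(2πi) whatever w is (`hasVecResidueAt_holCalc`). Equivariance holds because the derivative of f(ad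
ω) in the direction [T, ω] is the commutator [ad T, f(ad ω)] (`polyDiff_commutator`).

For the Yang-Baxter equation, contract with x in G_a, y in G_b, w in G_c; everything vanishes unless
a + b + c ≡ 0. In B(x, [y, w]) let commuting variables η and ζ stand for ad ω acting on y and on w.
By the Leibniz rule η + ζ is ad ω acting on the bracket, and by invariance -η - ζ is ad ω acting on
x. The three commutator terms become products of two values of χ, and the derivative terms, present
only when one of a, b, c is zero, become divided differences of χ. What remains is a scalar identity
in three variables with sum zero (`chiA_identity`): Fay's identity for the kernels, in which the
subtraction of the poles 1/w produces exactly the divided differences. Fay's identity is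
Weierstrass' three-term relation for θ₁, which in turn is the Plücker relation for 2 × 2 minors,
because θ₁(u + a) θ₁(u - a) is the minor E(u) O(a) - O(u) E(a) of two functions E, O (`theta1_mul`).

The operators (ad ω)_a need not be diagonalisable, so the scalar identity does not give the operator
identity at once. On each G_a the function χ_a is replaced by a polynomial agreeing with it to high
order on the spectrum: first order suffices for the value of the functional calculus
(`holCalc_eq_aeval`), second order for its derivative (`hasVecDerivAt_holCalc`). For generalised
eigenvectors x, y, w with eigenvalues α, β, γ, the polynomials in η, ζ that annihilate the form
contain an ideal with powers of η - β, ζ - γ and -η - ζ - α. If α + β + γ ≠ 0, this ideal is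
everything. Otherwise the scalar identity along generic lines through (β, γ) shows that the
polynomial form of the equation vanishes there to high order, and hence lies in the ideal
(`mem_ideal_of_dvd_line`, `relPoly_mem_formIdeal`).

The analytic input is that θ₁ vanishes exactly on the lattice and has a simple zero at 0
(`theta1_eq_zero_iff`, `deriv_theta1_zero_ne_zero`). Both facts are also read off from the minor
formula. -/

noncomputable section

namespace EllipticRMatrix

/-! ### The theta function -/

section Theta

open Complex

/-- The part of `θ₁(u + a) θ₁(u - a)` coming from even exponents. -/
def thetaEven (τ u : ℂ) : ℂ := jacobiTheta₂ (2 * u) (2 * τ)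

/-- The part of `θ₁(u + a) θ₁(u - a)` coming from odd exponents. -/
def thetaOdd (τ u : ℂ) : ℂ :=
  cexp (Real.pi * I * τ / 2 + 2 * Real.pi * I * u) * jacobiTheta₂ (2 * u + τ) (2 * τ)

variable {τ : ℂ}

theorem two_mul_im_pos (hτ : 0 < τ.im) : 0 < (2 * τ).im := by simpa using hτ

theorem theta1_eq (τ z : ℂ) : theta1 τ z =
    -(cexp (Real.pi * I * τ / 4 + Real.pi * I * (z + 1 / 2)) *
      jacobiTheta₂ (z + 1 / 2 + τ / 2) τ) := by
  rw [theta1, jacobiTheta₂, ← tsum_mul_left]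
  congr 1
  refine tsum_congr fun j => ?_
  rw [jacobiTheta₂_term, ← Complex.exp_add]
  congr 1
  ring

theorem hasSum_theta1 (hτ : 0 < τ.im) (z : ℂ) :
    HasSum (fun j : ℤ => cexp (Real.pi * I * ((j : ℂ) + 1 / 2) ^ 2 * τ
      + 2 * Real.pi * I * ((j : ℂ) + 1 / 2) * (z + 1 / 2))) (-theta1 τ z) := by
  rw [theta1_eq, neg_neg]
  refine ((hasSum_jacobiTheta₂_term _ hτ).mul_left _).congr_fun ?_ |> id
  intro j
  rw [jacobiTheta₂_term, ← Complex.exp_add]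
  congr 1
  ring

theorem differentiable_theta1 (hτ : 0 < τ.im) : Differentiable ℂ (theta1 τ) := by
  have : theta1 τ = fun z => -(cexp (Real.pi * I * τ / 4 + Real.pi * I * (z + 1 / 2)) *
      jacobiTheta₂ (z + 1 / 2 + τ / 2) τ) := funext fun z => theta1_eq τ z
  rw [this]
  intro z
  have h1 : DifferentiableAt ℂ (fun z : ℂ => jacobiTheta₂ (z + 1 / 2 + τ / 2) τ) z :=
    (differentiableAt_jacobiTheta₂_fst (z + 1 / 2 + τ / 2) hτ).comp z
      (f := fun z : ℂ => z + 1 / 2 + τ / 2) (by fun_prop)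
  have h2 : DifferentiableAt ℂ
    (fun z : ℂ => cexp (Real.pi * I * τ / 4 + Real.pi * I * (z + 1 / 2))) z := by fun_prop
  exact (h2.mul h1).neg

theorem differentiable_thetaEven (hτ : 0 < τ.im) : Differentiable ℂ (thetaEven τ) := fun u =>
  (differentiableAt_jacobiTheta₂_fst (2 * u) (two_mul_im_pos hτ)).comp u
    (f := fun u : ℂ => 2 * u) (by fun_prop)

theorem differentiable_thetaOdd (hτ : 0 < τ.im) : Differentiable ℂ (thetaOdd τ) := fun u => by
  have h1 : DifferentiableAt ℂ (fun u : ℂ => jacobiTheta₂ (2 * u + τ) (2 * τ)) u :=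
    (differentiableAt_jacobiTheta₂_fst (2 * u + τ) (two_mul_im_pos hτ)).comp u
      (f := fun u : ℂ => 2 * u + τ) (by fun_prop)
  have h2 : DifferentiableAt ℂ
    (fun u : ℂ => cexp (Real.pi * I * τ / 2 + 2 * Real.pi * I * u)) u := by fun_prop
  exact h2.mul h1

theorem theta1_neg (τ z : ℂ) : theta1 τ (-z) = -theta1 τ z := by
  have e : ∀ j : ℤ, cexp (Real.pi * I * (((-1 - j : ℤ) : ℂ) + 1 / 2) ^ 2 * τ
      + 2 * Real.pi * I * (((-1 - j : ℤ) : ℂ) + 1 / 2) * (z + 1 / 2)) =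
      -cexp (Real.pi * I * ((j : ℂ) + 1 / 2) ^ 2 * τ
      + 2 * Real.pi * I * ((j : ℂ) + 1 / 2) * (-z + 1 / 2)) := by
    intro j
    have h : cexp (-(2 * j + 1) * (Real.pi * I)) = -1 := by
      rw [neg_mul, Complex.exp_neg, add_mul, Complex.exp_add, one_mul, exp_pi_mul_I]
      have : (2 * (j : ℂ) * (Real.pi * I)) = j * (2 * Real.pi * I) := by ring
      rw [this, exp_int_mul_two_pi_mul_I]
      norm_num
    rw [← neg_one_mul (cexp (_ + _ * (-z + 1 / 2))), ← h, ← Complex.exp_add]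
    congr 1
    push_cast
    ring
  rw [theta1, theta1, ← (Equiv.subLeft (-1 : ℤ)).tsum_eq (fun j : ℤ =>
    cexp (Real.pi * I * ((j : ℂ) + 1 / 2) ^ 2 * τ
      + 2 * Real.pi * I * ((j : ℂ) + 1 / 2) * (z + 1 / 2)))]
  simp only [Equiv.subLeft_apply, e, tsum_neg, neg_neg]

theorem theta1_zero (τ : ℂ) : theta1 τ 0 = 0 := by
  have := theta1_neg τ 0
  rw [neg_zero] at this
  linear_combination this / 2

theorem theta1_add_one (τ z : ℂ) : theta1 τ (z + 1) = -theta1 τ z := by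
  rw [theta1_eq, theta1_eq, show z + 1 + 1 / 2 + τ / 2 = z + 1 / 2 + τ / 2 + 1 by ring,
    jacobiTheta₂_add_left, show Real.pi * I * τ / 4 + Real.pi * I * (z + 1 + 1 / 2) =
    Real.pi * I * τ / 4 + Real.pi * I * (z + 1 / 2) + Real.pi * I by ring, Complex.exp_add _ (_ * I),
    exp_pi_mul_I]
  ring

theorem theta1_add_tau (τ z : ℂ) :
    theta1 τ (z + τ) = -cexp (-(Real.pi * I * τ) - 2 * Real.pi * I * z) * theta1 τ z := by
  have h : cexp (-(Real.pi * I)) = -1 := by rw [Complex.exp_neg, exp_pi_mul_I]; norm_num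
  rw [theta1_eq, theta1_eq, show z + τ + 1 / 2 + τ / 2 = z + 1 / 2 + τ / 2 + τ by ring,
    jacobiTheta₂_add_left', ← neg_one_mul (cexp _), ← h, mul_neg, ← Complex.exp_add, ← mul_assoc,
    ← mul_assoc, ← Complex.exp_add, ← Complex.exp_add]
  congr 3
  ring

/-- In the double series over pairs (j, k), pass to the sum and the difference of j + 1/2 and k +
1/2, which become the frequencies of u and of a. These are integers of opposite parity, so the pairs
split according to the parity of j + k, and each half factors into a series in u times a series in
a. -/
theorem theta1_mul (hτ : 0 < τ.im) (u a : ℂ) : theta1 τ (u + a) * theta1 τ (u - a) =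
    thetaEven τ u * thetaOdd τ a - thetaOdd τ u * thetaEven τ a := by
  set f : ℂ → ℤ → ℂ := fun z j => cexp (Real.pi * I * ((j : ℂ) + 1 / 2) ^ 2 * τ
      + 2 * Real.pi * I * ((j : ℂ) + 1 / 2) * (z + 1 / 2)) with hf
  have hs : ∀ z, HasSum (f z) (-theta1 τ z) := hasSum_theta1 hτ
  have hE : ∀ z, HasSum (fun s => jacobiTheta₂_term s (2 * z) (2 * τ)) (thetaEven τ z) :=
    fun z => hasSum_jacobiTheta₂_term _ (two_mul_im_pos hτ)
  have hO : ∀ z, HasSum (fun s => cexp (Real.pi * I * τ / 2 + 2 * Real.pi * I * z) *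
      jacobiTheta₂_term s (2 * z + τ) (2 * τ)) (thetaOdd τ z) :=
    fun z => (hasSum_jacobiTheta₂_term _ (two_mul_im_pos hτ)).mul_left _
  have hprod : ∀ {g h : ℤ → ℂ} {A B : ℂ}, HasSum g A → HasSum h B →
      HasSum (fun p : ℤ × ℤ => g p.1 * h p.2) (A * B) := by
    intro g h A B hg hh
    exact hg.mul hh (summable_mul_of_summable_norm hg.summable.norm hh.summable.norm)
  -- `g1` parametrises the pairs with odd sum, `g2` those with even sum.
  set g1 : ℤ × ℤ → ℤ × ℤ := fun p => (p.1 + p.2, p.1 - p.2 - 1) with hg1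
  set g2 : ℤ × ℤ → ℤ × ℤ := fun p => (p.1 + p.2, p.1 - p.2) with hg2
  have i1 : Function.Injective g1 := by
    rintro ⟨a, b⟩ ⟨c, d⟩ h
    simp only [hg1, Prod.mk.injEq] at h ⊢
    omega
  have i2 : Function.Injective g2 := by
    rintro ⟨a, b⟩ ⟨c, d⟩ h
    simp only [hg2, Prod.mk.injEq] at h ⊢
    omega
  have hc : IsCompl (Set.range g1) (Set.range g2) := by
    rw [isCompl_iff, Set.disjoint_left, codisjoint_iff_le_sup]
    constructor
    · rintro _ ⟨⟨a, b⟩, rfl⟩ ⟨⟨c, d⟩, h⟩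
      simp only [hg1, hg2, Prod.mk.injEq] at h
      omega
    · rintro ⟨j, k⟩ -
      rcases Int.even_or_odd (j + k) with ⟨m, hm⟩ | ⟨m, hm⟩
      · right
        exact ⟨(m, j - m), by simp only [hg2, Prod.mk.injEq]; omega⟩
      · left
        exact ⟨(m + 1, j - m - 1), by simp only [hg1, Prod.mk.injEq]; omega⟩
  have e1 : ∀ p : ℤ × ℤ, f (u + a) (g1 p).1 * f (u - a) (g1 p).2 =
      jacobiTheta₂_term p.1 (2 * u) (2 * τ) *
      (cexp (Real.pi * I * τ / 2 + 2 * Real.pi * I * a) *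
        jacobiTheta₂_term p.2 (2 * a + τ) (2 * τ)) := by
    rintro ⟨s, t⟩
    simp only [hf, hg1, jacobiTheta₂_term, ← Complex.exp_add]
    rw [Complex.exp_eq_exp_iff_exists_int]
    refine ⟨s, ?_⟩
    push_cast
    ring
  have e2 : ∀ p : ℤ × ℤ, f (u + a) (g2 p).1 * f (u - a) (g2 p).2 =
      -((cexp (Real.pi * I * τ / 2 + 2 * Real.pi * I * u) *
        jacobiTheta₂_term p.1 (2 * u + τ) (2 * τ)) * jacobiTheta₂_term p.2 (2 * a) (2 * τ)) := by
    rintro ⟨s, t⟩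
    simp only [hf, hg2, jacobiTheta₂_term, ← Complex.exp_add]
    rw [← neg_one_mul, ← exp_pi_mul_I, ← Complex.exp_add, Complex.exp_eq_exp_iff_exists_int]
    refine ⟨s, ?_⟩
    push_cast
    ring
  have s1 : HasSum ((fun p : ℤ × ℤ => f (u + a) p.1 * f (u - a) p.2) ∘ ((↑) : Set.range g1 → _))
      (thetaEven τ u * thetaOdd τ a) := by
    refine (i1.hasSum_range_iff (f := fun p : ℤ × ℤ => f (u + a) p.1 * f (u - a) p.2)).2 ?_
    exact (hprod (hE u) (hO a)).congr_fun e1 |> id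
  have s2 : HasSum ((fun p : ℤ × ℤ => f (u + a) p.1 * f (u - a) p.2) ∘ ((↑) : Set.range g2 → _))
      (-(thetaOdd τ u * thetaEven τ a)) := by
    refine (i2.hasSum_range_iff (f := fun p : ℤ × ℤ => f (u + a) p.1 * f (u - a) p.2)).2 ?_
    exact (hprod (hO u) (hE a)).neg.congr_fun e2 |> id
  have := (hprod (hs (u + a)) (hs (u - a))).unique (HasSum.add_isCompl hc s1 s2)
  linear_combination this

/-- Weierstrass' three-term identity. -/
theorem theta1_three_term (hτ : 0 < τ.im) (y w p q : ℂ) :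
    theta1 τ (-y - w) * theta1 τ q * theta1 τ (y + p) * theta1 τ (w + (p + q))
      - theta1 τ y * theta1 τ (p + q) * theta1 τ (-y - w - p) * theta1 τ (w + q)
      + theta1 τ w * theta1 τ p * theta1 τ (-y - w - (p + q)) * theta1 τ (y - q) = 0 := by
  -- The half-sums are chosen so that sums and differences of u, a, b, c give all twelve arguments
  -- up to sign. The identity is then the Plücker relation among the six minors of the four vectors
  -- (E, O) at u, a, b, c.
  set u := (w + y) / 2 + p + q / 2 with hu
  set a := (w - y + q) / 2 with ha
  set b := (y + w + q) / 2 with hb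
  set c := (y + w - q) / 2 with hc
  have h1 := theta1_mul hτ u a
  have h2 := theta1_mul hτ b c
  have h3 := theta1_mul hτ u b
  have h4 := theta1_mul hτ c a
  have h5 := theta1_mul hτ u c
  have h6 := theta1_mul hτ a b
  rw [show u + a = w + (p + q) by rw [hu, ha]; ring, show u - a = y + p by rw [hu, ha]; ring] at h1
  rw [show b + c = -(-y - w) by rw [hb, hc]; ring, show b - c = q by rw [hb, hc]; ring,
    theta1_neg] at h2
  rw [show u + b = -(-y - w - (p + q)) by rw [hu, hb]; ring,
    show u - b = p by rw [hu, hb]; ring, theta1_neg] at h3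
  rw [show c + a = w by rw [hc, ha]; ring, show c - a = y - q by rw [hc, ha]; ring] at h4
  rw [show u + c = -(-y - w - p) by rw [hu, hc]; ring,
    show u - c = p + q by rw [hu, hc]; ring, theta1_neg] at h5
  rw [show a + b = w + q by rw [ha, hb]; ring, show a - b = -y by rw [ha, hb]; ring,
    theta1_neg] at h6
  set A := thetaEven τ
  set O := thetaOdd τ
  calc _ = -((theta1 τ (w + (p + q)) * theta1 τ (y + p)) * (-theta1 τ (-y - w) * theta1 τ q))
        - ((-theta1 τ (-y - w - p) * theta1 τ (p + q)) * (theta1 τ (w + q) * -theta1 τ y))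
        - ((-theta1 τ (-y - w - (p + q)) * theta1 τ p) * (theta1 τ w * theta1 τ (y - q))) := by
        ring
    _ = 0 := by rw [h1, h2, h3, h4, h5, h6]; ring

/-- Term-by-term integration keeps only the constant Fourier mode. This serves as a witness that the
theta function is not identically zero. -/
theorem integral_jacobiTheta₂ (hτ : 0 < τ.im) :
    ∫ x in (0 : ℝ)..1, jacobiTheta₂ x τ = 1 := by
  have hb : Summable fun n : ℤ => ‖jacobiTheta₂_term n 0 τ‖ :=
    ((summable_jacobiTheta₂_term_iff 0 τ).2 hτ).norm
  have key := intervalIntegral.hasSum_integral_of_dominated_convergence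
    (μ := MeasureTheory.volume) (a := 0) (b := 1)
    (F := fun (n : ℤ) (x : ℝ) => jacobiTheta₂_term n x τ)
    (f := fun x : ℝ => jacobiTheta₂ x τ) (fun n _ => ‖jacobiTheta₂_term n 0 τ‖)
    (fun n => by
      refine Continuous.aestronglyMeasurable ?_
      unfold jacobiTheta₂_term
      fun_prop)
    (fun n => by
      refine Filter.Eventually.of_forall fun x _ => ?_
      simp [norm_jacobiTheta₂_term])
    (Filter.Eventually.of_forall fun x _ => hb)
    (by simp)
    (Filter.Eventually.of_forall fun x _ => hasSum_jacobiTheta₂_term _ hτ)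
  refine key.unique ?_
  have h0 : ∀ n : ℤ, n ≠ 0 → ∫ x in (0 : ℝ)..1, jacobiTheta₂_term n x τ = 0 := by
    intro n hn
    have hc : (2 * Real.pi * I * n : ℂ) ≠ 0 :=
      mul_ne_zero two_pi_I_ne_zero (by exact_mod_cast hn)
    simp only [jacobiTheta₂_term, Complex.exp_add, intervalIntegral.integral_mul_const]
    rw [integral_exp_mul_complex hc]
    have : 2 * Real.pi * I * n * ((1 : ℝ) : ℂ) = n * (2 * Real.pi * I) := by push_cast; ring
    rw [this, exp_int_mul_two_pi_mul_I]
    simp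
  have h1 : ∫ x in (0 : ℝ)..1, jacobiTheta₂_term 0 x τ = 1 := by
    simp [jacobiTheta₂_term]
  rw [← h1]
  exact hasSum_single 0 h0

theorem exists_theta1_ne_zero (hτ : 0 < τ.im) : ∃ z, theta1 τ z ≠ 0 := by
  by_contra! h
  have : ∀ w, jacobiTheta₂ w τ = 0 := by
    intro w
    have h1 := h (w - 1 / 2 - τ / 2)
    rw [theta1_eq, neg_eq_zero, mul_eq_zero, or_iff_right (Complex.exp_ne_zero _)] at h1
    convert h1 using 2
    ring
  have h2 := integral_jacobiTheta₂ hτ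
  simp [this] at h2

/-- At a common zero u the product θ₁(u + a) θ₁(u - a) would vanish for all a, and so one of two
entire functions, each a translate or reflection of θ₁, would be identically zero. -/
theorem thetaEven_ne_zero_or (hτ : 0 < τ.im) (u : ℂ) :
    thetaEven τ u ≠ 0 ∨ thetaOdd τ u ≠ 0 := by
  by_contra! h
  obtain ⟨z, hz⟩ := exists_theta1_ne_zero hτ
  have h1 : ∀ a, theta1 τ (u + a) * theta1 τ (u - a) = 0 := fun a => by
    rw [theta1_mul hτ, h.1, h.2]; ring
  have hA : AnalyticOnNhd ℂ (fun a => theta1 τ (u + a)) Set.univ :=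
    ((differentiable_theta1 hτ).comp (f := fun a : ℂ => u + a)
      (by fun_prop)).differentiableOn.analyticOnNhd isOpen_univ
  have hB : AnalyticOnNhd ℂ (fun a => theta1 τ (u - a)) Set.univ :=
    ((differentiable_theta1 hτ).comp (f := fun a : ℂ => u - a)
      (by fun_prop)).differentiableOn.analyticOnNhd isOpen_univ
  rcases hA.eq_zero_or_eq_zero_of_smul_eq_zero hB
    (fun a _ => h1 a) isPreconnected_univ with h2 | h2
  · exact hz (by simpa using h2 (z - u) trivial)
  · exact hz (by simpa using h2 (u - z) trivial)

theorem thetaEven_add_half (τ u : ℂ) : thetaEven τ (u + 1 / 2) = thetaEven τ u := by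
  rw [thetaEven, thetaEven, show 2 * (u + 1 / 2) = 2 * u + 1 by ring, jacobiTheta₂_add_left]

theorem thetaOdd_add_half (τ u : ℂ) : thetaOdd τ (u + 1 / 2) = -thetaOdd τ u := by
  rw [thetaOdd, thetaOdd, show 2 * (u + 1 / 2) + τ = 2 * u + τ + 1 by ring, jacobiTheta₂_add_left,
    show Real.pi * I * τ / 2 + 2 * Real.pi * I * (u + 1 / 2) =
      Real.pi * I * τ / 2 + 2 * Real.pi * I * u + Real.pi * I by ring, Complex.exp_add _ (_ * I),
    exp_pi_mul_I]
  ring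

/-- Translation by τ/2 swaps the even and the odd part with one and the same factor, so it acts on
the pair (E, O) without disturbing proportionality. -/
theorem thetaEven_add_half_tau (τ u : ℂ) : thetaEven τ (u + τ / 2) =
    cexp (-(Real.pi * I * τ / 2) - 2 * Real.pi * I * u) * thetaOdd τ u := by
  rw [thetaEven, thetaOdd, ← mul_assoc, ← Complex.exp_add]
  ring_nf
  simp

theorem thetaOdd_add_half_tau (τ u : ℂ) : thetaOdd τ (u + τ / 2) =
    cexp (-(Real.pi * I * τ / 2) - 2 * Real.pi * I * u) * thetaEven τ u := by
  rw [thetaOdd, thetaEven, show 2 * (u + τ / 2) + τ = 2 * u + 2 * τ by ring,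
    jacobiTheta₂_add_left', ← mul_assoc, ← Complex.exp_add]
  congr 2
  ring

/-- A continuous function with two independent periods is bounded. -/
theorem isBounded_range_of_periodic {f : ℂ → ℂ} (hf : Continuous f) (hτ : 0 < τ.im)
    (h1 : ∀ u, f (u + 1) = f u) (h2 : ∀ u, f (u + τ) = f u) :
    Bornology.IsBounded (Set.range f) := by
  have hz1 : ∀ (n : ℤ) u, f (u + n) = f u := by
    intro n u
    have : Function.Periodic f 1 := h1
    simpa using this.int_mul n u
  have hz2 : ∀ (n : ℤ) u, f (u + n * τ) = f u := by
    intro n u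
    have : Function.Periodic f τ := h2
    exact this.int_mul n u
  have hK : IsCompact ((fun p : ℝ × ℝ => f (p.1 + p.2 * τ)) ''
      (Set.Icc (0 : ℝ) 1 ×ˢ Set.Icc (0 : ℝ) 1)) :=
    (isCompact_Icc.prod isCompact_Icc).image (by fun_prop)
  refine hK.isBounded.subset ?_
  rintro _ ⟨u, rfl⟩
  set y := u.im / τ.im with hy
  set x := u.re - y * τ.re with hx
  have hu : u = x + y * τ := by
    apply Complex.ext
    · simp [hx]
    · simp [hy, hτ.ne']
  refine ⟨(Int.fract x, Int.fract y), ⟨⟨Int.fract_nonneg _, (Int.fract_lt_one _).le⟩,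
    ⟨Int.fract_nonneg _, (Int.fract_lt_one _).le⟩⟩, ?_⟩
  have : u = ((Int.fract x : ℝ) : ℂ) + ((Int.fract y : ℝ) : ℂ) * τ + (⌊y⌋ : ℤ) * τ + (⌊x⌋ : ℤ) := by
    have e1 : (x : ℂ) = Int.fract x + (⌊x⌋ : ℤ) := by
      exact_mod_cast (Int.fract_add_floor x).symm
    have e2 : (y : ℂ) = Int.fract y + (⌊y⌋ : ℤ) := by
      exact_mod_cast (Int.fract_add_floor y).symm
    conv_lhs => rw [hu, e1, e2]
    ring
  rw [this, hz1, hz2]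

/-- A nowhere vanishing entire function with two independent multipliers is an exponential. -/
theorem exists_exp_of_quasiperiodic {f : ℂ → ℂ} (hf : Differentiable ℂ f) (h0 : ∀ u, f u ≠ 0)
    {σ : ℂ} (hσ : 0 < σ.im) {c d : ℂ} (h1 : ∀ u, f (u + 1) = c * f u)
    (h2 : ∀ u, f (u + σ) = d * f u) : ∃ k, ∀ u h, f (u + h) = cexp (k * h) * f u := by
  have hc : c ≠ 0 := fun h => h0 1 (by simpa [h] using h1 0)
  have hd : d ≠ 0 := fun h => h0 σ (by simpa [h] using h2 0)
  have hf' : Differentiable ℂ (deriv f) := fun u => hf.analyticAt u |>.deriv.differentiableAt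
  -- The logarithmic derivative is entire, and the multipliers cancel in it. It is therefore doubly
  -- periodic, hence bounded and, by Liouville, constant.
  have hq : Differentiable ℂ fun u => deriv f u / f u := hf'.div hf h0
  have hper : ∀ {ρ e : ℂ}, e ≠ 0 → (∀ u, f (u + ρ) = e * f u) →
      ∀ u, deriv f (u + ρ) / f (u + ρ) = deriv f u / f u := by
    intro ρ e he h u
    have : deriv f (u + ρ) = e * deriv f u := by
      rw [← deriv_comp_add_const f ρ u, funext h, deriv_const_mul _ hf.differentiableAt]
    rw [this, h, mul_div_mul_left _ _ he]
  have hb := isBounded_range_of_periodic hq.continuous hσ (hper hc h1) (hper hd h2)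
  obtain ⟨k, hk⟩ : ∃ k, ∀ u, deriv f u / f u = k :=
    ⟨_, fun u => hq.apply_eq_apply_of_bounded hb u 0⟩
  refine ⟨k, fun u h => ?_⟩
  have hg : ∀ v, HasDerivAt (fun v => f v * cexp (-(k * v))) 0 v := by
    intro v
    have e1 : HasDerivAt (fun v => cexp (-(k * v))) (cexp (-(k * v)) * -(k * 1)) v :=
      ((hasDerivAt_id v).const_mul k).neg.cexp
    have e2 := (hf v).hasDerivAt.mul e1
    have e3 : deriv f v = k * f v := by rw [← hk v, div_mul_cancel₀ _ (h0 v)]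
    exact e2.congr_deriv (by rw [e3]; ring)
  have := is_const_of_deriv_eq_zero (fun v => (hg v).differentiableAt) (fun v => (hg v).deriv)
    (u + h) u
  simp only [mul_add, neg_add, Complex.exp_add] at this
  have e : cexp (-(k * h)) * cexp (k * h) = 1 := by rw [← Complex.exp_add]; simp
  have hne : cexp (-(k * u)) ≠ 0 := Complex.exp_ne_zero _
  apply mul_right_cancel₀ hne
  linear_combination cexp (k * h) * this - f (u + h) * cexp (-(k * u)) * e

/-- If θ₁(z₀) = 0, the minor formula makes the vectors (E, O) at u + z₀ and at u parallel for every
u. Neither vector is zero, so their ratio is entire without zeros; it is quasi-periodic for the half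
periods and hence an exponential. Comparing its exponent with the two multipliers forces z₀ into the
lattice. -/
theorem mem_lattice_of_theta1_eq_zero (hτ : 0 < τ.im) {z₀ : ℂ} (hz : theta1 τ z₀ = 0) :
    z₀ ∈ lattice τ := by
  set P := thetaEven τ with hP
  set Q := thetaOdd τ with hQ
  have hdP : Differentiable ℂ P := differentiable_thetaEven hτ
  have hdQ : Differentiable ℂ Q := differentiable_thetaOdd hτ
  have hne := thetaEven_ne_zero_or hτ
  have hpar : ∀ u, P (u + z₀) * Q u = Q (u + z₀) * P u := by
    intro u
    have := theta1_mul hτ (u + z₀) u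
    rw [add_sub_cancel_left, hz, mul_zero] at this
    exact (sub_eq_zero.1 this.symm)
  classical
  -- The two quotients agree where both make sense, and at each point at least one of them does; the
  -- case split glues them.
  set l : ℂ → ℂ := fun u => if P u = 0 then Q (u + z₀) / Q u else P (u + z₀) / P u with hl
  have hlP : ∀ u, P (u + z₀) = l u * P u := by
    intro u
    by_cases h : P u = 0
    · have hq : Q u ≠ 0 := (hne u).resolve_left (not_not.2 h)
      have := hpar u
      rw [h, mul_zero, mul_eq_zero, or_iff_left hq] at this
      rw [this, h, mul_zero]
    · simp only [hl, if_neg h]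
      field_simp
  have hlQ : ∀ u, Q (u + z₀) = l u * Q u := by
    intro u
    by_cases h : P u = 0
    · have hq : Q u ≠ 0 := (hne u).resolve_left (not_not.2 h)
      simp only [hl, if_pos h]
      field_simp
    · simp only [hl, if_neg h]
      field_simp
      exact (hpar u).symm
  have huniq : ∀ u k, P (u + z₀) = k * P u → Q (u + z₀) = k * Q u → l u = k := by
    intro u k h1 h2
    rcases hne u with h | h
    · exact mul_right_cancel₀ h ((hlP u).symm.trans h1)
    · exact mul_right_cancel₀ h ((hlQ u).symm.trans h2)
  have hl0 : ∀ u, l u ≠ 0 := by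
    intro u h
    rcases hne (u + z₀) with h' | h'
    · exact h' (by have := hlP u; rwa [h, zero_mul] at this)
    · exact h' (by have := hlQ u; rwa [h, zero_mul] at this)
  have hdl : Differentiable ℂ l := by
    intro u
    rcases hne u with h | h
    · have : l =ᶠ[𝓝 u] fun v => P (v + z₀) / P v := by
        filter_upwards [hdP.continuous.continuousAt.eventually_ne h] with v hv
        simp only [hl, if_neg hv]
      refine DifferentiableAt.congr_of_eventuallyEq ?_ this
      exact (hdP.comp (f := fun v => v + z₀) (by fun_prop)).differentiableAt.div
        hdP.differentiableAt h
    · have : l =ᶠ[𝓝 u] fun v => Q (v + z₀) / Q v := by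
        filter_upwards [hdQ.continuous.continuousAt.eventually_ne h] with v hv
        rw [hlQ v]
        field_simp
      refine DifferentiableAt.congr_of_eventuallyEq ?_ this
      exact (hdQ.comp (f := fun v => v + z₀) (by fun_prop)).differentiableAt.div
        hdQ.differentiableAt h
  have hp1 : ∀ u, l (u + 1 / 2) = l u := by
    intro u
    apply huniq
    · rw [add_right_comm, hP, thetaEven_add_half, thetaEven_add_half]
      exact hlP u
    · rw [add_right_comm, hQ, thetaOdd_add_half, thetaOdd_add_half, mul_neg]
      exact congrArg Neg.neg (hlQ u)
  have hp2 : ∀ u, l (u + τ / 2) = cexp (-(2 * Real.pi * I * z₀)) * l u := by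
    intro u
    have e : cexp (-(Real.pi * I * τ / 2) - 2 * Real.pi * I * (u + z₀)) =
      cexp (-(2 * Real.pi * I * z₀)) * cexp (-(Real.pi * I * τ / 2) - 2 * Real.pi * I * u) := by
      rw [← Complex.exp_add]
      ring_nf
    apply huniq
    · rw [add_right_comm, hP, thetaEven_add_half_tau, thetaEven_add_half_tau, e]
      have := hlQ u
      rw [← hQ, this]
      ring
    · rw [add_right_comm, hQ, thetaOdd_add_half_tau, thetaOdd_add_half_tau, e]
      have := hlP u
      rw [← hP, this]
      ring
  obtain ⟨k, hk⟩ := exists_exp_of_quasiperiodic hdl hl0 hτ (c := 1)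
    (d := cexp (-(2 * Real.pi * I * z₀)) * cexp (-(2 * Real.pi * I * z₀)))
    (fun u => by rw [show u + 1 = u + 1 / 2 + 1 / 2 by ring, hp1, hp1, one_mul])
    (fun u => by rw [show u + τ = u + τ / 2 + τ / 2 by ring, hp2, hp2, ← mul_assoc])
  -- The half periods, and not only the full ones, must be used here: k/2 = 2πi n and kτ/2 = 2πi (m
  -- - z₀) give z₀ = m - nτ, whereas full periods would determine only 2 z₀.
  have k1 : cexp (k * (1 / 2)) = 1 := by
    have := hk 0 (1 / 2)
    rw [hp1] at this
    exact mul_right_cancel₀ (hl0 0) (by rw [← this, one_mul])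
  have k2 : cexp (k * (τ / 2)) = cexp (-(2 * Real.pi * I * z₀)) := by
    have := hk 0 (τ / 2)
    rw [hp2] at this
    exact mul_right_cancel₀ (hl0 0) this.symm
  obtain ⟨n, hn⟩ := Complex.exp_eq_one_iff.1 k1
  obtain ⟨m, hm⟩ := Complex.exp_eq_exp_iff_exists_int.1 k2
  refine ⟨m, -n, ?_⟩
  have h2 : (2 * Real.pi * I : ℂ) ≠ 0 := two_pi_I_ne_zero
  apply mul_left_cancel₀ h2
  push_cast
  linear_combination hm - τ * hn

theorem theta1_add_lattice {z x : ℂ} (hx : x ∈ lattice τ) :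
    theta1 τ (z + x) = 0 ↔ theta1 τ z = 0 := by
  have h1 : ∀ z, theta1 τ (z + 1) = 0 ↔ theta1 τ z = 0 := fun z => by
    rw [theta1_add_one, neg_eq_zero]
  have h2 : ∀ z, theta1 τ (z + τ) = 0 ↔ theta1 τ z = 0 := fun z => by
    rw [theta1_add_tau, mul_eq_zero, or_iff_right (neg_ne_zero.2 (Complex.exp_ne_zero _))]
  have p1 : Function.Periodic (fun z => theta1 τ z = 0) 1 := fun z => propext (h1 z)
  have p2 : Function.Periodic (fun z => theta1 τ z = 0) τ := fun z => propext (h2 z)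
  obtain ⟨m, n, rfl⟩ := hx
  have q1 := p1.int_mul m (z + n * τ)
  have q2 := p2.int_mul n z
  simp only [mul_one] at q1 q2
  rw [show z + (m + n * τ) = z + n * τ + m by ring, q1, q2]

theorem theta1_eq_zero_iff (hτ : 0 < τ.im) {z : ℂ} : theta1 τ z = 0 ↔ z ∈ lattice τ := by
  refine ⟨mem_lattice_of_theta1_eq_zero hτ, fun h => ?_⟩
  have := (theta1_add_lattice (z := 0) h).2 (theta1_zero τ)
  rwa [zero_add] at this

/-- Differentiating the minor formula on the diagonal expresses the Wronskian of E and O as θ₁'(0)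
θ₁(2u). Were θ₁'(0) zero, E and O would be proportional, all minors would vanish, and so would
θ₁(z)², which is the minor for z and 0. -/
theorem deriv_theta1_zero_ne_zero (hτ : 0 < τ.im) : deriv (theta1 τ) 0 ≠ 0 := by
  intro h
  have hdP := differentiable_thetaEven hτ
  have hdQ := differentiable_thetaOdd hτ
  have hT := differentiable_theta1 hτ
  have hW : ∀ u, deriv (thetaEven τ) u * thetaOdd τ u = deriv (thetaOdd τ) u * thetaEven τ u := by
    intro u
    have e1 : HasDerivAt (fun v => theta1 τ (v + u) * theta1 τ (v - u))
        (deriv (theta1 τ) (u + u) * theta1 τ (u - u) +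
          theta1 τ (u + u) * deriv (theta1 τ) (u - u)) u :=
      ((hT _).hasDerivAt.comp_add_const u u).mul ((hT _).hasDerivAt.comp_sub_const u u)
    have e2 := ((hdP u).hasDerivAt.mul_const (thetaOdd τ u)).sub
      ((hdQ u).hasDerivAt.mul_const (thetaEven τ u))
    rw [funext fun v => theta1_mul hτ v u] at e1
    have e3 := e1.unique e2
    rw [sub_self, theta1_zero, h] at e3
    linear_combination -e3
  -- if the Wronskian vanishes, then the two functions are proportional
  obtain ⟨z, hz⟩ := exists_theta1_ne_zero hτ
  have hz2 : theta1 τ z * theta1 τ z ≠ 0 := mul_ne_zero hz hz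
  have hcase : ∀ (f g : ℂ → ℂ), Differentiable ℂ f → Differentiable ℂ g →
      (∀ u, deriv f u * g u = deriv g u * f u) → g 0 ≠ 0 →
      ∀ u v, f u * g v = g u * f v := by
    intro f g hf hg hfg h0
    have hA : ∀ u, f u * g 0 - f 0 * g u = 0 := by
      have hev : ∀ᶠ u in 𝓝 (0 : ℂ), f u * g 0 - f 0 * g u = 0 := by
        obtain ⟨r, hr, hball⟩ := Metric.eventually_nhds_iff_ball.1
          (hg.continuous.continuousAt.eventually_ne h0)
        filter_upwards [Metric.ball_mem_nhds _ hr] with u hu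
        have hd : ∀ v ∈ Metric.ball (0 : ℂ) r, HasDerivWithinAt (fun v => f v / g v) 0
            (Metric.ball (0 : ℂ) r) v := by
          intro v hv
          have := ((hf v).hasDerivAt.div (hg v).hasDerivAt (hball v hv)).hasDerivWithinAt
            (s := Metric.ball (0 : ℂ) r)
          exact this.congr_deriv (by rw [hfg v, mul_comm (f v), sub_self, zero_div])
        have hc := (convex_ball (0 : ℂ) r).is_const_of_fderivWithin_eq_zero (𝕜 := ℂ)
          (fun v hv => (hd v hv).differentiableWithinAt)
          (fun v hv => by
            have := (hd v hv).hasFDerivWithinAt.fderivWithin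
              (Metric.isOpen_ball.uniqueDiffWithinAt hv)
            rw [this]; ext; simp) hu (Metric.mem_ball_self hr)
        have := hball u hu
        field_simp at hc
        linear_combination hc
      have hAn : AnalyticOnNhd ℂ (fun u => f u * g 0 - f 0 * g u) Set.univ :=
        DifferentiableOn.analyticOnNhd (by fun_prop) isOpen_univ
      intro u
      exact hAn.eqOn_zero_of_preconnected_of_eventuallyEq_zero isPreconnected_univ
        (Set.mem_univ 0) hev (Set.mem_univ u)
    intro u v
    apply mul_right_cancel₀ h0
    linear_combination g v * hA u - g u * hA v
  have hprop : ∀ u v, thetaEven τ u * thetaOdd τ v = thetaOdd τ u * thetaEven τ v := by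
    rcases thetaEven_ne_zero_or hτ 0 with h0 | h0
    · intro u v
      exact (hcase _ _ hdQ hdP (fun u => (hW u).symm) h0 u v).symm
    · exact hcase _ _ hdP hdQ hW h0
  have := theta1_mul hτ z 0
  rw [add_zero, sub_zero, hprop z 0, sub_self] at this
  exact hz2 this

end Theta

/-! ### Differences of polynomials of noncommuting variables -/

section PolyDiff

open Polynomial

/-- `∑ p_k ∑_{i < k} aⁱ x b^{k-1-i}`: for `a = b` this is the derivative at `a` in the
direction `x` of the polynomial map given by `p`. -/
def polyDiff {A : Type*} [Ring A] [Algebra ℂ A] (p : ℂ[X]) (a x b : A) : A :=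
  ∑ k ∈ Finset.range (p.natDegree + 1),
    p.coeff k • ∑ i ∈ Finset.range k, a ^ i * x * b ^ (k - 1 - i)

theorem mul_sum_pow_sub {A : Type*} [Ring A] (a x b : A) (k : ℕ) :
    a * ∑ i ∈ Finset.range k, a ^ i * x * b ^ (k - 1 - i)
      - (∑ i ∈ Finset.range k, a ^ i * x * b ^ (k - 1 - i)) * b = a ^ k * x - x * b ^ k := by
  have h := Finset.sum_range_sub (fun i => a ^ i * x * b ^ (k - i)) k
  simp only [Nat.sub_self, pow_zero, mul_one, one_mul, Nat.sub_zero] at h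
  rw [← h, Finset.mul_sum, Finset.sum_mul, ← Finset.sum_sub_distrib]
  refine Finset.sum_congr rfl fun i hi => ?_
  have hi' := Finset.mem_range.1 hi
  rw [show k - i = k - 1 - i + 1 by omega, show k - (i + 1) = k - 1 - i by omega]
  simp only [pow_succ b, pow_succ' a, mul_assoc]

variable {A : Type*} [Ring A] [Algebra ℂ A]

/-- Telescoping. With x = 1 and commuting arguments this says that `polyDiff` is the divided
difference of p. -/
theorem mul_polyDiff_sub (p : ℂ[X]) (a x b : A) :
    a * polyDiff p a x b - polyDiff p a x b * b = aeval a p * x - x * aeval b p := by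
  rw [polyDiff, Finset.mul_sum, Finset.sum_mul, ← Finset.sum_sub_distrib, aeval_eq_sum_range,
    aeval_eq_sum_range, Finset.sum_mul, Finset.mul_sum, ← Finset.sum_sub_distrib]
  refine Finset.sum_congr rfl fun k _ => ?_
  rw [mul_smul_comm, smul_mul_assoc, ← smul_sub, mul_sum_pow_sub, smul_sub, smul_mul_assoc,
    mul_smul_comm]

/-- Conjugation moves p(a) along with a; this is the infinitesimal form, again by telescoping. It is
the source of the equivariance under G_0. -/
theorem polyDiff_commutator (p : ℂ[X]) (a t : A) :
    polyDiff p a (t * a - a * t) a = t * aeval a p - aeval a p * t := by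
  rw [polyDiff, aeval_eq_sum_range, Finset.sum_mul, Finset.mul_sum, ← Finset.sum_sub_distrib]
  refine Finset.sum_congr rfl fun k _ => ?_
  rw [mul_smul_comm, smul_mul_assoc, ← smul_sub]
  congr 1
  have h := Finset.sum_range_sub' (fun i => a ^ i * t * a ^ (k - i)) k
  simp only [Nat.sub_self, pow_zero, mul_one, one_mul, Nat.sub_zero] at h
  rw [← h]
  refine Finset.sum_congr rfl fun i hi => ?_
  have hi' := Finset.mem_range.1 hi
  rw [show k - i = k - 1 - i + 1 by omega, show k - (i + 1) = k - 1 - i by omega]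
  rw [mul_sub, sub_mul]
  simp only [pow_succ a i, pow_succ' a (k - 1 - i), mul_assoc]

theorem map_polyDiff {A' : Type*} [Ring A'] [Algebra ℂ A'] (φ : A →ₐ[ℂ] A') (p : ℂ[X])
    (a x b : A) : φ (polyDiff p a x b) = polyDiff p (φ a) (φ x) (φ b) := by
  simp [polyDiff]

theorem polyDiff_add (p : ℂ[X]) (a x y b : A) :
    polyDiff p a (x + y) b = polyDiff p a x b + polyDiff p a y b := by
  simp only [polyDiff, mul_add, add_mul, Finset.sum_add_distrib, smul_add]

theorem polyDiff_smul (p : ℂ[X]) (c : ℂ) (a x b : A) :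
    polyDiff p a (c • x) b = c • polyDiff p a x b := by
  simp only [polyDiff, mul_smul_comm, smul_mul_assoc, ← Finset.smul_sum, smul_comm _ c]

theorem eval_polyDiff (p : ℂ[X]) (a b : ℂ) :
    (a - b) * polyDiff p a 1 b = p.eval a - p.eval b := by
  have := mul_polyDiff_sub p a 1 b
  simp only [coe_aeval_eq_eval, mul_one, one_mul] at this
  rw [← this]
  ring

end PolyDiff

/-! ### Division of holomorphic functions by polynomials -/

section Division

open Polynomial

/-- Division with remainder, one root at a time: each further root l is split off from the quotient
g as g(w) = g(l) + (w - l) g₁(w), with g₁ holomorphic by removable singularities. Multiplicities are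
covered, since `s` is a multiset. -/
theorem exists_eval_add_prod_mul {U : Set ℂ} (hU : IsOpen U) {H : ℂ → ℂ}
    (hH : DifferentiableOn ℂ H U) (s : Multiset ℂ) (hs : ∀ l ∈ s, l ∈ U) :
    ∃ (p : ℂ[X]) (g : ℂ → ℂ), DifferentiableOn ℂ g U ∧
      ∀ w ∈ U, H w = p.eval w + (s.map fun l => X - C l).prod.eval w * g w := by
  induction s using Multiset.induction_on with
  | empty => exact ⟨0, H, hH, by simp⟩
  | cons l s ih =>
    obtain ⟨p, g, hg, h⟩ := ih fun l' hl' => hs l' (Multiset.mem_cons_of_mem hl')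
    have hl : l ∈ U := hs l (Multiset.mem_cons_self l s)
    refine ⟨p + C (g l) * (s.map fun l => X - C l).prod, dslope g l,
      (Complex.differentiableOn_dslope (hU.mem_nhds hl)).2 hg, fun w hw => ?_⟩
    have hd := sub_smul_dslope g l w
    rw [smul_eq_mul] at hd
    rw [h w hw, Multiset.map_cons, Multiset.prod_cons, eval_add, eval_mul, eval_mul, eval_sub,
      eval_X, eval_C, eval_C]
    linear_combination -(eval w (Multiset.map (fun l => X - C l) s).prod) * hd

theorem exists_eval_add_mul {U : Set ℂ} (hU : IsOpen U) {H : ℂ → ℂ}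
    (hH : DifferentiableOn ℂ H U) {c : ℂ[X]} (hc : c.Monic) (hroot : ∀ l, c.IsRoot l → l ∈ U) :
    ∃ (p : ℂ[X]) (g : ℂ → ℂ), DifferentiableOn ℂ g U ∧
      ∀ w ∈ U, H w = p.eval w + c.eval w * g w := by
  obtain ⟨p, g, hg, h⟩ := exists_eval_add_prod_mul hU hH c.roots
    fun l hl => hroot l (isRoot_of_mem_roots hl)
  refine ⟨p, g, hg, ?_⟩
  rwa [← (IsAlgClosed.splits c).eq_prod_roots_of_monic hc] at h

end Division

/-! ### The holomorphic functional calculus -/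

section HolCalc

open Polynomial

/-- The circles of radius `ρ` around the points of `S` form a contour in `U` around `K`. -/
structure IsContour (U : Set ℂ) (S : Finset ℂ) (ρ : ℝ) (K : Set ℂ) : Prop where
  pos : 0 < ρ
  subset : ∀ l ∈ S, Metric.closedBall l ρ ⊆ U
  disjoint : ∀ l ∈ S, ∀ l' ∈ S, l ≠ l' →
    Disjoint (Metric.closedBall l ρ) (Metric.closedBall l' ρ)
  cover : ∀ μ ∈ K, ∃ l ∈ S, μ ∈ Metric.ball l ρ

theorem IsContour.notMem {U : Set ℂ} {S : Finset ℂ} {ρ : ℝ} {K : Set ℂ} (h : IsContour U S ρ K)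
    {l ζ : ℂ} (hl : l ∈ S) (hζ : ζ ∈ Metric.sphere l ρ) : ζ ∉ K := by
  intro hK
  obtain ⟨l', hl', hb⟩ := h.cover ζ hK
  by_cases e : l = l'
  · subst e
    rw [Metric.mem_sphere] at hζ
    rw [Metric.mem_ball] at hb
    exact hb.ne hζ
  · exact Set.disjoint_left.1 (h.disjoint l hl l' hl' e) (Metric.sphere_subset_closedBall hζ)
      (Metric.ball_subset_closedBall hb)

theorem eventually_isContour {U : Set ℂ} (hU : IsOpen U) (S : Finset ℂ) {K : Set ℂ}
    (hSU : ∀ l ∈ S, l ∈ U) (hK : K ⊆ S) : ∀ᶠ ρ in 𝓝[>] (0 : ℝ), IsContour U S ρ K := by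
  have h1 : ∀ᶠ ρ in 𝓝[>] (0 : ℝ), ∀ l ∈ S, Metric.closedBall l ρ ⊆ U := by
    rw [eventually_all_finset]
    intro l hl
    obtain ⟨r, hr, hb⟩ := Metric.nhds_basis_closedBall.mem_iff.1 (hU.mem_nhds (hSU l hl))
    filter_upwards [Ioo_mem_nhdsGT hr] with ρ hρ
    exact (Metric.closedBall_subset_closedBall hρ.2.le).trans hb
  have h2 : ∀ᶠ ρ in 𝓝[>] (0 : ℝ), ∀ l ∈ S, ∀ l' ∈ S, l ≠ l' →
      Disjoint (Metric.closedBall l ρ) (Metric.closedBall l' ρ) := by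
    rw [eventually_all_finset]
    intro l _
    rw [eventually_all_finset]
    intro l' _
    by_cases e : l = l'
    · simp [e]
    · have hd : 0 < dist l l' / 2 := half_pos (dist_pos.2 e)
      filter_upwards [Ioo_mem_nhdsGT hd] with ρ hρ _
      exact Metric.closedBall_disjoint_closedBall (by linarith [hρ.2])
  filter_upwards [h1, h2, self_mem_nhdsWithin] with ρ a1 a2 a3
  exact ⟨a3, a1, a2, fun μ hμ => ⟨μ, hK hμ, Metric.mem_ball_self a3⟩⟩

variable {V : Type*} [AddCommGroup V] [Module ℂ V]

theorem sub_mul_resolvent {A : Module.End ℂ V} {ζ : ℂ} (hζ : ζ ∉ spectrum ℂ A) :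
    (algebraMap ℂ (Module.End ℂ V) ζ - A) * resolvent A ζ = 1 :=
  Ring.mul_inverse_cancel _ (spectrum.notMem_iff.1 hζ)

theorem resolvent_mul_sub {A : Module.End ℂ V} {ζ : ℂ} (hζ : ζ ∉ spectrum ℂ A) :
    resolvent A ζ * (algebraMap ℂ (Module.End ℂ V) ζ - A) = 1 :=
  Ring.inverse_mul_cancel _ (spectrum.notMem_iff.1 hζ)

/-- The difference between p(ζ) and p(A) on the resolvent is a polynomial in ζ, which contributes
nothing to a contour integral. For the characteristic polynomial, Cayley-Hamilton kills the p(A)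
term, so its product with the resolvent has no poles at all. -/
theorem eval_smul_resolvent {A : Module.End ℂ V} {ζ : ℂ} (hζ : ζ ∉ spectrum ℂ A) (p : ℂ[X]) :
    p.eval ζ • resolvent A ζ = aeval A p * resolvent A ζ
      + polyDiff p (algebraMap ℂ (Module.End ℂ V) ζ) 1 A := by
  have h1 := mul_polyDiff_sub p (algebraMap ℂ (Module.End ℂ V) ζ) 1 A
  have hc : ∀ B : Module.End ℂ V, algebraMap ℂ (Module.End ℂ V) ζ * B =
    B * algebraMap ℂ (Module.End ℂ V) ζ := fun B => Algebra.commutes ζ B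
  have h2 : polyDiff p (algebraMap ℂ (Module.End ℂ V) ζ) 1 A *
      (algebraMap ℂ (Module.End ℂ V) ζ - A) =
      p.eval ζ • (1 : Module.End ℂ V) - aeval A p := by
    rw [mul_sub, ← hc, h1, mul_one, one_mul, aeval_algebraMap_apply, coe_aeval_eq_eval,
      Algebra.algebraMap_eq_smul_one]
  calc p.eval ζ • resolvent A ζ = (p.eval ζ • (1 : Module.End ℂ V) - aeval A p) * resolvent A ζ
        + aeval A p * resolvent A ζ := by rw [sub_mul, smul_one_mul]; abel
    _ = _ := by rw [← h2, mul_assoc, sub_mul_resolvent hζ, mul_one, add_comm]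

theorem differentiable_polyDiff (A : Module.End ℂ V) (p : ℂ[X]) (φ : Module.Dual ℂ V) (v : V) :
    Differentiable ℂ fun ζ : ℂ => φ (polyDiff p (algebraMap ℂ (Module.End ℂ V) ζ) 1 A v) := by
  have : (fun ζ : ℂ => φ (polyDiff p (algebraMap ℂ (Module.End ℂ V) ζ) 1 A v)) = fun ζ =>
      ∑ k ∈ Finset.range (p.natDegree + 1),
        p.coeff k * ∑ i ∈ Finset.range k, ζ ^ i * φ ((A ^ (k - 1 - i)) v) := by
    funext ζ
    simp [polyDiff, LinearMap.sum_apply, ← map_pow, Module.End.mul_apply]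
  rw [this]
  fun_prop

variable [FiniteDimensional ℂ V]

theorem charpoly_eval_ne_zero {A : Module.End ℂ V} {ζ : ℂ} (hζ : ζ ∉ spectrum ℂ A) :
    (LinearMap.charpoly A).eval ζ ≠ 0 := fun h =>
  hζ ((Module.End.mem_spectrum_iff_isRoot_charpoly A ζ).2 h)

theorem resolvent_apply_eq {A : Module.End ℂ V} {ζ : ℂ} (hζ : ζ ∉ spectrum ℂ A)
    (φ : Module.Dual ℂ V) (v : V) : φ (resolvent A ζ v) =
      φ (polyDiff (LinearMap.charpoly A) (algebraMap ℂ (Module.End ℂ V) ζ) 1 A v) /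
        (LinearMap.charpoly A).eval ζ := by
  rw [eq_div_iff (charpoly_eval_ne_zero hζ)]
  have h := eval_smul_resolvent hζ (LinearMap.charpoly A)
  rw [LinearMap.aeval_self_charpoly, zero_mul, zero_add] at h
  rw [← h, LinearMap.smul_apply, map_smul, smul_eq_mul, mul_comm]

theorem continuousOn_resolvent (A : Module.End ℂ V) (φ : Module.Dual ℂ V) (v : V) :
    ContinuousOn (fun ζ => φ (resolvent A ζ v)) (spectrum ℂ A)ᶜ := by
  refine ContinuousOn.congr (f := fun ζ =>
    φ (polyDiff (LinearMap.charpoly A) (algebraMap ℂ (Module.End ℂ V) ζ) 1 A v) /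
        (LinearMap.charpoly A).eval ζ) ?_ fun ζ hζ => resolvent_apply_eq hζ φ v
  exact (differentiable_polyDiff A _ φ v).continuous.continuousOn.div
    (LinearMap.charpoly A).continuous.continuousOn fun ζ hζ => charpoly_eval_ne_zero hζ

theorem IsContour.circleIntegrable_resolvent {U : Set ℂ} {S : Finset ℂ} {ρ : ℝ}
    {A : Module.End ℂ V} (h : IsContour U S ρ (spectrum ℂ A)) {l : ℂ} (hl : l ∈ S)
    (φ : Module.Dual ℂ V) (v : V) : CircleIntegrable (fun ζ => φ (resolvent A ζ v)) l ρ :=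
  ((continuousOn_resolvent A φ v).mono fun _ hζ => h.notMem hl hζ).circleIntegrable h.pos.le

-- The Neumann series of the resolvent around μ terminates on a generalised eigenvector.
omit [FiniteDimensional ℂ V] in
theorem resolvent_apply_of_pow_eq_zero {A : Module.End ℂ V} {ζ μ : ℂ} (hζ : ζ ∉ spectrum ℂ A)
    (hne : ζ ≠ μ) {K : ℕ} {v : V} (hv : ((A - μ • 1) ^ K) v = 0) :
    resolvent A ζ v = ∑ k ∈ Finset.range K, (ζ - μ) ^ (-(k + 1 : ℤ)) • ((A - μ • 1) ^ k) v := by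
  have hne' : ζ - μ ≠ 0 := sub_ne_zero.2 hne
  have key : (algebraMap ℂ (Module.End ℂ V) ζ - A)
      (∑ k ∈ Finset.range K, (ζ - μ) ^ (-(k + 1 : ℤ)) • ((A - μ • 1) ^ k) v) = v := by
    have e : (algebraMap ℂ (Module.End ℂ V) ζ - A) = (ζ - μ) • 1 - (A - μ • 1) := by
      rw [Algebra.algebraMap_eq_smul_one, sub_smul]
      abel
    have h := Finset.sum_range_sub' (fun k : ℕ => (ζ - μ) ^ (-(k : ℤ)) • ((A - μ • 1) ^ k) v) K
    rw [hv] at h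
    simp only [Nat.cast_zero, neg_zero, zpow_zero, pow_zero, Module.End.one_apply, one_smul,
      smul_zero, sub_zero] at h
    rw [e, map_sum]
    conv_rhs => rw [← h]
    refine Finset.sum_congr rfl fun k _ => ?_
    rw [map_smul, LinearMap.sub_apply, LinearMap.smul_apply, Module.End.one_apply, smul_sub,
      smul_smul, ← Module.End.mul_apply, ← pow_succ', ← zpow_add_one₀ hne']
    push_cast
    congr 3
    ring
  calc resolvent A ζ v = (resolvent A ζ * (algebraMap ℂ (Module.End ℂ V) ζ - A))
        (∑ k ∈ Finset.range K, (ζ - μ) ^ (-(k + 1 : ℤ)) • ((A - μ • 1) ^ k) v) := by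
        rw [Module.End.mul_apply, key]
    _ = _ := by rw [resolvent_mul_sub hζ, Module.End.one_apply]

/-- The sum of the Riesz projections is the identity. -/
theorem IsContour.sum_integral_resolvent {U : Set ℂ} {S : Finset ℂ} {ρ : ℝ}
    {A : Module.End ℂ V} (h : IsContour U S ρ (spectrum ℂ A)) (φ : Module.Dual ℂ V) (v : V) :
    ∑ l ∈ S, (2 * Real.pi * Complex.I : ℂ)⁻¹ * (∮ ζ in C(l, ρ), φ (resolvent A ζ v)) = φ v := by
  have hv : v ∈ ⨆ μ : ℂ, A.maxGenEigenspace μ := by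
    rw [Module.End.iSup_maxGenEigenspace_eq_top]; trivial
  refine Submodule.iSup_induction _ (motive := fun v => ∑ l ∈ S,
    (2 * Real.pi * Complex.I : ℂ)⁻¹ * (∮ ζ in C(l, ρ), φ (resolvent A ζ v)) = φ v) hv ?_ ?_ ?_
  · intro μ v hv
    by_cases hv0 : v = 0
    · subst hv0
      simp [circleIntegral]
    obtain ⟨K, hK⟩ := (Module.End.mem_maxGenEigenspace A μ v).1 hv
    have hμ : μ ∈ spectrum ℂ A := by
      by_contra hne
      have hu : IsUnit (A - μ • (1 : Module.End ℂ V)) := by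
        have := (spectrum.notMem_iff.1 hne).neg
        rwa [neg_sub, Algebra.algebraMap_eq_smul_one] at this
      obtain ⟨B, hB⟩ := (hu.pow K).exists_left_inv
      apply hv0
      rw [← Module.End.one_apply (R := ℂ) v, ← hB, Module.End.mul_apply, hK, map_zero]
    obtain ⟨l₀, hl₀, hb⟩ := h.cover μ hμ
    have hint : ∀ l ∈ S, (∮ ζ in C(l, ρ), φ (resolvent A ζ v)) =
        if l = l₀ then 2 * Real.pi * Complex.I * φ v else 0 := by
      intro l hl
      have e1 : (∮ ζ in C(l, ρ), φ (resolvent A ζ v)) = ∮ ζ in C(l, ρ),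
          ∑ k ∈ Finset.range K, (ζ - μ) ^ (-(k + 1 : ℤ)) * φ (((A - μ • 1) ^ k) v) := by
        refine circleIntegral.integral_congr h.pos.le fun ζ hζ => ?_
        have hζs := h.notMem hl hζ
        rw [resolvent_apply_of_pow_eq_zero hζs (fun e => hζs (e ▸ hμ)) hK]
        simp
      have hci : ∀ k ∈ Finset.range K, CircleIntegrable
          (fun ζ => (ζ - μ) ^ (-(k + 1 : ℤ)) * φ (((A - μ • 1) ^ k) v)) l ρ := by
        intro k _
        refine ContinuousOn.circleIntegrable h.pos.le (ContinuousOn.mul ?_ continuousOn_const)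
        refine ContinuousOn.zpow₀ (by fun_prop) _ fun ζ hζ => Or.inl ?_
        exact sub_ne_zero.2 fun e => h.notMem hl hζ (e ▸ hμ)
      have hK0 : K ≠ 0 := by
        rintro rfl
        exact hv0 (by simpa using hK)
      obtain ⟨K', rfl⟩ := Nat.exists_eq_succ_of_ne_zero hK0
      rw [e1, circleIntegral.integral_fun_sum hci, Finset.sum_range_succ']
      -- Higher powers of (ζ - μ)⁻¹ have a primitive; only the simple pole contributes, and only on
      -- the circle that encloses μ.
      have e2 : ∀ k ∈ Finset.range K', (∮ ζ in C(l, ρ),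
          (ζ - μ) ^ (-((k + 1 : ℕ) + 1 : ℤ)) * φ (((A - μ • 1) ^ (k + 1)) v)) = 0 := by
        intro k _
        have hk : (-((k + 1 : ℕ) + 1 : ℤ)) ≠ -1 := by omega
        have := circleIntegral.integral_sub_zpow_of_ne hk l μ ρ
        have e := circleIntegral.integral_const_mul (φ (((A - μ • 1) ^ (k + 1)) v))
          (fun ζ => (ζ - μ) ^ (-((k + 1 : ℕ) + 1 : ℤ))) l ρ
        rw [this, mul_zero] at e
        simpa only [mul_comm] using e
      rw [Finset.sum_eq_zero e2, zero_add]
      have e3 : (∮ ζ in C(l, ρ), (ζ - μ) ^ (-((0 : ℕ) + 1 : ℤ)) * φ (((A - μ • (1 : Module.End ℂ V)) ^ 0) v)) =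
          φ v * ∮ ζ in C(l, ρ), (ζ - μ)⁻¹ := by
        rw [← circleIntegral.integral_const_mul]
        simp [mul_comm]
      rw [e3]
      split_ifs with hll
      · subst hll
        rw [circleIntegral.integral_sub_inv_of_mem_ball hb, mul_comm]
      · have hout : μ ∉ Metric.closedBall l ρ := fun hm =>
          Set.disjoint_left.1 (h.disjoint l hl l₀ hl₀ hll) hm (Metric.ball_subset_closedBall hb)
        have hd : DifferentiableOn ℂ (fun ζ : ℂ => (ζ - μ)⁻¹) (Metric.closedBall l ρ) := by
          refine DifferentiableOn.inv (by fun_prop) fun ζ hζ => ?_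
          exact sub_ne_zero.2 fun e => hout (e ▸ hζ)
        rw [(hd.mono Metric.closure_ball_subset_closedBall).diffContOnCl.circleIntegral_eq_zero
          h.pos.le, mul_zero]
    rw [Finset.sum_congr rfl fun l hl => by rw [hint l hl]]
    simp only [mul_ite, mul_zero, Finset.sum_ite_eq', hl₀, if_true]
    rw [inv_mul_cancel_left₀ Complex.two_pi_I_ne_zero]
  · simp [circleIntegral]
  · intro x y hx hy
    rw [map_add, ← hx, ← hy, ← Finset.sum_add_distrib]
    refine Finset.sum_congr rfl fun l hl => ?_
    rw [← mul_add, ← circleIntegral.integral_add (h.circleIntegrable_resolvent hl φ x)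
      (h.circleIntegrable_resolvent hl φ y)]
    simp

/-- Writing H = p + c g with c the characteristic polynomial, the product c(ζ) (ζ - A)⁻¹ is
polynomial in ζ, so the g part is holomorphic inside the circles and integrates to zero. The p part
reduces to the sum of the Riesz projections. -/
theorem IsContour.sum_integral_mul_resolvent {U : Set ℂ} {S : Finset ℂ}
    {ρ : ℝ} {A : Module.End ℂ V} (h : IsContour U S ρ (spectrum ℂ A)) {H g : ℂ → ℂ} {p : ℂ[X]}
    (hg : DifferentiableOn ℂ g U)
    (hH : ∀ w ∈ U, H w = p.eval w + (LinearMap.charpoly A).eval w * g w)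
    (φ : Module.Dual ℂ V) (v : V) :
    ∑ l ∈ S, (2 * Real.pi * Complex.I : ℂ)⁻¹ * (∮ ζ in C(l, ρ), H ζ * φ (resolvent A ζ v)) =
      φ (aeval A p v) := by
  refine Eq.trans ?_ (h.sum_integral_resolvent (φ ∘ₗ aeval A p) v)
  refine Finset.sum_congr rfl fun l hl => ?_
  congr 1
  set F : ℂ → ℂ := fun ζ => φ (polyDiff p (algebraMap ℂ (Module.End ℂ V) ζ) 1 A v) +
    g ζ * φ (polyDiff (LinearMap.charpoly A) (algebraMap ℂ (Module.End ℂ V) ζ) 1 A v) with hF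
  have hFd : DifferentiableOn ℂ F (Metric.closedBall l ρ) :=
    (differentiable_polyDiff A p φ v).differentiableOn.add
      ((hg.mono (h.subset l hl)).mul (differentiable_polyDiff A _ φ v).differentiableOn)
  have hF0 : (∮ ζ in C(l, ρ), F ζ) = 0 :=
    (hFd.mono Metric.closure_ball_subset_closedBall).diffContOnCl.circleIntegral_eq_zero h.pos.le
  have e : (∮ ζ in C(l, ρ), H ζ * φ (resolvent A ζ v)) =
      ∮ ζ in C(l, ρ), (φ ∘ₗ aeval A p) (resolvent A ζ v) + F ζ := by
    refine circleIntegral.integral_congr h.pos.le fun ζ hζ => ?_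
    have hζs := h.notMem hl hζ
    have hζU := h.subset l hl (Metric.sphere_subset_closedBall hζ)
    have h1 := congrArg (fun B : Module.End ℂ V => φ (B v)) (eval_smul_resolvent hζs p)
    have h2 := congrArg (fun B : Module.End ℂ V => φ (B v))
      (eval_smul_resolvent hζs (LinearMap.charpoly A))
    simp only [LinearMap.aeval_self_charpoly, zero_mul, zero_add, LinearMap.add_apply, map_add,
      LinearMap.smul_apply, map_smul, smul_eq_mul, Module.End.mul_apply] at h1 h2
    simp only [hF, LinearMap.comp_apply]
    rw [hH ζ hζU]
    linear_combination h1 + g ζ * h2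
  rw [e, circleIntegral.integral_add (h.circleIntegrable_resolvent hl _ v)
    ((hFd.continuousOn.mono Metric.sphere_subset_closedBall).circleIntegrable h.pos.le), hF0,
    add_zero]

theorem holCalc_eq_aeval {U : Set ℂ} (hU : IsOpen U) {A : Module.End ℂ V}
    (hA : spectrum ℂ A ⊆ U) {H g : ℂ → ℂ} {p : ℂ[X]} (hg : DifferentiableOn ℂ g U)
    (hH : ∀ w ∈ U, H w = p.eval w + (LinearMap.charpoly A).eval w * g w) :
    holCalc H A = aeval A p := by
  apply (LinearMap.toMatrix (Module.finBasis ℂ V) (Module.finBasis ℂ V)).injective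
  rw [holCalc, LinearMap.toMatrix_toLin]
  ext i j
  rw [Matrix.of_apply]
  apply Tendsto.limUnder_eq
  -- The limit in the definition is that of an eventually constant function of the radius.
  refine tendsto_const_nhds.congr' ?_
  filter_upwards [eventually_isContour hU (Module.End.finite_spectrum A).toFinset
    (K := spectrum ℂ A) (fun l hl => hA (by simpa using hl)) (by simp)] with ρ hρ
  have := hρ.sum_integral_mul_resolvent hg hH ((Module.finBasis ℂ V).coord i)
    (Module.finBasis ℂ V j)
  simp only [LinearMap.toMatrix_apply, Module.Basis.coord_apply] at this ⊢
  exact this.symm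

theorem exists_eval_add_charpoly_pow_mul {U : Set ℂ} (hU : IsOpen U) {A : Module.End ℂ V}
    (hA : spectrum ℂ A ⊆ U) {H : ℂ → ℂ} (hH : DifferentiableOn ℂ H U) (n : ℕ) :
    ∃ (p : ℂ[X]) (g : ℂ → ℂ), DifferentiableOn ℂ g U ∧
      ∀ w ∈ U, H w = p.eval w + (LinearMap.charpoly A).eval w ^ n * g w := by
  obtain ⟨p, g, hg, h⟩ := exists_eval_add_mul hU hH ((LinearMap.charpoly_monic A).pow n)
    fun l hl => hA ((Module.End.mem_spectrum_iff_isRoot_charpoly A l).2 (by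
      rw [IsRoot, eval_pow] at hl
      by_contra h
      exact pow_ne_zero n h hl))
  exact ⟨p, g, hg, fun w hw => by rw [h w hw, eval_pow]⟩

/-- Any annihilating polynomial may replace the characteristic one. This lets the same data serve
(ad ω)_a and its negative transpose (ad ω)_b. -/
theorem holCalc_eq_aeval_of_aeval_eq_zero {U : Set ℂ} (hU : IsOpen U) {A : Module.End ℂ V}
    (hA : spectrum ℂ A ⊆ U) {H g : ℂ → ℂ} {p c : ℂ[X]} (hc : aeval A c = 0)
    (hg : DifferentiableOn ℂ g U) (hH : ∀ w ∈ U, H w = p.eval w + c.eval w * g w) :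
    holCalc H A = aeval A p := by
  obtain ⟨q, h, hh, hq⟩ := exists_eval_add_charpoly_pow_mul hU hA hg 1
  rw [holCalc_eq_aeval hU hA (p := p + c * q) (g := fun w => c.eval w * h w)
    (c.differentiable.differentiableOn.mul hh)
    (fun w hw => by rw [hH w hw, hq w hw, eval_add, eval_mul]; ring)]
  simp [hc]

/-- The contour need not be centred at the eigenvalues of A. Hence one fixed contour serves all
operators near a given one. -/
theorem IsContour.apply_holCalc {U : Set ℂ} (hU : IsOpen U) {S : Finset ℂ}
    {ρ : ℝ} {A : Module.End ℂ V} (h : IsContour U S ρ (spectrum ℂ A)) {H : ℂ → ℂ}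
    (hH : DifferentiableOn ℂ H U) (φ : Module.Dual ℂ V) (v : V) :
    φ (holCalc H A v) = ∑ l ∈ S, (2 * Real.pi * Complex.I : ℂ)⁻¹ *
      (∮ ζ in C(l, ρ), H ζ * φ (resolvent A ζ v)) := by
  have hA : spectrum ℂ A ⊆ U := fun μ hμ => by
    obtain ⟨l, hl, hb⟩ := h.cover μ hμ
    exact h.subset l hl (Metric.ball_subset_closedBall hb)
  obtain ⟨p, g, hg, hp⟩ := exists_eval_add_charpoly_pow_mul hU hA hH 1
  simp only [pow_one] at hp
  rw [holCalc_eq_aeval hU hA hg hp, h.sum_integral_mul_resolvent hg hp]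

end HolCalc

/-! ### Derivatives and residues of vector-valued functions -/

section VecCalculus

variable {V W : Type*} [AddCommGroup V] [Module ℂ V] [AddCommGroup W] [Module ℂ W]

theorem HasVecDerivAt.map {f : ℂ → V} {v : V} {t₀ : ℂ} (h : HasVecDerivAt f v t₀)
    (L : V →ₗ[ℂ] W) : HasVecDerivAt (fun t => L (f t)) (L v) t₀ :=
  fun φ => h (φ ∘ₗ L)

theorem HasVecDerivAt.sum {ι : Type*} (s : Finset ι) {f : ι → ℂ → V} {v : ι → V} {t₀ : ℂ}
    (h : ∀ i ∈ s, HasVecDerivAt (f i) (v i) t₀) :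
    HasVecDerivAt (fun t => ∑ i ∈ s, f i t) (∑ i ∈ s, v i) t₀ := by
  intro φ
  simp only [map_sum]
  exact HasDerivAt.fun_sum fun i hi => h i hi φ

theorem HasResidueAt.add {f g : ℂ → ℂ} {c d z₀ : ℂ} (hf : HasResidueAt f c z₀)
    (hg : HasResidueAt g d z₀) : HasResidueAt (fun z => f z + g z) (c + d) z₀ := by
  obtain ⟨r, hr, h1, h2⟩ := hf
  obtain ⟨s, hs, k1, k2⟩ := hg
  have hsub : ∀ {t u : ℝ}, t ≤ u → Metric.ball z₀ t \ {z₀} ⊆ Metric.ball z₀ u \ {z₀} :=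
    fun h => Set.sdiff_subset_sdiff_left (Metric.ball_subset_ball h)
  refine ⟨min r s, lt_min hr hs, (h1.mono (hsub (min_le_left _ _))).add
    (k1.mono (hsub (min_le_right _ _))), fun ε h0 hε => ?_⟩
  have hci : ∀ {k : ℂ → ℂ} {u : ℝ}, DifferentiableOn ℂ k (Metric.ball z₀ u \ {z₀}) → ε < u →
      CircleIntegrable k z₀ ε := by
    intro k u hk hu
    refine (hk.continuousOn.mono fun z hz => ?_).circleIntegrable h0.le
    rw [Metric.mem_sphere] at hz
    refine ⟨by rw [Metric.mem_ball, hz]; exact hu, ?_⟩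
    rintro rfl
    rw [dist_self] at hz
    exact h0.ne hz
  rw [circleIntegral.integral_add (hci h1 (hε.trans_le (min_le_left _ _)))
    (hci k1 (hε.trans_le (min_le_right _ _))), mul_add, h2 ε h0 (hε.trans_le (min_le_left _ _)),
    k2 ε h0 (hε.trans_le (min_le_right _ _))]

theorem HasResidueAt.const_mul {f : ℂ → ℂ} {c z₀ : ℂ} (hf : HasResidueAt f c z₀) (a : ℂ) :
    HasResidueAt (fun z => a * f z) (a * c) z₀ := by
  obtain ⟨r, hr, h1, h2⟩ := hf
  refine ⟨r, hr, h1.const_mul a, fun ε h0 hε => ?_⟩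
  rw [circleIntegral.integral_const_mul, ← h2 ε h0 hε]
  ring

theorem HasResidueAt.sum {ι : Type*} (s : Finset ι) {f : ι → ℂ → ℂ} {c : ι → ℂ} {z₀ : ℂ}
    (h : ∀ i ∈ s, HasResidueAt (f i) (c i) z₀) :
    HasResidueAt (fun z => ∑ i ∈ s, f i z) (∑ i ∈ s, c i) z₀ := by
  classical
  induction s using Finset.induction_on with
  | empty =>
    exact ⟨1, one_pos, by simp, fun ε _ _ => by simp [circleIntegral]⟩
  | insert i s hi ih =>
    simp only [Finset.sum_insert hi]
    exact (h i (Finset.mem_insert_self i s)).add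
      (ih fun j hj => h j (Finset.mem_insert_of_mem hj))

theorem HasVecResidueAt.map {f : ℂ → V} {v : V} {t₀ : ℂ} (h : HasVecResidueAt f v t₀)
    (L : V →ₗ[ℂ] W) : HasVecResidueAt (fun t => L (f t)) (L v) t₀ :=
  fun φ => h (φ ∘ₗ L)

theorem HasVecResidueAt.sum {ι : Type*} (s : Finset ι) {f : ι → ℂ → V} {v : ι → V} {t₀ : ℂ}
    (h : ∀ i ∈ s, HasVecResidueAt (f i) (v i) t₀) :
    HasVecResidueAt (fun t => ∑ i ∈ s, f i t) (∑ i ∈ s, v i) t₀ := by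
  intro φ
  simp only [map_sum]
  exact HasResidueAt.sum s fun i hi => h i hi φ

/-- Every functional on `End V` is a combination of matrix entries. -/
theorem dual_end_apply {κ : Type*} [Fintype κ] [DecidableEq κ] (b : Module.Basis κ ℂ V)
    (ψ : Module.Dual ℂ (Module.End ℂ V)) (T : Module.End ℂ V) :
    ψ T = ∑ i, ∑ j, ψ (LinearMap.toSpanSingleton ℂ V (b i) ∘ₗ b.coord j) * b.coord i (T (b j)) := by
  have : T = ∑ i, ∑ j, b.coord i (T (b j)) • (LinearMap.toSpanSingleton ℂ V (b i) ∘ₗ b.coord j) := by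
    refine b.ext fun k => ?_
    simp only [LinearMap.sum_apply, LinearMap.smul_apply, LinearMap.comp_apply,
      Module.Basis.coord_apply, Module.Basis.repr_self, LinearMap.toSpanSingleton_apply]
    simp only [Finsupp.single_apply, ite_smul, one_smul, zero_smul, smul_ite, smul_zero,
      Finset.sum_ite_eq, Finset.mem_univ, if_true]
    exact (b.sum_repr _).symm
  conv_lhs => rw [this]
  simp only [map_sum, map_smul, smul_eq_mul, mul_comm]

theorem hasVecDerivAt_end [FiniteDimensional ℂ V] {F : ℂ → Module.End ℂ V} {D : Module.End ℂ V}
    {t₀ : ℂ} (h : ∀ (φ : Module.Dual ℂ V) (v : V), HasDerivAt (fun t => φ (F t v)) (φ (D v)) t₀) :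
    HasVecDerivAt F D t₀ := by
  intro ψ
  rw [funext fun t => dual_end_apply (Module.finBasis ℂ V) ψ (F t),
    dual_end_apply (Module.finBasis ℂ V) ψ D]
  exact HasDerivAt.fun_sum fun i _ => HasDerivAt.fun_sum fun j _ => (h _ _).const_mul _

theorem hasVecResidueAt_end [FiniteDimensional ℂ V] {F : ℂ → Module.End ℂ V}
    {D : Module.End ℂ V} {t₀ : ℂ}
    (h : ∀ (φ : Module.Dual ℂ V) (v : V), HasResidueAt (fun t => φ (F t v)) (φ (D v)) t₀) :
    HasVecResidueAt F D t₀ := by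
  intro ψ
  rw [funext fun t => dual_end_apply (Module.finBasis ℂ V) ψ (F t),
    dual_end_apply (Module.finBasis ℂ V) ψ D]
  exact HasResidueAt.sum _ fun i _ => HasResidueAt.sum _ fun j _ => (h _ _).const_mul _

/-- In finite dimensions testing on functionals is the same as differentiability for any norm; this
gives access to normed algebras. -/
theorem hasVecDerivAt_iff_equiv {E : Type*} [NormedAddCommGroup E] [NormedSpace ℂ E]
    [FiniteDimensional ℂ E] (e : V ≃ₗ[ℂ] E) {f : ℂ → V} {v : V} {t₀ : ℂ} :
    HasVecDerivAt f v t₀ ↔ HasDerivAt (fun t => e (f t)) (e v) t₀ := by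
  constructor
  · intro h
    have hs : ∀ x : E, x = ∑ i, (Module.finBasis ℂ E).coord i x • Module.finBasis ℂ E i :=
      fun x => ((Module.finBasis ℂ E).sum_repr x).symm
    have h1 : HasDerivAt
        (fun t => ∑ i, (Module.finBasis ℂ E).coord i (e (f t)) • Module.finBasis ℂ E i)
        (∑ i, (Module.finBasis ℂ E).coord i (e v) • Module.finBasis ℂ E i) t₀ :=
      HasDerivAt.fun_sum fun i _ =>
        (h ((Module.finBasis ℂ E).coord i ∘ₗ e.toLinearMap)).smul_const _
    rw [← hs] at h1
    exact h1.congr_of_eventuallyEq (Eventually.of_forall fun t => hs _)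
  · intro h φ
    have := ((φ ∘ₗ e.symm.toLinearMap).toContinuousLinearMap.hasFDerivAt).comp_hasDerivAt t₀ h
    simpa [Function.comp_def] using this

end VecCalculus

/-! ### The derivative of the functional calculus -/

section Derivative

open Polynomial Asymptotics

theorem hasDerivAt_aeval {𝔸 : Type*} [NormedRing 𝔸] [NormedAlgebra ℂ 𝔸] {M : ℂ → 𝔸} {X : 𝔸}
    {t₀ : ℂ} (hM : HasDerivAt M X t₀) (p : ℂ[X]) :
    HasDerivAt (fun t => aeval (M t) p) (polyDiff p (M t₀) X (M t₀)) t₀ := by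
  have hpow : ∀ k : ℕ, HasDerivAt (fun t => M t ^ k)
      (∑ i ∈ Finset.range k, M t₀ ^ i * X * M t₀ ^ (k - 1 - i)) t₀ := by
    intro k
    induction k with
    | zero => simpa using hasDerivAt_const t₀ (1 : 𝔸)
    | succ k ih =>
      have h := ih.mul hM
      simp only [pow_succ]
      refine h.congr_deriv ?_
      rw [Finset.sum_range_succ, Finset.sum_mul]
      congr 1
      · refine Finset.sum_congr rfl fun i hi => ?_
        have := Finset.mem_range.1 hi
        rw [show k + 1 - 1 - i = k - 1 - i + 1 by omega, pow_succ, mul_assoc (_ * X)]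
      · simp
  simp only [aeval_eq_sum_range]
  exact HasDerivAt.fun_sum fun k _ => (hpow k).const_smul (p.coeff k)

variable {V : Type*} [AddCommGroup V] [Module ℂ V] [FiniteDimensional ℂ V]
variable {𝔸 : Type*} [NormedRing 𝔸] [NormedAlgebra ℂ 𝔸] [CompleteSpace 𝔸]
  [FiniteDimensional ℂ 𝔸]

omit [FiniteDimensional ℂ V] [CompleteSpace 𝔸] [FiniteDimensional ℂ 𝔸] in
theorem resolvent_eq_symm (e : Module.End ℂ V ≃ₐ[ℂ] 𝔸) {A : Module.End ℂ V} {ζ : ℂ}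
    (hζ : ζ ∉ spectrum ℂ A) :
    resolvent A ζ = e.symm (Ring.inverse (algebraMap ℂ 𝔸 ζ - e A)) := by
  have hu : IsUnit (algebraMap ℂ 𝔸 ζ - e A) :=
    spectrum.notMem_iff.1 (by rwa [AlgEquiv.spectrum_eq])
  apply e.injective
  rw [e.apply_symm_apply]
  have h1 : e (resolvent A ζ) * (algebraMap ℂ 𝔸 ζ - e A) = 1 := by
    rw [← e.commutes, ← map_sub, ← map_mul, resolvent_mul_sub hζ, map_one]
  calc e (resolvent A ζ) = e (resolvent A ζ) * ((algebraMap ℂ 𝔸 ζ - e A) *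
        Ring.inverse (algebraMap ℂ 𝔸 ζ - e A)) := by rw [Ring.mul_inverse_cancel _ hu, mul_one]
    _ = _ := by rw [← mul_assoc, h1, one_mul]

-- Inversion is continuous at units, so the resolvent entries are continuous jointly in the operator
-- and in ζ; compactness of `K` makes the bound uniform for nearby operators.
omit [FiniteDimensional ℂ V] in
theorem eventually_resolvent_bounded (e : Module.End ℂ V ≃ₐ[ℂ] 𝔸) {A : ℂ → Module.End ℂ V}
    (hA : ContinuousAt (fun s => e (A s)) 0) {K : Set ℂ} (hK : IsCompact K)
    (hKA : ∀ ζ ∈ K, ζ ∉ spectrum ℂ (A 0)) (φ : Module.Dual ℂ V) (v : V) :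
    ∃ C, ∀ᶠ s in 𝓝 (0 : ℂ), ∀ ζ ∈ K, ζ ∉ spectrum ℂ (A s) → ‖φ (resolvent (A s) ζ v)‖ ≤ C := by
  set Φ : 𝔸 →L[ℂ] ℂ := (φ ∘ₗ (LinearMap.applyₗ v) ∘ₗ e.symm.toLinearMap).toContinuousLinearMap
    with hΦ
  have hΦe : ∀ B, Φ B = φ (e.symm B v) := fun B => rfl
  set F : 𝔸 × ℂ → ℂ := fun q => Φ (Ring.inverse (algebraMap ℂ 𝔸 q.2 - q.1)) with hF
  have hcont : ∀ ζ ∈ K, ContinuousAt F (e (A 0), ζ) := by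
    intro ζ hζ
    have hu : IsUnit (algebraMap ℂ 𝔸 ζ - e (A 0)) :=
      spectrum.notMem_iff.1 (by rw [AlgEquiv.spectrum_eq]; exact hKA ζ hζ)
    obtain ⟨u, hu⟩ := hu
    have h1 : ContinuousAt Ring.inverse (algebraMap ℂ 𝔸 ζ - e (A 0)) := by
      rw [← hu]; exact NormedRing.inverse_continuousAt u
    have h2 : ContinuousAt (fun q : 𝔸 × ℂ => algebraMap ℂ 𝔸 q.2 - q.1) (e (A 0), ζ) :=
      (((continuous_algebraMap ℂ 𝔸).comp continuous_snd).sub continuous_fst).continuousAt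
    have h3 : ContinuousAt (fun q : 𝔸 × ℂ => Ring.inverse (algebraMap ℂ 𝔸 q.2 - q.1))
        (e (A 0), ζ) := ContinuousAt.comp (g := Ring.inverse) h1 h2
    exact Φ.continuous.continuousAt.comp h3
  have hcK : ContinuousOn (fun ζ => F (e (A 0), ζ)) K := fun ζ hζ =>
    ((hcont ζ hζ).comp (f := fun ζ => (e (A 0), ζ)) (by fun_prop)).continuousWithinAt
  obtain ⟨C, hC⟩ := hK.exists_bound_of_continuousOn hcK
  refine ⟨C + 1, ?_⟩
  have hev := hK.eventually_forall_of_forall_eventually (x₀ := e (A 0))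
    (P := fun a ζ => ‖F (a, ζ)‖ < C + 1) (fun ζ hζ =>
      (hcont ζ hζ).norm.eventually_lt_const ((hC ζ hζ).trans_lt (lt_add_one C)))
  filter_upwards [hA.eventually hev] with s hs ζ hζ hζs
  rw [resolvent_eq_symm e hζs, ← hΦe]
  exact (hs ζ hζ).le

/-- With c the characteristic polynomial of A(0), H(A(s)) = p(A(s)) + c(A(s))² g(A(s)). Since
c(A(0)) = 0, the factor c(A(s)) is O(s), while g(A(s)) stays bounded; so the last term is O(s²) and
only p contributes to the derivative. This is why agreement to second order is required. -/
theorem hasVecDerivAt_holCalc_aux (e : Module.End ℂ V ≃ₐ[ℂ] 𝔸) {U : Set ℂ} (hU : IsOpen U)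
    {H g : ℂ → ℂ} {p : ℂ[X]} {A : ℂ → Module.End ℂ V} {X : Module.End ℂ V}
    (hA : HasVecDerivAt A X 0) (hs : spectrum ℂ (A 0) ⊆ U) (hg : DifferentiableOn ℂ g U)
    (hH : ∀ w ∈ U, H w = p.eval w + (LinearMap.charpoly (A 0)).eval w ^ 2 * g w) :
    HasVecDerivAt (fun s => holCalc H (A s)) (polyDiff p (A 0) X (A 0)) 0 := by
  set c := LinearMap.charpoly (A 0) with hc
  have hM : HasDerivAt (fun s => e (A s)) (e X) 0 := (hasVecDerivAt_iff_equiv e.toLinearEquiv).1 hA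
  obtain ⟨ρ, hρ⟩ := (eventually_isContour hU (Module.End.finite_spectrum (A 0)).toFinset
    (K := spectrum ℂ (A 0)) (fun l hl => hs (by simpa using hl)) (by simp)).exists
  set S := (Module.End.finite_spectrum (A 0)).toFinset
  have hcontour : ∀ᶠ s in 𝓝 (0 : ℂ), IsContour U S ρ (spectrum ℂ (A s)) := by
    set W : Set ℂ := ⋃ l ∈ S, Metric.ball l ρ with hW
    have hWo : IsOpen W := isOpen_biUnion fun l _ => Metric.isOpen_ball
    have hsub : spectrum ℂ (e (A 0)) ⊆ W := by
      rw [AlgEquiv.spectrum_eq]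
      intro μ hμ
      obtain ⟨l, hl, hb⟩ := hρ.cover μ hμ
      exact Set.mem_biUnion hl hb
    -- Upper semicontinuity of the spectrum: for small s the eigenvalues of A(s) stay inside the
    -- circles chosen for A(0).
    have hup := upperHemicontinuous_spectrum ℂ 𝔸 (e (A 0)) W (hWo.mem_nhdsSet.2 hsub)
    filter_upwards [hM.continuousAt.eventually hup] with s hs'
    refine ⟨hρ.pos, hρ.subset, hρ.disjoint, fun μ hμ => ?_⟩
    have h1 := subset_of_mem_nhdsSet hs'
    rw [AlgEquiv.spectrum_eq] at h1
    simpa [hW] using h1 hμ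
  have hsU : ∀ᶠ s in 𝓝 (0 : ℂ), spectrum ℂ (A s) ⊆ U := by
    filter_upwards [hcontour] with s hs' μ hμ
    obtain ⟨l, hl, hb⟩ := hs'.cover μ hμ
    exact hs'.subset l hl (Metric.ball_subset_closedBall hb)
  have hdec : ∀ᶠ s in 𝓝 (0 : ℂ), holCalc H (A s) =
      aeval (A s) p + aeval (A s) c * aeval (A s) c * holCalc g (A s) := by
    filter_upwards [hsU] with s hs'
    obtain ⟨q, h, hh, hq⟩ := exists_eval_add_charpoly_pow_mul hU hs' hg 1
    simp only [pow_one] at hq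
    rw [holCalc_eq_aeval hU hs' hh hq, holCalc_eq_aeval hU hs' (p := p + c * c * q)
      (g := fun w => c.eval w ^ 2 * h w)
      ((c.differentiable.differentiableOn.pow 2).mul hh)
      (fun w hw => by rw [hH w hw, hq w hw, eval_add, eval_mul, eval_mul]; ring)]
    simp [mul_assoc]
  have hbdd : ∀ (φ : Module.Dual ℂ V) (v : V),
      (fun s => φ (holCalc g (A s) v)) =O[𝓝 (0 : ℂ)] fun _ => (1 : ℂ) := by
    intro φ v
    set K : Set ℂ := ⋃ l ∈ S, Metric.sphere l ρ with hKdef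
    have hK : IsCompact K := S.isCompact_biUnion fun l _ => isCompact_sphere l ρ
    obtain ⟨C, hC⟩ := eventually_resolvent_bounded e hM.continuousAt hK (fun ζ hζ => by
      obtain ⟨l, hl, hb⟩ := Set.mem_iUnion₂.1 hζ
      exact hρ.notMem hl hb) φ v
    obtain ⟨D, hD⟩ := hK.exists_bound_of_continuousOn (hg.continuousOn.mono fun ζ hζ => by
      obtain ⟨l, hl, hb⟩ := Set.mem_iUnion₂.1 hζ
      exact hρ.subset l hl (Metric.sphere_subset_closedBall hb))
    refine IsBigO.of_bound
      (∑ l ∈ S, ‖(2 * Real.pi * Complex.I : ℂ)⁻¹‖ * (2 * Real.pi * ρ * (D * C))) ?_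
    filter_upwards [hC, hcontour] with s hs1 hs2
    rw [hs2.apply_holCalc hU hg, norm_one, mul_one]
    refine norm_sum_le_of_le _ fun l hl => ?_
    rw [norm_mul]
    refine mul_le_mul_of_nonneg_left ?_ (norm_nonneg _)
    refine circleIntegral.norm_integral_le_of_norm_le_const hρ.pos.le fun ζ hζ => ?_
    have hζK : ζ ∈ K := Set.mem_biUnion hl hζ
    rw [norm_mul]
    exact mul_le_mul (hD ζ hζK) (hs1 ζ hζK (hs2.notMem hl hζ)) (norm_nonneg _)
      ((norm_nonneg _).trans (hD ζ hζK))
  have hcO : (fun s => aeval (e (A s)) c) =O[𝓝 (0 : ℂ)] fun s : ℂ => s := by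
    have h0 : aeval (e (A 0)) c = 0 := by
      rw [aeval_algHom_apply, hc, LinearMap.aeval_self_charpoly, map_zero]
    simpa [h0] using (hasDerivAt_aeval hM c).isBigO_sub
  have hcsq : ∀ (φ : Module.Dual ℂ V) (v : V),
      (fun s => φ ((aeval (A s) c * aeval (A s) c) v)) =O[𝓝 (0 : ℂ)] fun s : ℂ => s * s := by
    intro φ v
    set Φ : 𝔸 →L[ℂ] ℂ := (φ ∘ₗ (LinearMap.applyₗ v) ∘ₗ e.symm.toLinearMap).toContinuousLinearMap
    have hΦe : ∀ B, Φ B = φ (e.symm B v) := fun B => rfl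
    have h1 := (Φ.isBigO_comp (fun s => aeval (e (A s)) c * aeval (e (A s)) c) (𝓝 (0 : ℂ))).trans
      (hcO.mul hcO)
    refine h1.congr_left fun s => ?_
    rw [hΦe, aeval_algHom_apply, ← map_mul, e.symm_apply_apply]
  have hp : HasVecDerivAt (fun s => aeval (A s) p) (polyDiff p (A 0) X (A 0)) 0 := by
    rw [hasVecDerivAt_iff_equiv e.toLinearEquiv]
    have := hasDerivAt_aeval hM p
    simp only [aeval_algHom_apply] at this
    refine this.congr_deriv ?_
    exact (map_polyDiff e.toAlgHom p (A 0) X (A 0)).symm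
  refine hasVecDerivAt_end fun φ v => ?_
  have h1 : HasDerivAt (fun s => φ (aeval (A s) p v)) (φ (polyDiff p (A 0) X (A 0) v)) 0 :=
    (hp.map (LinearMap.applyₗ v)) φ
  have h2 : HasDerivAt
      (fun s => φ ((aeval (A s) c * aeval (A s) c * holCalc g (A s)) v)) 0 0 := by
    have hO : (fun s => φ ((aeval (A s) c * aeval (A s) c * holCalc g (A s)) v)) =O[𝓝 (0 : ℂ)]
        fun s : ℂ => s * s := by
      -- Expanding the vector g(A(s)) v in a basis turns the composition into a sum of scalar
      -- products of an O(s²) and an O(1) factor.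
      have e1 : ∀ s, φ ((aeval (A s) c * aeval (A s) c * holCalc g (A s)) v) =
          ∑ k, φ ((aeval (A s) c * aeval (A s) c) (Module.finBasis ℂ V k)) *
            (Module.finBasis ℂ V).coord k (holCalc g (A s) v) := by
        intro s
        rw [Module.End.mul_apply _ (holCalc g (A s))]
        conv_lhs => rw [← (Module.finBasis ℂ V).sum_repr (holCalc g (A s) v)]
        simp only [map_sum, map_smul, smul_eq_mul, Module.Basis.coord_apply]
        exact Finset.sum_congr rfl fun k _ => mul_comm _ _
      simp only [e1]
      refine IsBigO.fun_sum fun k _ => ?_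
      simpa using (hcsq φ (Module.finBasis ℂ V k)).mul (hbdd ((Module.finBasis ℂ V).coord k) v)
    have := (IsBigO.hasFDerivAt (𝕜 := ℂ) (x₀ := (0 : ℂ)) (n := 2)
      (hO.trans (IsBigO.of_bound 1 (Eventually.of_forall fun s => by simp [sq])))
      one_lt_two).hasDerivAt
    simpa using this
  have h3 := h1.add h2
  rw [add_zero] at h3
  refine h3.congr_of_eventuallyEq ?_
  filter_upwards [hdec] with s hs'
  rw [hs']
  simp

section

attribute [local instance] Matrix.linftyOpNormedRing Matrix.linftyOpNormedAlgebra

theorem hasVecDerivAt_holCalc {U : Set ℂ} (hU : IsOpen U)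
    {H g : ℂ → ℂ} {p : ℂ[X]} {A : ℂ → Module.End ℂ V} {X : Module.End ℂ V}
    (hA : HasVecDerivAt A X 0) (hs : spectrum ℂ (A 0) ⊆ U) (hg : DifferentiableOn ℂ g U)
    (hH : ∀ w ∈ U, H w = p.eval w + (LinearMap.charpoly (A 0)).eval w ^ 2 * g w) :
    HasVecDerivAt (fun s => holCalc H (A s)) (polyDiff p (A 0) X (A 0)) 0 := by
  have : CompleteSpace (Matrix (Fin (Module.finrank ℂ V)) (Fin (Module.finrank ℂ V)) ℂ) :=
    FiniteDimensional.complete ℂ _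
  exact hasVecDerivAt_holCalc_aux (LinearMap.toMatrixAlgEquiv (Module.finBasis ℂ V)) hU hA hs hg hH

theorem hasVecDerivAt_endExp (A : Module.End ℂ V) :
    HasVecDerivAt (fun x : ℂ => endExp (x • A)) A 0 := by
  have : CompleteSpace (Matrix (Fin (Module.finrank ℂ V)) (Fin (Module.finrank ℂ V)) ℂ) :=
    FiniteDimensional.complete ℂ _
  rw [hasVecDerivAt_iff_equiv (LinearMap.toMatrix (Module.finBasis ℂ V) (Module.finBasis ℂ V))]
  have := hasDerivAt_exp_smul_const (𝕂 := ℂ)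
    (LinearMap.toMatrix (Module.finBasis ℂ V) (Module.finBasis ℂ V) A) (0 : ℂ)
  rw [zero_smul, NormedSpace.exp_zero, one_mul] at this
  simp only [endExp, LinearMap.toMatrix_toLin, map_smul]
  exact this

theorem endExp_zero : endExp (0 : Module.End ℂ V) = 1 := by
  simp [endExp]
  rfl

end

end Derivative

/-! ### Circle integrals depending on a parameter -/

section Parameter

/-- Differentiation under the integral sign. The derivative in the parameter is dominated through
Cauchy's estimate on discs of radius r/2, so only continuity of the kernel is needed on the product.
-/
theorem differentiableOn_circleIntegral_param {W : Set ℂ} (hW : IsOpen W) {k : ℂ → ℂ → ℂ} {l : ℂ}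
    {ρ : ℝ} (hρ : 0 ≤ ρ)
    (hc : ContinuousOn (fun q : ℂ × ℂ => k q.1 q.2) (W ×ˢ Metric.sphere l ρ))
    (hd : ∀ ζ ∈ Metric.sphere l ρ, DifferentiableOn ℂ (fun z => k z ζ) W) :
    DifferentiableOn ℂ (fun z => ∮ ζ in C(l, ρ), k z ζ) W := by
  intro z₀ hz₀
  obtain ⟨r, hr, hball⟩ := Metric.nhds_basis_closedBall.mem_iff.1 (hW.mem_nhds hz₀)
  have hr2 : 0 < r / 2 := half_pos hr
  obtain ⟨B, hB⟩ := ((isCompact_closedBall z₀ r).prod (isCompact_sphere l ρ)).exists_bound_of_continuousOn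
    (hc.mono (Set.prod_mono_left hball))
  have hcm : ∀ θ : ℝ, circleMap l ρ θ ∈ Metric.sphere l ρ := circleMap_mem_sphere l hρ
  have hθc : ∀ z ∈ W, Continuous fun θ : ℝ => k z (circleMap l ρ θ) := by
    intro z hz
    rw [← continuousOn_univ]
    exact hc.comp (f := fun θ : ℝ => (z, circleMap l ρ θ)) (by fun_prop)
      fun θ _ => ⟨hz, hcm θ⟩
  have hdc : Continuous (deriv (circleMap l ρ)) := by
    rw [funext (deriv_circleMap l ρ)]
    fun_prop
  have hF : ∀ z ∈ W, Continuous fun θ : ℝ => deriv (circleMap l ρ) θ • k z (circleMap l ρ θ) :=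
    fun z hz => hdc.smul (hθc z hz)
  have hsub : ∀ z ∈ Metric.ball z₀ (r / 2), Metric.closedBall z (r / 2) ⊆ Metric.closedBall z₀ r := by
    intro z hz
    refine Metric.closedBall_subset_closedBall' ?_
    rw [Metric.mem_ball] at hz
    linarith
  have hderiv : ∀ z ∈ Metric.ball z₀ (r / 2), ∀ ζ ∈ Metric.sphere l ρ,
      HasDerivAt (fun z => k z ζ) (deriv (fun z => k z ζ) z) z := by
    intro z hz ζ hζ
    have hzW : z ∈ W := hball (hsub z hz (Metric.mem_closedBall_self hr2.le))
    exact ((hd ζ hζ).differentiableAt (hW.mem_nhds hzW)).hasDerivAt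
  have hbound : ∀ z ∈ Metric.ball z₀ (r / 2), ∀ ζ ∈ Metric.sphere l ρ,
      ‖deriv (fun z => k z ζ) z‖ ≤ B / (r / 2) := by
    intro z hz ζ hζ
    refine Complex.norm_deriv_le_of_forall_mem_sphere_norm_le hr2 ?_ fun w hw =>
      hB (w, ζ) ⟨hsub z hz (Metric.sphere_subset_closedBall hw), hζ⟩
    exact DifferentiableOn.diffContOnCl (((hd ζ hζ).mono (hball)).mono
      (Metric.closure_ball_subset_closedBall.trans (hsub z hz)))
  have hmem : Metric.ball z₀ (r / 2) ∈ 𝓝 z₀ := Metric.ball_mem_nhds _ hr2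
  -- The derivative is measurable along the circle as the pointwise limit of difference quotients
  -- with steps 1/(n + 1). The later shift by n₀ keeps all the points inside `W`.
  have hmeas : MeasureTheory.AEStronglyMeasurable
      (fun θ : ℝ => deriv (circleMap l ρ) θ • deriv (fun z => k z (circleMap l ρ θ)) z₀)
      (MeasureTheory.volume.restrict (Set.uIoc 0 (2 * Real.pi))) := by
    have hlim : Tendsto (fun n : ℕ => ((1 / ((n : ℝ) + 1) : ℝ) : ℂ)) atTop (𝓝[≠] 0) := by
      refine tendsto_nhdsWithin_iff.2 ⟨?_, Eventually.of_forall fun n => ?_⟩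
      · have := (Complex.continuous_ofReal.tendsto 0).comp tendsto_one_div_add_atTop_nhds_zero_nat
        simpa [Function.comp_def] using this
      · have : ((1 / ((n : ℝ) + 1) : ℝ) : ℂ) ≠ 0 := by
          exact_mod_cast (by positivity : (1 / ((n : ℝ) + 1) : ℝ) ≠ 0)
        exact this
    have hlim' : Tendsto (fun n : ℕ => z₀ + ((1 / ((n : ℝ) + 1) : ℝ) : ℂ)) atTop (𝓝 z₀) := by
      have := (tendsto_nhdsWithin_iff.1 hlim).1.const_add z₀
      simpa using this
    obtain ⟨n₀, hn₀⟩ := eventually_atTop.1 (hlim'.eventually (hW.mem_nhds hz₀))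
    refine aestronglyMeasurable_of_tendsto_ae atTop
      (f := fun (n : ℕ) θ => deriv (circleMap l ρ) θ •
        (((1 / (((n + n₀ : ℕ) : ℝ) + 1) : ℝ) : ℂ)⁻¹ •
        (k (z₀ + ((1 / (((n + n₀ : ℕ) : ℝ) + 1) : ℝ) : ℂ)) (circleMap l ρ θ) -
          k z₀ (circleMap l ρ θ)))) (fun n => ?_) (Eventually.of_forall fun θ => ?_)
    · refine Continuous.aestronglyMeasurable ?_
      have c1 := hθc _ (hn₀ (n + n₀) (Nat.le_add_left _ _))
      have c2 := hθc _ hz₀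
      exact hdc.smul ((c1.fun_sub c2).fun_const_smul _)
    · have h1 := (hderiv z₀ (Metric.mem_ball_self hr2) _ (hcm θ)).tendsto_slope_zero
      exact ((h1.comp hlim).comp (tendsto_add_atTop_nat n₀)).const_smul _
  have key := intervalIntegral.hasDerivAt_integral_of_dominated_loc_of_deriv_le (𝕜 := ℂ)
    (μ := MeasureTheory.volume) (a := 0) (b := 2 * Real.pi)
    (bound := fun _ => |ρ| * (B / (r / 2)))
    (F := fun z θ => deriv (circleMap l ρ) θ • k z (circleMap l ρ θ))
    (F' := fun z θ => deriv (circleMap l ρ) θ • deriv (fun z => k z (circleMap l ρ θ)) z)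
    (x₀ := z₀) hmem
    (by
      filter_upwards [hW.mem_nhds hz₀] with z hz
      exact (hF z hz).aestronglyMeasurable)
    ((hF z₀ hz₀).intervalIntegrable _ _) hmeas
    (Eventually.of_forall fun θ _ z hz => by
      rw [norm_smul]
      refine mul_le_mul ?_ (hbound z hz _ (hcm θ)) (norm_nonneg _) (abs_nonneg _)
      rw [deriv_circleMap]
      simp)
    (by simp)
    (Eventually.of_forall fun θ _ z hz => (hderiv z hz _ (hcm θ)).fun_const_smul _)
  exact key.2.differentiableAt.differentiableWithinAt

variable {V : Type*} [AddCommGroup V] [Module ℂ V] [FiniteDimensional ℂ V]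

/-- The residue of a functional calculus depending on a parameter `z`, for a kernel with a simple
pole at `z = 0` whose residue `c` does not depend on the variable of the calculus. -/
theorem hasVecResidueAt_holCalc {U : Set ℂ} (hU : IsOpen U) {A : Module.End ℂ V}
    (hA : spectrum ℂ A ⊆ U) {F k : ℂ → ℂ → ℂ} {r : ℝ} (hr : 0 < r) {c : ℂ}
    (hF : ∀ z ∈ Metric.ball (0 : ℂ) r, z ≠ 0 → DifferentiableOn ℂ (F z) U)
    (hk : ContinuousOn (fun q : ℂ × ℂ => k q.1 q.2) (Metric.ball 0 r ×ˢ (U \ {0})))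
    (hkd : ∀ ζ ∈ U \ {0}, DifferentiableOn ℂ (fun z => k z ζ) (Metric.ball 0 r))
    (hFk : ∀ z ∈ Metric.ball (0 : ℂ) r, z ≠ 0 → ∀ ζ ∈ U \ {0}, z * F z ζ = k z ζ)
    (hk0 : ∀ ζ ∈ U \ {0}, k 0 ζ = c) :
    HasVecResidueAt (fun z => holCalc (F z) A) (c • (1 : Module.End ℂ V)) 0 := by
  set S := (Module.End.finite_spectrum A).toFinset with hS
  -- The identity z F = k is known only for ζ ≠ 0, so the circles have to avoid 0, even when 0 is an
  -- eigenvalue.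
  have h0 : ∀ᶠ ρ in 𝓝[>] (0 : ℝ), ∀ l ∈ S, (0 : ℂ) ∉ Metric.sphere l ρ := by
    rw [eventually_all_finset]
    intro l _
    by_cases hl : l = 0
    · filter_upwards [self_mem_nhdsWithin] with ρ hρ
      simp only [hl, Metric.mem_sphere, dist_self]
      exact (ne_of_gt hρ).symm
    · filter_upwards [Ioo_mem_nhdsGT (norm_pos_iff.2 hl)] with ρ hρ
      simp only [Metric.mem_sphere, dist_zero_left]
      exact hρ.2.ne'
  obtain ⟨ρ, hρ, hρ0⟩ := ((eventually_isContour hU S (K := spectrum ℂ A)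
    (fun l hl => hA (by simpa [hS] using hl)) (by simp [hS])).and h0).exists
  have hcirc : ∀ l ∈ S, Metric.sphere l ρ ⊆ U \ {0} := fun l hl ζ hζ =>
    ⟨hρ.subset l hl (Metric.sphere_subset_closedBall hζ), fun e => hρ0 l hl (by
      rw [Set.mem_singleton_iff] at e; rwa [e] at hζ)⟩
  refine hasVecResidueAt_end fun φ v => ?_
  -- Ψ is holomorphic at z = 0 as well, and the functional calculus is Ψ(z)/z off 0; its residue is
  -- Ψ(0), which is c times the sum of the Riesz projections.
  set Ψ : ℂ → ℂ := fun z => ∑ l ∈ S, (2 * Real.pi * Complex.I : ℂ)⁻¹ *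
      (∮ ζ in C(l, ρ), k z ζ * φ (resolvent A ζ v)) with hΨ
  have hΨd : DifferentiableOn ℂ Ψ (Metric.ball 0 r) := by
    refine DifferentiableOn.fun_sum fun l hl => DifferentiableOn.const_mul ?_ _
    refine differentiableOn_circleIntegral_param Metric.isOpen_ball hρ.pos.le ?_ fun ζ hζ =>
      (hkd ζ (hcirc l hl hζ)).mul_const _
    refine (hk.mono (Set.prod_mono_right (hcirc l hl))).mul ?_
    exact (continuousOn_resolvent A φ v).comp continuousOn_snd
      fun q hq => hρ.notMem hl hq.2
  have hΨ0 : Ψ 0 = c * φ v := by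
    rw [← hρ.sum_integral_resolvent φ v, Finset.mul_sum]
    refine Finset.sum_congr rfl fun l hl => ?_
    rw [mul_left_comm]
    congr 1
    rw [← circleIntegral.integral_const_mul]
    refine circleIntegral.integral_congr hρ.pos.le fun ζ hζ => ?_
    simp only [hk0 ζ (hcirc l hl hζ)]
  have heq : ∀ z ∈ Metric.ball (0 : ℂ) r, z ≠ 0 → φ (holCalc (F z) A v) = z⁻¹ * Ψ z := by
    intro z hz hz0
    rw [hρ.apply_holCalc hU (hF z hz hz0), hΨ, Finset.mul_sum]
    refine Finset.sum_congr rfl fun l hl => ?_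
    rw [mul_left_comm]
    congr 1
    rw [← circleIntegral.integral_const_mul]
    refine circleIntegral.integral_congr hρ.pos.le fun ζ hζ => ?_
    simp only [← hFk z hz hz0 ζ (hcirc l hl hζ)]
    field_simp
  refine ⟨r, hr, ?_, fun ε hε0 hε => ?_⟩
  · refine DifferentiableOn.congr (f := fun z => z⁻¹ * Ψ z) ?_ fun z hz => heq z hz.1 hz.2
    exact (differentiableOn_inv.mono fun z hz => hz.2).mul (hΨd.mono Set.sdiff_subset)
  · have e : (∮ z in C(0, ε), φ (holCalc (F z) A v)) = ∮ z in C(0, ε), (z - 0)⁻¹ • Ψ z := by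
      refine circleIntegral.integral_congr hε0.le fun z hz => ?_
      rw [mem_sphere_zero_iff_norm] at hz
      simp only [sub_zero, smul_eq_mul]
      refine heq z (by rw [mem_ball_zero_iff, hz]; exact hε) ?_
      rintro rfl
      rw [norm_zero] at hz
      exact hε0.ne hz
    rw [e, (hΨd.mono (Metric.closedBall_subset_ball hε)).circleIntegral_sub_inv_smul
      (Metric.mem_ball_self hε0), smul_eq_mul, inv_mul_cancel_left₀ Complex.two_pi_I_ne_zero, hΨ0]
    simp

end Parameter

/-! ### The kernels `χ_a` -/

section Kernel

open Complex

variable {τ : ℂ} {N : ℕ}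

/-- The set of all `w` outside of `2πi Ω_a`. -/
def regularSet (τ : ℂ) (N a : ℕ) : Set ℂ :=
  {w | ∀ x ∈ latticeShift τ N a, w ≠ 2 * Real.pi * I * x}

/-- The argument of the theta function in the denominator of `χ(w + 2πi (a/N) τ, z)`. -/
def shiftArg (τ : ℂ) (N a : ℕ) (w : ℂ) : ℂ := w / (2 * Real.pi * I) + (a : ℂ) / N * τ

/-- `exp (2πi a z / N) χ(w + 2πi (a/N) τ, z)`. -/
def chiShift (τ : ℂ) (N a : ℕ) (w z : ℂ) : ℂ :=
  cexp (2 * Real.pi * I * a * z / N) * chi τ (w + 2 * Real.pi * I * ((a : ℂ) / N) * τ) z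

theorem neg_mem_lattice {x : ℂ} (hx : x ∈ lattice τ) : -x ∈ lattice τ := by
  obtain ⟨m, n, rfl⟩ := hx
  exact ⟨-m, -n, by push_cast; ring⟩

theorem neg_mem_lattice_iff {x : ℂ} : -x ∈ lattice τ ↔ x ∈ lattice τ :=
  ⟨fun h => by simpa using neg_mem_lattice h, neg_mem_lattice⟩

theorem add_mem_lattice {x y : ℂ} (hx : x ∈ lattice τ) (hy : y ∈ lattice τ) :
    x + y ∈ lattice τ := by
  obtain ⟨m, n, rfl⟩ := hx
  obtain ⟨m', n', rfl⟩ := hy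
  exact ⟨m + m', n + n', by push_cast; ring⟩

theorem intCast_mul_tau_mem_lattice (n : ℤ) : (n : ℂ) * τ ∈ lattice τ := ⟨0, n, by simp⟩

theorem mem_regularSet_iff {a : ℕ} {w : ℂ} (hw : w ≠ 0) :
    w ∈ regularSet τ N a ↔ shiftArg τ N a w ∉ lattice τ := by
  have h2 : (2 * Real.pi * I : ℂ) ≠ 0 := two_pi_I_ne_zero
  constructor
  · intro h hm
    exact h (w / (2 * Real.pi * I)) ⟨hm, div_ne_zero hw h2⟩ (by field_simp)
  · rintro h x ⟨hx, -⟩ rfl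
    refine h ?_
    rwa [shiftArg, mul_div_cancel_left₀ _ h2]

theorem mem_regularSet_of_notMem {a : ℕ} {w : ℂ} (h : shiftArg τ N a w ∉ lattice τ) :
    w ∈ regularSet τ N a := by
  rintro x ⟨hx, -⟩ rfl
  refine h ?_
  rwa [shiftArg, mul_div_cancel_left₀ _ two_pi_I_ne_zero]

theorem tau_coeff_eq_int (hτ : 0 < τ.im) {s : ℝ} (h : (s : ℂ) * τ ∈ lattice τ) :
    ∃ n : ℤ, s = n := by
  obtain ⟨m, n, e⟩ := h
  refine ⟨n, ?_⟩
  have := congrArg Complex.im e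
  simp [hτ.ne'] at this
  exact this

/-- Since 0 < a/N < 1, the τ-coordinate is not an integer. Thus w = 0 is a pole of the shifted
kernel only for a = 0. -/
theorem shiftArg_zero_notMem (hτ : 0 < τ.im) {a : ℕ} (ha : a < N) (ha0 : a ≠ 0) :
    shiftArg τ N a 0 ∉ lattice τ := by
  intro h
  rw [shiftArg, zero_div, zero_add] at h
  obtain ⟨n, hn⟩ := tau_coeff_eq_int hτ (s := (a : ℝ) / N) (by push_cast; exact h)
  have hN : (0 : ℝ) < N := by exact_mod_cast Nat.zero_lt_of_lt ha
  have h1 : (0 : ℝ) < (a : ℝ) / N := div_pos (by exact_mod_cast Nat.pos_of_ne_zero ha0) hN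
  have h2 : (a : ℝ) / N < 1 := (div_lt_one hN).2 (by exact_mod_cast ha)
  rw [hn] at h1 h2
  have h3 : 0 < n := by exact_mod_cast h1
  have h4 : n < 1 := by exact_mod_cast h2
  omega

/-- `θ₁(v) = v D(v)`. -/
def thetaQuot (τ : ℂ) : ℂ → ℂ := dslope (theta1 τ) 0

theorem theta1_eq_mul_thetaQuot (τ v : ℂ) : theta1 τ v = v * thetaQuot τ v := by
  have := sub_smul_dslope (theta1 τ) 0 v
  rw [theta1_zero, sub_zero, sub_zero, smul_eq_mul] at this
  exact this.symm

theorem differentiable_thetaQuot (hτ : 0 < τ.im) : Differentiable ℂ (thetaQuot τ) := by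
  rw [← differentiableOn_univ, thetaQuot, Complex.differentiableOn_dslope univ_mem]
  exact (differentiable_theta1 hτ).differentiableOn

theorem thetaQuot_zero (τ : ℂ) : thetaQuot τ 0 = deriv (theta1 τ) 0 := dslope_same _ _

theorem thetaQuot_zero_ne_zero (hτ : 0 < τ.im) : thetaQuot τ 0 ≠ 0 := by
  rw [thetaQuot_zero]
  exact deriv_theta1_zero_ne_zero hτ

theorem exists_ball_thetaQuot_ne_zero (hτ : 0 < τ.im) :
    ∃ r > 0, ∀ v ∈ Metric.ball (0 : ℂ) r, thetaQuot τ v ≠ 0 :=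
  Metric.eventually_nhds_iff_ball.1
    ((differentiable_thetaQuot hτ).continuous.continuousAt.eventually_ne
      (thetaQuot_zero_ne_zero hτ))

theorem differentiable_shiftArg (a : ℕ) : Differentiable ℂ (shiftArg τ N a) := by
  unfold shiftArg
  fun_prop

/-- Away from the zeros of the theta function this is continuity. The exceptional point is w = 0 for
a = 0, which belongs to the set although θ₁ vanishes there; it is interior because a simple zero is
isolated. -/
theorem isOpen_regularSet (hτ : 0 < τ.im) {a : ℕ} (ha : a < N) : IsOpen (regularSet τ N a) := by
  rw [isOpen_iff_mem_nhds]
  intro w hw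
  by_cases h : shiftArg τ N a w ∈ lattice τ
  · have hw0 : w = 0 := by
      by_contra hw0
      exact (mem_regularSet_iff hw0).1 hw h
    subst hw0
    have ha0 : a = 0 := by
      by_contra ha0
      exact shiftArg_zero_notMem hτ ha ha0 h
    subst ha0
    obtain ⟨r, hr, hb⟩ := exists_ball_thetaQuot_ne_zero hτ
    have hcont : ContinuousAt (fun w : ℂ => w / (2 * Real.pi * I)) 0 := by fun_prop
    have hev := hcont.eventually_mem
      (by simpa only [zero_div] using Metric.ball_mem_nhds (0 : ℂ) hr)
    filter_upwards [hev] with u hu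
    by_cases hu0 : u = 0
    · rw [hu0]; exact hw
    · rw [mem_regularSet_iff hu0, ← theta1_eq_zero_iff hτ]
      simp only [shiftArg, Nat.cast_zero, zero_div, zero_mul, add_zero]
      rw [theta1_eq_mul_thetaQuot]
      exact mul_ne_zero (div_ne_zero hu0 two_pi_I_ne_zero) (hb _ hu)
  · rw [← theta1_eq_zero_iff hτ] at h
    have := ((differentiable_theta1 hτ).continuous.comp
      (differentiable_shiftArg (τ := τ) (N := N) a).continuous).continuousAt.eventually_ne h
    filter_upwards [this] with u hu
    exact mem_regularSet_of_notMem (by rwa [← theta1_eq_zero_iff hτ])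

theorem chiShift_eq (τ : ℂ) (N a : ℕ) (w z : ℂ) : chiShift τ N a w z =
    cexp (2 * Real.pi * I * a * z / N) * (1 / (2 * Real.pi * I) *
      (theta1 τ (shiftArg τ N a w + z) * deriv (theta1 τ) 0 /
        (theta1 τ z * theta1 τ (shiftArg τ N a w)))) := by
  have : (w + 2 * Real.pi * I * ((a : ℂ) / N) * τ) / (2 * Real.pi * I) = shiftArg τ N a w := by
    rw [shiftArg, add_div, mul_assoc _ ((a : ℂ) / N), mul_div_cancel_left₀ _ two_pi_I_ne_zero]
  rw [chiShift, chi, this]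

theorem chiA_of_ne {a : ℕ} {w : ℂ} (hw : w ≠ 0) (z : ℂ) :
    chiA τ N a w z = chiShift τ N a w z - if a = 0 then 1 / w else 0 := by
  by_cases ha : a = 0
  · subst ha
    simp [chiA, chiShift, chiReg, hw]
  · simp [chiA, chiShift, ha]

theorem chiA_of_pos {a : ℕ} (ha : a ≠ 0) (w z : ℂ) : chiA τ N a w z = chiShift τ N a w z := by
  simp [chiA, chiShift, ha]

/-- `w χ(w, z)`, with its removable singularity at `w = 0` removed. -/
def chiNum (τ w z : ℂ) : ℂ :=
  theta1 τ (w / (2 * Real.pi * I) + z) * deriv (theta1 τ) 0 /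
    (theta1 τ z * thetaQuot τ (w / (2 * Real.pi * I)))

theorem chi_eq_chiNum_div {w z : ℂ} (hw : w ≠ 0) : chi τ w z = chiNum τ w z / w := by
  rw [chi, chiNum, theta1_eq_mul_thetaQuot τ (w / (2 * Real.pi * I))]
  have := two_pi_I_ne_zero
  have hpi : (Real.pi : ℂ) ≠ 0 := by exact_mod_cast Real.pi_ne_zero
  field_simp

theorem chiNum_zero (hτ : 0 < τ.im) {z : ℂ} (hz : z ∉ lattice τ) : chiNum τ 0 z = 1 := by
  have h1 : theta1 τ z ≠ 0 := by rwa [Ne, theta1_eq_zero_iff hτ]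
  have h2 := deriv_theta1_zero_ne_zero hτ
  rw [chiNum, zero_div, zero_add, thetaQuot_zero]
  field_simp

/-- The function w χ(w, z) is holomorphic at w = 0 with value 1, so χ(w, z) - 1/w is its difference
quotient at 0, which `dslope` extends holomorphically. -/
theorem exists_nhds_chiReg (hτ : 0 < τ.im) {z : ℂ} (hz : z ∉ lattice τ) :
    ∃ r > 0, DifferentiableOn ℂ (fun w => chiReg τ w z) (Metric.ball 0 r) := by
  obtain ⟨r, hr, hb⟩ := exists_ball_thetaQuot_ne_zero hτ
  have h1 : theta1 τ z ≠ 0 := by rwa [Ne, theta1_eq_zero_iff hτ]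
  have hcont : ContinuousAt (fun w : ℂ => w / (2 * Real.pi * I)) 0 := by fun_prop
  have hev := hcont.eventually_mem
    (by simpa only [zero_div] using Metric.ball_mem_nhds (0 : ℂ) hr)
  obtain ⟨s, hs, hsb⟩ := Metric.eventually_nhds_iff_ball.1 hev
  have hd : DifferentiableOn ℂ (fun w => chiNum τ w z) (Metric.ball 0 s) := by
    unfold chiNum
    refine DifferentiableOn.div ?_ ?_ fun w hw => mul_ne_zero h1 (hb _ (hsb w hw))
    · exact (((differentiable_theta1 hτ).comp (f := fun w => w / (2 * Real.pi * I) + z)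
        (by fun_prop)).mul_const _).differentiableOn
    · exact (((differentiable_thetaQuot hτ).comp (f := fun w => w / (2 * Real.pi * I))
        (by fun_prop)).const_mul _).differentiableOn
  have hball : Metric.ball (0 : ℂ) s ∈ 𝓝 (0 : ℂ) := Metric.ball_mem_nhds _ hs
  have hds : DifferentiableOn ℂ (dslope (fun w => chiNum τ w z) 0) (Metric.ball 0 s) :=
    (Complex.differentiableOn_dslope hball).2 hd
  have hne : ∀ w : ℂ, w ≠ 0 → chi τ w z - 1 / w = dslope (fun w => chiNum τ w z) 0 w := by
    intro w hw
    rw [dslope_of_ne _ hw, slope_def_field, chiNum_zero hτ hz, sub_zero, chi_eq_chiNum_div hw,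
      sub_div]
  refine ⟨s, hs, hds.congr fun w _ => ?_⟩
  rw [chiReg]
  split_ifs with hw
  · subst hw
    refine Tendsto.limUnder_eq ?_
    have hc : ContinuousAt (dslope (fun w => chiNum τ w z) 0) 0 :=
      (hds.differentiableAt hball).continuousAt
    refine (hc.tendsto.mono_left nhdsWithin_le_nhds).congr' ?_
    filter_upwards [self_mem_nhdsWithin] with u hu
    exact (hne u hu).symm
  · exact hne w hw

theorem differentiableOn_chiA (hτ : 0 < τ.im) {a : ℕ} (ha : a < N) {z : ℂ}
    (hz : z ∉ lattice τ) : DifferentiableOn ℂ (fun w => chiA τ N a w z) (regularSet τ N a) := by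
  intro w hw
  have h1 : theta1 τ z ≠ 0 := by rwa [Ne, theta1_eq_zero_iff hτ]
  apply DifferentiableAt.differentiableWithinAt
  by_cases h : shiftArg τ N a w ∈ lattice τ
  · have hw0 : w = 0 := by
      by_contra hw0
      exact (mem_regularSet_iff hw0).1 hw h
    subst hw0
    have ha0 : a = 0 := by
      by_contra ha0
      exact shiftArg_zero_notMem hτ ha ha0 h
    subst ha0
    obtain ⟨r, hr, hd⟩ := exists_nhds_chiReg hτ hz
    have := hd.differentiableAt (Metric.ball_mem_nhds _ hr)
    simpa [chiA] using this
  · have h' : theta1 τ (shiftArg τ N a w) ≠ 0 := by rwa [Ne, theta1_eq_zero_iff hτ]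
    have hsh : DifferentiableAt ℂ (fun w => chiShift τ N a w z) w := by
      simp only [chiShift_eq]
      have e1 := (differentiable_theta1 hτ).comp (differentiable_shiftArg (τ := τ) (N := N) a)
      have e2 := (differentiable_theta1 hτ).comp (f := fun w => shiftArg τ N a w + z)
        ((differentiable_shiftArg (τ := τ) (N := N) a).add_const z)
      refine DifferentiableAt.const_mul (DifferentiableAt.const_mul ?_ _) _
      exact (e2.differentiableAt.mul_const _).div (e1.differentiableAt.const_mul _)
        (mul_ne_zero h1 h')
    by_cases ha0 : a = 0
    · have hw0 : w ≠ 0 := by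
        rintro rfl
        subst ha0
        exact h ⟨0, 0, by simp [shiftArg]⟩
      have hev : (fun w => chiA τ N a w z) =ᶠ[𝓝 w] fun w => chiShift τ N a w z - 1 / w := by
        filter_upwards [isOpen_ne.mem_nhds hw0] with u hu
        rw [chiA_of_ne hu, if_pos ha0]
      refine DifferentiableAt.congr_of_eventuallyEq ?_ hev
      exact hsh.sub ((differentiableAt_const _).div differentiableAt_id hw0)
    · simpa only [chiA_of_pos ha0] using hsh

theorem theta1_add_nat_mul_tau (τ z : ℂ) (k : ℕ) : theta1 τ (z + k * τ) =
    (-1) ^ k * cexp (-(Real.pi * I * τ * k ^ 2) - 2 * Real.pi * I * k * z) * theta1 τ z := by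
  induction k with
  | zero => simp
  | succ k ih =>
    rw [show z + (k + 1 : ℕ) * τ = z + k * τ + τ by push_cast; ring, theta1_add_tau, ih,
      pow_succ]
    have : cexp (-(Real.pi * I * τ * ((k + 1 : ℕ) : ℂ) ^ 2)
        - 2 * Real.pi * I * ((k + 1 : ℕ) : ℂ) * z) =
        cexp (-(Real.pi * I * τ) - 2 * Real.pi * I * (z + k * τ)) *
        cexp (-(Real.pi * I * τ * k ^ 2) - 2 * Real.pi * I * k * z) := by
      rw [← Complex.exp_add]
      congr 1
      push_cast
      ring
    rw [this]
    ring_nf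

/-- In the quotient the sign and the factor independent of s cancel. A translation by kτ costs only
an exponential linear in s, which the prefactors exp(2πi a z/N) are designed to absorb. -/
theorem theta1_ratio_add (τ x s : ℂ) (k : ℕ) :
    theta1 τ (x + k * τ - s) / theta1 τ (x + k * τ) =
      cexp (2 * Real.pi * I * k * s) * (theta1 τ (x - s) / theta1 τ x) := by
  have e : cexp (-(Real.pi * I * τ * k ^ 2) - 2 * Real.pi * I * k * (x - s)) =
      cexp (2 * Real.pi * I * k * s) *
        cexp (-(Real.pi * I * τ * k ^ 2) - 2 * Real.pi * I * k * x) := by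
    rw [← Complex.exp_add]
    ring_nf
  rw [show x + k * τ - s = x - s + k * τ by ring, theta1_add_nat_mul_tau,
    theta1_add_nat_mul_tau, e]
  have h1 : ((-1 : ℂ)) ^ k ≠ 0 := pow_ne_zero _ (by norm_num)
  have h2 := Complex.exp_ne_zero (-(Real.pi * I * τ * k ^ 2) - 2 * Real.pi * I * k * x)
  rw [show (-1) ^ k * (cexp (2 * Real.pi * I * k * s) *
      cexp (-(Real.pi * I * τ * k ^ 2) - 2 * Real.pi * I * k * x)) * theta1 τ (x - s) =
      ((-1) ^ k * cexp (-(Real.pi * I * τ * k ^ 2) - 2 * Real.pi * I * k * x)) *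
      (cexp (2 * Real.pi * I * k * s) * theta1 τ (x - s)) by ring,
    mul_div_mul_left _ _ (mul_ne_zero h1 h2), mul_div_assoc]

theorem chiShift_eq_ratio (τ : ℂ) (N a : ℕ) (w z : ℂ) : chiShift τ N a w z =
    cexp (2 * Real.pi * I * a * z / N) * (deriv (theta1 τ) 0 / (2 * Real.pi * I)) *
      (theta1 τ (shiftArg τ N a w + z) / theta1 τ (shiftArg τ N a w)) / theta1 τ z := by
  rw [chiShift_eq]
  ring

/-- Oddness of θ₁, after the argument has been reflected up to a translation by kτ. -/
theorem chiShift_neg (hN : 0 < N) {a b k : ℕ} (h : a + b = k * N) (w z : ℂ) :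
    chiShift τ N b (-w) z = -chiShift τ N a w (-z) := by
  have hN' : (N : ℂ) ≠ 0 := by exact_mod_cast hN.ne'
  have h' : (a : ℂ) + b = k * N := by exact_mod_cast h
  have hs : shiftArg τ N b (-w) = -shiftArg τ N a w + k * τ := by
    rw [shiftArg, shiftArg]
    field_simp
    linear_combination (2 * Real.pi * I * τ) * h'
  have hr := theta1_ratio_add τ (-shiftArg τ N a w) (-z) k
  rw [sub_neg_eq_add, sub_neg_eq_add] at hr
  rw [chiShift_eq_ratio, chiShift_eq_ratio, hs, hr, theta1_neg τ z,
    show -shiftArg τ N a w + z = -(shiftArg τ N a w + -z) by ring, theta1_neg, theta1_neg,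
    neg_div_neg_eq]
  have e : cexp (2 * Real.pi * I * b * z / N) * cexp (2 * Real.pi * I * k * -z) =
      cexp (2 * Real.pi * I * a * -z / N) := by
    rw [← Complex.exp_add]
    congr 1
    field_simp
    linear_combination z * h'
  rw [div_neg, neg_neg, ← e]
  ring

/-- Fay's identity for the shifted kernels. -/
theorem chiShift_fay (hτ : 0 < τ.im) (hN : 0 < N) {a b c k : ℕ} (h : a + b + c = k * N)
    {α β γ : ℂ} (hsum : α + β + γ = 0) (hα : shiftArg τ N a α ∉ lattice τ)
    (hβ : shiftArg τ N b β ∉ lattice τ) (hγ : shiftArg τ N c γ ∉ lattice τ) {p q : ℂ}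
    (hp : p ∉ lattice τ) (hq : q ∉ lattice τ) (hpq : p + q ∉ lattice τ) :
    chiShift τ N b β p * chiShift τ N c γ (p + q)
      + chiShift τ N a α (-p) * chiShift τ N c γ q
      + chiShift τ N a α (-(p + q)) * chiShift τ N b β (-q) = 0 := by
  have hN' : (N : ℂ) ≠ 0 := by exact_mod_cast hN.ne'
  have h' : (a : ℂ) + b + c = k * N := by exact_mod_cast h
  set y := shiftArg τ N b β with hy
  set w := shiftArg τ N c γ with hw
  -- The three theta arguments sum to kτ rather than to 0, because a + b + c = kN.
  have hx : shiftArg τ N a α = -y - w + k * τ := by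
    rw [hy, hw, shiftArg, shiftArg, shiftArg]
    field_simp
    linear_combination N * hsum + (2 * Real.pi * I * τ) * h'
  rw [← theta1_eq_zero_iff hτ] at hα hβ hγ hp hq hpq
  have hx0 : theta1 τ (-y - w) ≠ 0 := by
    intro h0
    apply hα
    rw [hx, theta1_add_nat_mul_tau, h0, mul_zero]
  -- Once the quasi-periodicity factors for kτ are included, the three products carry the same
  -- exponential, and the three-term identity applies.
  have e1 : cexp (2 * Real.pi * I * b * p / N) * cexp (2 * Real.pi * I * c * (p + q) / N) =
      cexp (2 * Real.pi * I * (-(a * p) + c * q) / N) * cexp (2 * Real.pi * I * k * p) := by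
    rw [← Complex.exp_add, ← Complex.exp_add]
    congr 1
    field_simp
    linear_combination p * h'
  have e2 : cexp (2 * Real.pi * I * a * -p / N) * cexp (2 * Real.pi * I * c * q / N) =
      cexp (2 * Real.pi * I * (-(a * p) + c * q) / N) := by
    rw [← Complex.exp_add]
    congr 1
    field_simp
  have e3 : cexp (2 * Real.pi * I * a * -(p + q) / N) * cexp (2 * Real.pi * I * b * -q / N) *
      cexp (2 * Real.pi * I * k * (p + q)) =
      cexp (2 * Real.pi * I * (-(a * p) + c * q) / N) * cexp (2 * Real.pi * I * k * p) := by
    rw [← Complex.exp_add, ← Complex.exp_add, ← Complex.exp_add]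
    congr 1
    field_simp
    linear_combination -q * h'
  have r1 := theta1_ratio_add τ (-y - w) p k
  have r2 := theta1_ratio_add τ (-y - w) (p + q) k
  rw [← hx] at r1 r2
  have key := theta1_three_term hτ y w p q
  set D := deriv (theta1 τ) 0 / (2 * Real.pi * I)
  have t1 : chiShift τ N b β p * chiShift τ N c γ (p + q) =
      (cexp (2 * Real.pi * I * (-(a * p) + c * q) / N) * cexp (2 * Real.pi * I * k * p)) * D ^ 2 *
      (theta1 τ (y + p) / theta1 τ y * (theta1 τ (w + (p + q)) / theta1 τ w) /
        (theta1 τ p * theta1 τ (p + q))) := by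
    rw [chiShift_eq_ratio, chiShift_eq_ratio, ← e1]
    ring
  have t2 : chiShift τ N a α (-p) * chiShift τ N c γ q =
      (cexp (2 * Real.pi * I * (-(a * p) + c * q) / N) * cexp (2 * Real.pi * I * k * p)) * D ^ 2 *
      (-(theta1 τ (-y - w - p) / theta1 τ (-y - w) * (theta1 τ (w + q) / theta1 τ w) /
        (theta1 τ p * theta1 τ q))) := by
    rw [chiShift_eq_ratio, chiShift_eq_ratio, ← e2, theta1_neg, ← sub_eq_add_neg, r1]
    ring
  have t3 : chiShift τ N a α (-(p + q)) * chiShift τ N b β (-q) =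
      (cexp (2 * Real.pi * I * (-(a * p) + c * q) / N) * cexp (2 * Real.pi * I * k * p)) * D ^ 2 *
      (theta1 τ (-y - w - (p + q)) / theta1 τ (-y - w) * (theta1 τ (y - q) / theta1 τ y) /
        (theta1 τ (p + q) * theta1 τ q)) := by
    rw [chiShift_eq_ratio, chiShift_eq_ratio, ← e3, theta1_neg, theta1_neg, ← sub_eq_add_neg,
      ← sub_eq_add_neg, r2]
    ring
  rw [t1, t2, t3, ← mul_add, ← mul_add]
  apply mul_eq_zero_of_right
  field_simp
  linear_combination key

/-- The pole -1/w is odd too, and a, b vanish together. At w = 0 with a = 0 the value is a limit, so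
the identity extends there by continuity. -/
theorem chiA_neg (hτ : 0 < τ.im) {a b k : ℕ} (ha : a < N) (hb : b < N) (h : a + b = k * N)
    {z : ℂ} (hz : z ∉ lattice τ) (w : ℂ) : chiA τ N b (-w) z = -chiA τ N a w (-z) := by
  have hab : a = 0 ↔ b = 0 := by
    have hk : k < 2 := by
      by_contra hk
      have : 2 * N ≤ k * N := Nat.mul_le_mul_right N (by omega)
      omega
    interval_cases k <;> omega
  have hne : ∀ w : ℂ, w ≠ 0 → chiA τ N b (-w) z = -chiA τ N a w (-z) := by
    intro w hw
    rw [chiA_of_ne hw, chiA_of_ne (neg_ne_zero.2 hw), chiShift_neg (Nat.zero_lt_of_lt ha) h]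
    by_cases hb0 : b = 0
    · rw [if_pos hb0, if_pos (hab.2 hb0), one_div, one_div, inv_neg]
      ring
    · rw [if_neg hb0, if_neg fun ha0 => hb0 (hab.1 ha0)]
      ring
  by_cases hw : w = 0
  · subst hw
    by_cases ha0 : a = 0
    · have hb0 := hab.1 ha0
      subst ha0 hb0
      have hz' : -z ∉ lattice τ := by rwa [neg_mem_lattice_iff]
      have h0 : (0 : ℂ) ∈ regularSet τ N 0 := fun x hx e => by
        rcases mul_eq_zero.1 e.symm with h | h
        · exact two_pi_I_ne_zero h
        · exact hx.2 h
      have hU := (isOpen_regularSet hτ ha).mem_nhds h0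
      have c1 : ContinuousAt (fun w => chiA τ N 0 (-w) z) 0 := by
        refine ContinuousAt.comp (g := fun w => chiA τ N 0 w z) (f := fun w : ℂ => -w) ?_
          (by fun_prop)
        rw [neg_zero]
        exact ((differentiableOn_chiA hτ ha hz).differentiableAt hU).continuousAt
      have c2 : ContinuousAt (fun w => -chiA τ N 0 w (-z)) 0 :=
        ((differentiableOn_chiA hτ ha hz').differentiableAt hU).continuousAt.neg
      refine tendsto_nhds_unique (l := 𝓝[≠] (0 : ℂ)) (c1.tendsto.mono_left nhdsWithin_le_nhds)
        ((c2.tendsto.mono_left nhdsWithin_le_nhds).congr' ?_)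
      filter_upwards [self_mem_nhdsWithin] with u hu
      exact (hne u hu).symm
    · rw [chiA_of_pos ha0, chiA_of_pos fun hb0 => ha0 (hab.2 hb0),
        chiShift_neg (Nat.zero_lt_of_lt ha) h]
  · exact hne w hw

theorem neg_mem_regularSet {a b k : ℕ} (hN : 0 < N) (h : a + b = k * N) {w : ℂ}
    (hw : w ∈ regularSet τ N a) : -w ∈ regularSet τ N b := by
  by_cases hw0 : w = 0
  · subst hw0
    rintro x hx e
    rw [neg_zero] at e
    rcases mul_eq_zero.1 e.symm with h | h
    · exact two_pi_I_ne_zero h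
    · exact hx.2 h
  · rw [mem_regularSet_iff hw0] at hw
    rw [mem_regularSet_iff (neg_ne_zero.2 hw0)]
    have hN' : (N : ℂ) ≠ 0 := by exact_mod_cast hN.ne'
    have h' : (a : ℂ) + b = k * N := by exact_mod_cast h
    have hs : shiftArg τ N b (-w) = -shiftArg τ N a w + (k : ℤ) * τ := by
      rw [shiftArg, shiftArg]
      push_cast
      field_simp
      linear_combination (2 * Real.pi * I * τ) * h'
    intro hm
    apply hw
    rw [← neg_mem_lattice_iff, show -shiftArg τ N a w =
      shiftArg τ N b (-w) + ((-k : ℤ) : ℂ) * τ by rw [hs]; push_cast; ring]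
    exact add_mem_lattice hm (intCast_mul_tau_mem_lattice _)

/-- The identity for the kernels `χ_a` behind the dynamical Yang-Baxter equation. -/
theorem chiA_identity (hτ : 0 < τ.im) {a b c k : ℕ} (ha : a < N) (hb : b < N) (hc : c < N)
    (h : a + b + c = k * N) {α β γ : ℂ} (hsum : α + β + γ = 0) (hα0 : α ≠ 0) (hβ0 : β ≠ 0)
    (hγ0 : γ ≠ 0) (hα : α ∈ regularSet τ N a) (hβ : β ∈ regularSet τ N b)
    (hγ : γ ∈ regularSet τ N c) {p q : ℂ}
    (hp : p ∉ lattice τ) (hq : q ∉ lattice τ) (hpq : p + q ∉ lattice τ) :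
    chiA τ N b β p * chiA τ N c γ (p + q)
      + chiA τ N a α (-p) * chiA τ N c γ q
      + chiA τ N a α (-(p + q)) * chiA τ N b β (-q)
      + (if a = 0 then (chiA τ N c γ q - chiA τ N c (-β) q) / α else 0)
      + (if b = 0 then (chiA τ N c γ (p + q) - chiA τ N c (-α) (p + q)) / β else 0)
      + (if c = 0 then (chiA τ N b β p - chiA τ N b (-α) p) / γ else 0) = 0 := by
  have hN := Nat.zero_lt_of_lt ha
  have fay := chiShift_fay hτ hN h hsum ((mem_regularSet_iff hα0).1 hα)
    ((mem_regularSet_iff hβ0).1 hβ) ((mem_regularSet_iff hγ0).1 hγ) hp hq hpq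
  have n1 : a = 0 → chiA τ N c (-β) q = -chiA τ N b β (-q) := fun h0 =>
    chiA_neg hτ hb hc (by rw [h0, zero_add] at h; exact h) hq β
  have n2 : b = 0 → chiA τ N c (-α) (p + q) = -chiA τ N a α (-(p + q)) := fun h0 =>
    chiA_neg hτ ha hc (by rw [h0, add_zero] at h; exact h) hpq α
  have n3 : c = 0 → chiA τ N b (-α) p = -chiA τ N a α (-p) := fun h0 =>
    chiA_neg hτ ha hb (by rw [h0, add_zero] at h; exact h) hp α
  have hite : ∀ (P : Prop) [Decidable P] (x : ℂ),
      (if P then x else 0) = (if P then 1 else 0) * x := fun P _ x => by split_ifs <;> simp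
  have e1 : (if a = 0 then (chiA τ N c γ q - chiA τ N c (-β) q) / α else 0) =
      (if a = 0 then 1 else 0) * ((chiA τ N c γ q + chiA τ N b β (-q)) / α) := by
    rw [hite]
    split_ifs with h0
    · rw [n1 h0, sub_neg_eq_add]
    · simp
  have e2 : (if b = 0 then (chiA τ N c γ (p + q) - chiA τ N c (-α) (p + q)) / β else 0) =
      (if b = 0 then 1 else 0) * ((chiA τ N c γ (p + q) + chiA τ N a α (-(p + q))) / β) := by
    rw [hite]
    split_ifs with h0
    · rw [n2 h0, sub_neg_eq_add]
    · simp
  have e3 : (if c = 0 then (chiA τ N b β p - chiA τ N b (-α) p) / γ else 0) =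
      (if c = 0 then 1 else 0) * ((chiA τ N b β p + chiA τ N a α (-p)) / γ) := by
    rw [hite]
    split_ifs with h0
    · rw [n3 h0, sub_neg_eq_add]
    · simp
  rw [e1, e2, e3]
  simp only [chiA_of_ne hα0, chiA_of_ne hβ0, chiA_of_ne hγ0]
  rw [hite (a = 0) (1 / α), hite (b = 0) (1 / β), hite (c = 0) (1 / γ)]
  have hk : k < 3 := by
    by_contra hk
    have : 3 * N ≤ k * N := Nat.mul_le_mul_right N (by omega)
    omega
  -- Indices below N with a sum divisible by N: if two of them are zero, so is the third. In the
  -- Kronecker symbols this makes each double product equal to the triple one.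
  have two : ∀ {P Q R : Prop} [Decidable P] [Decidable Q] [Decidable R], (P → Q → R) →
      (if P then (1 : ℂ) else 0) * (if Q then 1 else 0) =
      (if P then (1 : ℂ) else 0) * (if Q then 1 else 0) * (if R then 1 else 0) := by
    intro P Q R _ _ _ hPQ
    by_cases hP : P <;> by_cases hQ : Q <;> simp_all
  have d1 : (if a = 0 then (1 : ℂ) else 0) * (if b = 0 then 1 else 0) =
      (if a = 0 then (1 : ℂ) else 0) * (if b = 0 then 1 else 0) * (if c = 0 then 1 else 0) :=
    two fun _ _ => by interval_cases k <;> omega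
  have d2 : (if a = 0 then (1 : ℂ) else 0) * (if c = 0 then 1 else 0) =
      (if a = 0 then (1 : ℂ) else 0) * (if c = 0 then 1 else 0) * (if b = 0 then 1 else 0) :=
    two fun _ _ => by interval_cases k <;> omega
  have d3 : (if b = 0 then (1 : ℂ) else 0) * (if c = 0 then 1 else 0) =
      (if b = 0 then (1 : ℂ) else 0) * (if c = 0 then 1 else 0) * (if a = 0 then 1 else 0) :=
    two fun _ _ => by interval_cases k <;> omega
  set da : ℂ := if a = 0 then 1 else 0
  set db : ℂ := if b = 0 then 1 else 0
  set dc : ℂ := if c = 0 then 1 else 0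
  -- When a = b = c = 0, products of two subtracted poles are left over. They cancel by α + β + γ =
  -- 0.
  have hinv : 1 / α * (1 / β) + 1 / α * (1 / γ) + 1 / β * (1 / γ) = 0 := by
    field_simp
    linear_combination hsum
  linear_combination fay - 1 / α * (1 / β) * d1 - 1 / α * (1 / γ) * d2 - 1 / β * (1 / γ) * d3
    - da * db * dc * hinv

end Kernel

/-! ### Residues of the kernels at z = 0 -/

section KernelResidue

open Complex

variable {τ : ℂ} {N : ℕ} {V : Type*} [AddCommGroup V] [Module ℂ V] [FiniteDimensional ℂ V]

/-- Writing θ₁(z) = z D(z), multiplication by z clears the pole, and at z = 0 the numerator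
θ₁(w/(2πi) + ...) cancels against the denominator. The value 1/(2πi) is free of w, and the
subtracted 1/w acquires a factor z and drops out. -/
theorem hasVecResidueAt_holCalc_chiA (hτ : 0 < τ.im) {a : ℕ} (ha : a < N)
    {A : Module.End ℂ V} (hA : spectrum ℂ A ⊆ regularSet τ N a) :
    HasVecResidueAt (fun z => holCalc (fun w => chiA τ N a w z) A)
      ((1 / (2 * Real.pi * I) : ℂ) • (1 : Module.End ℂ V)) 0 := by
  obtain ⟨r, hr, hb⟩ := exists_ball_thetaQuot_ne_zero hτ
  have hlat : ∀ z ∈ Metric.ball (0 : ℂ) r, z ≠ 0 → z ∉ lattice τ := by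
    intro z hz hz0
    rw [← theta1_eq_zero_iff hτ, theta1_eq_mul_thetaQuot]
    exact mul_ne_zero hz0 (hb z hz)
  have hden : ∀ ζ ∈ regularSet τ N a \ {0}, theta1 τ (shiftArg τ N a ζ) ≠ 0 := by
    intro ζ hζ
    rw [Ne, theta1_eq_zero_iff hτ]
    exact (mem_regularSet_iff hζ.2).1 hζ.1
  have hT := differentiable_theta1 hτ
  have hQ := differentiable_thetaQuot hτ
  have hS := differentiable_shiftArg (τ := τ) (N := N) a
  refine hasVecResidueAt_holCalc (isOpen_regularSet hτ ha) hA hr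
    (k := fun z ζ => cexp (2 * Real.pi * I * a * z / N) * (1 / (2 * Real.pi * I) *
      (theta1 τ (shiftArg τ N a ζ + z) * deriv (theta1 τ) 0 /
        (thetaQuot τ z * theta1 τ (shiftArg τ N a ζ)))) - if a = 0 then z / ζ else 0)
    (fun z hz hz0 => differentiableOn_chiA hτ ha (hlat z hz hz0)) ?_ ?_ ?_ ?_
  · refine ContinuousOn.sub (ContinuousOn.mul (by fun_prop) (ContinuousOn.mul (by fun_prop)
      (ContinuousOn.div (ContinuousOn.mul ?_ (by fun_prop)) (ContinuousOn.mul ?_ ?_) ?_))) ?_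
    · exact (hT.continuous.comp (f := fun q : ℂ × ℂ => shiftArg τ N a q.2 + q.1)
        ((hS.continuous.comp continuous_snd).add continuous_fst)).continuousOn
    · exact (hQ.continuous.comp continuous_fst).continuousOn
    · exact (hT.continuous.comp (hS.continuous.comp continuous_snd)).continuousOn
    · exact fun q hq => mul_ne_zero (hb _ hq.1) (hden _ hq.2)
    · split_ifs
      · exact continuousOn_fst.div continuousOn_snd fun q hq => hq.2.2
      · exact continuousOn_const
  · intro ζ hζ
    refine DifferentiableOn.sub (DifferentiableOn.mul (by fun_prop) (DifferentiableOn.const_mul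
      (DifferentiableOn.div (DifferentiableOn.mul_const ?_ _) (DifferentiableOn.mul_const ?_ _)
        fun z hz => mul_ne_zero (hb _ hz) (hden _ hζ)) _)) ?_
    · exact (hT.comp (f := fun z => shiftArg τ N a ζ + z) (by fun_prop)).differentiableOn
    · exact hQ.differentiableOn
    · split_ifs <;> fun_prop
  · intro z hz hz0 ζ hζ
    have hζ0 : ζ ≠ 0 := hζ.2
    have h1 := hb z hz
    have h2 := hden ζ hζ
    have h3 : (2 * Real.pi * I : ℂ) ≠ 0 := two_pi_I_ne_zero
    rw [chiA_of_ne hζ0, chiShift_eq, theta1_eq_mul_thetaQuot τ z, mul_sub]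
    congr 1
    · have hpi : (Real.pi : ℂ) ≠ 0 := by exact_mod_cast Real.pi_ne_zero
      field_simp
    · split_ifs
      · ring
      · simp
  · intro ζ hζ
    have h1 := deriv_theta1_zero_ne_zero hτ
    have h2 := hden ζ hζ
    simp only [add_zero, mul_zero, zero_div, Complex.exp_zero, ite_self, sub_zero, one_mul,
      thetaQuot_zero]
    rw [mul_comm (deriv (theta1 τ) 0), div_self (mul_ne_zero h2 h1), mul_one]

end KernelResidue

/-! ### Contraction of tensors with the bilinear form -/

section Contraction

variable {G : Type*} [LieRing G] [LieAlgebra ℂ G] (B : LinearMap.BilinForm ℂ G)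

/-- `a ⊗ b ↦ B(y, b) a`. -/
def contractRight (y : G) : G ⊗[ℂ] G →ₗ[ℂ] G :=
  (TensorProduct.rid ℂ G).toLinearMap ∘ₗ LinearMap.lTensor G (B y)

/-- `a ⊗ b ↦ B(x, a) b`. -/
def contractLeft (x : G) : G ⊗[ℂ] G →ₗ[ℂ] G :=
  (TensorProduct.lid ℂ G).toLinearMap ∘ₗ LinearMap.rTensor G (B x)

/-- `a ⊗ b ⊗ c ↦ B(x, a) B(y, b) B(w, c)`. -/
def contract3 (x y w : G) : G ⊗[ℂ] (G ⊗[ℂ] G) →ₗ[ℂ] ℂ :=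
  B w ∘ₗ contractLeft B y ∘ₗ (TensorProduct.lid ℂ (G ⊗[ℂ] G)).toLinearMap ∘ₗ
    LinearMap.rTensor (G ⊗[ℂ] G) (B x)

@[simp]
theorem contractRight_tmul (y a b : G) : contractRight B y (a ⊗ₜ b) = B y b • a := by
  simp [contractRight]

@[simp]
theorem contractLeft_tmul (x a b : G) : contractLeft B x (a ⊗ₜ b) = B x a • b := by
  simp [contractLeft]

@[simp]
theorem contract3_tmul (x y w a b c : G) :
    contract3 B x y w (a ⊗ₜ (b ⊗ₜ c)) = B x a * (B y b * B w c) := by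
  simp [contract3]

theorem brk1213_add_left (r r' s : G ⊗[ℂ] G) :
    brk1213 (r + r') s = brk1213 r s + brk1213 r' s := by
  simp [brk1213, TensorProduct.add_tmul]

theorem brk1213_add_right (r s s' : G ⊗[ℂ] G) :
    brk1213 r (s + s') = brk1213 r s + brk1213 r s' := by
  simp [brk1213, TensorProduct.tmul_add]

theorem brk1223_add_left (r r' s : G ⊗[ℂ] G) :
    brk1223 (r + r') s = brk1223 r s + brk1223 r' s := by
  simp [brk1223, TensorProduct.add_tmul]

theorem brk1223_add_right (r s s' : G ⊗[ℂ] G) :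
    brk1223 r (s + s') = brk1223 r s + brk1223 r s' := by
  simp [brk1223, TensorProduct.tmul_add]

theorem brk1323_add_left (r r' s : G ⊗[ℂ] G) :
    brk1323 (r + r') s = brk1323 r s + brk1323 r' s := by
  simp [brk1323, TensorProduct.add_tmul]

theorem brk1323_add_right (r s s' : G ⊗[ℂ] G) :
    brk1323 r (s + s') = brk1323 r s + brk1323 r s' := by
  simp [brk1323, TensorProduct.tmul_add]

theorem tensor_induction₂ {P : G ⊗[ℂ] G → G ⊗[ℂ] G → Prop} (h0l : ∀ s, P 0 s)
    (h0r : ∀ r, P r 0) (hpure : ∀ a b c d : G, P (a ⊗ₜ b) (c ⊗ₜ d))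
    (hl : ∀ r r' s, P r s → P r' s → P (r + r') s)
    (hr : ∀ r s s', P r s → P r s' → P r (s + s')) (r s : G ⊗[ℂ] G) : P r s := by
  induction r using TensorProduct.induction_on with
  | zero => exact h0l s
  | tmul a b =>
    induction s using TensorProduct.induction_on with
    | zero => exact h0r _
    | tmul c d => exact hpure a b c d
    | add s s' h h' => exact hr _ _ _ h h'
  | add r r' h h' => exact hl _ _ _ h h'

theorem contract3_brk1213 (x y w : G) (r s : G ⊗[ℂ] G) :
    contract3 B x y w (brk1213 r s) = B x ⁅contractRight B y r, contractRight B w s⁆ := by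
  refine tensor_induction₂ (P := fun r s => contract3 B x y w (brk1213 r s) =
    B x ⁅contractRight B y r, contractRight B w s⁆) ?_ ?_ ?_ ?_ ?_ r s
  · intro s; simp [brk1213]
  · intro r; simp [brk1213]
  · intro a b c d
    simp only [brk1213_tmul, contract3_tmul, contractRight_tmul, smul_lie, lie_smul, map_smul,
      smul_eq_mul]
    ring
  · intro r r' s h h'
    rw [brk1213_add_left, map_add, h, h', map_add, add_lie, map_add]
  · intro r s s' h h'
    rw [brk1213_add_right, map_add, h, h', map_add, lie_add, map_add]

theorem contract3_brk1223 (x y w : G) (r s : G ⊗[ℂ] G) :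
    contract3 B x y w (brk1223 r s) = B y ⁅contractLeft B x r, contractRight B w s⁆ := by
  refine tensor_induction₂ (P := fun r s => contract3 B x y w (brk1223 r s) =
    B y ⁅contractLeft B x r, contractRight B w s⁆) ?_ ?_ ?_ ?_ ?_ r s
  · intro s; simp [brk1223]
  · intro r; simp [brk1223]
  · intro a b c d
    simp only [brk1223_tmul, contract3_tmul, contractRight_tmul, contractLeft_tmul, smul_lie,
      lie_smul, map_smul, smul_eq_mul]
    ring
  · intro r r' s h h'
    rw [brk1223_add_left, map_add, h, h', map_add, add_lie, map_add]
  · intro r s s' h h'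
    rw [brk1223_add_right, map_add, h, h', map_add, lie_add, map_add]

theorem contract3_brk1323 (x y w : G) (r s : G ⊗[ℂ] G) :
    contract3 B x y w (brk1323 r s) = B w ⁅contractLeft B x r, contractLeft B y s⁆ := by
  refine tensor_induction₂ (P := fun r s => contract3 B x y w (brk1323 r s) =
    B w ⁅contractLeft B x r, contractLeft B y s⁆) ?_ ?_ ?_ ?_ ?_ r s
  · intro s; simp [brk1323]
  · intro r; simp [brk1323]
  · intro a b c d
    simp only [brk1323_tmul, contract3_tmul, contractLeft_tmul, smul_lie, lie_smul, map_smul,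
      smul_eq_mul]
    ring
  · intro r r' s h h'
    rw [brk1323_add_left, map_add, h, h', map_add, add_lie, map_add]
  · intro r s s' h h'
    rw [brk1323_add_right, map_add, h, h', map_add, lie_add, map_add]

theorem contract3_ins1 (x y w t : G) (s : G ⊗[ℂ] G) :
    contract3 B x y w (ins1 t s) = B x t * B y (contractRight B w s) := by
  induction s using TensorProduct.induction_on with
  | zero => simp [ins1]
  | tmul a b => simp only [ins1, contract3_tmul, contractRight_tmul, map_smul, smul_eq_mul]; ring
  | add s s' h h' =>
    rw [ins1, TensorProduct.tmul_add, map_add, map_add, map_add, mul_add, ← h, ← h']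
    rfl

theorem contract3_ins2 (x y w t : G) (s : G ⊗[ℂ] G) :
    contract3 B x y w (ins2 t s) = B y t * B x (contractRight B w s) := by
  induction s using TensorProduct.induction_on with
  | zero => simp [ins2]
  | tmul a b =>
    simp only [ins2_tmul, contract3_tmul, contractRight_tmul, map_smul, smul_eq_mul]; ring
  | add s s' h h' =>
    rw [ins2, map_add, map_add, map_add, map_add, mul_add, ← h, ← h']
    rfl

theorem contract3_ins3 (x y w t : G) (s : G ⊗[ℂ] G) :
    contract3 B x y w (ins3 t s) = B w t * B x (contractRight B y s) := by
  induction s using TensorProduct.induction_on with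
  | zero => simp [ins3]
  | tmul a b =>
    simp only [ins3_tmul, contract3_tmul, contractRight_tmul, map_smul, smul_eq_mul]; ring
  | add s s' h h' =>
    rw [ins3, TensorProduct.add_tmul, map_add, map_add, map_add, map_add, mul_add, ← h, ← h']
    rfl

theorem contract3_add₁ (x x' y w : G) (u : G ⊗[ℂ] (G ⊗[ℂ] G)) :
    contract3 B (x + x') y w u = contract3 B x y w u + contract3 B x' y w u := by
  simp [contract3, LinearMap.rTensor_add]

theorem contract3_add₂ (x y y' w : G) (u : G ⊗[ℂ] (G ⊗[ℂ] G)) :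
    contract3 B x (y + y') w u = contract3 B x y w u + contract3 B x y' w u := by
  simp [contract3, contractLeft, LinearMap.rTensor_add]

theorem contract3_add₃ (x y w w' : G) (u : G ⊗[ℂ] (G ⊗[ℂ] G)) :
    contract3 B x y (w + w') u = contract3 B x y w u + contract3 B x y w' u := by
  simp [contract3]

theorem contract3_zero (x y w : G) (u : G ⊗[ℂ] (G ⊗[ℂ] G)) : contract3 B 0 y w u = 0 ∧
    contract3 B x 0 w u = 0 ∧ contract3 B x y 0 u = 0 := by
  simp [contract3, contractLeft]

variable {B} {ι : Type*} [Fintype ι] [DecidableEq ι] {T T' : Module.Basis ι ℂ G}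

theorem sum_form_smul (hT : ∀ α β, B (T α) (T' β) = if α = β then 1 else 0) (v : G) :
    ∑ α, B (T α) v • T' α = v := by
  have : (∑ α, (LinearMap.toSpanSingleton ℂ G (T' α)) ∘ₗ B (T α)) = LinearMap.id := by
    refine T'.ext fun β => ?_
    simp [LinearMap.sum_apply, hT]
  simpa [LinearMap.sum_apply] using LinearMap.congr_fun this v

theorem sum_form_smul' (hT : ∀ α β, B (T α) (T' β) = if α = β then 1 else 0) (v : G) :
    ∑ α, B v (T' α) • T α = v := by
  have : (∑ α, (LinearMap.toSpanSingleton ℂ G (T α)) ∘ₗ B.flip (T' α)) = LinearMap.id := by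
    refine T.ext fun β => ?_
    simp [LinearMap.sum_apply, hT]
  simpa [LinearMap.sum_apply] using LinearMap.congr_fun this v

theorem sum_contractRight_tmul (hT : ∀ α β, B (T α) (T' β) = if α = β then 1 else 0)
    (u : G ⊗[ℂ] G) : ∑ α, contractRight B (T α) u ⊗ₜ[ℂ] T' α = u := by
  induction u using TensorProduct.induction_on with
  | zero => simp
  | tmul a b =>
    simp only [contractRight_tmul, TensorProduct.smul_tmul]
    rw [← TensorProduct.tmul_sum, sum_form_smul hT]
  | add u u' h h' => simp only [map_add, TensorProduct.add_tmul, Finset.sum_add_distrib, h, h']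

theorem eq_of_contractRight_eq (hT : ∀ α β, B (T α) (T' β) = if α = β then 1 else 0)
    {u u' : G ⊗[ℂ] G} (h : ∀ y, contractRight B y u = contractRight B y u') : u = u' := by
  rw [← sum_contractRight_tmul hT u, ← sum_contractRight_tmul hT u']
  simp only [h]

-- Contractions with the `T` are exactly the coordinates in the basis of triple tensors of the dual
-- basis `T'`.
omit [Fintype ι] in
theorem eq_zero_of_contract3_eq_zero (hT : ∀ α β, B (T α) (T' β) = if α = β then 1 else 0)
    {u : G ⊗[ℂ] (G ⊗[ℂ] G)} (h : ∀ x y w, contract3 B x y w u = 0) : u = 0 := by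
  set b := T'.tensorProduct (T'.tensorProduct T') with hb
  have key : ∀ i : ι × ι × ι, b.coord i = contract3 B (T i.1) (T i.2.1) (T i.2.2) := by
    rintro ⟨i, j, k⟩
    refine b.ext ?_
    rintro ⟨i', j', k'⟩
    simp only [hb, Module.Basis.tensorProduct_apply, contract3_tmul, hT, Module.Basis.coord_apply,
      Module.Basis.tensorProduct_repr_tmul_apply, Module.Basis.repr_self, Finsupp.single_apply]
    simp only [eq_comm, smul_eq_mul]
    split_ifs <;> simp
  refine b.ext_elem fun i => ?_
  have := LinearMap.congr_fun (key i) u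
  rw [Module.Basis.coord_apply, h] at this
  simpa using this

variable (B T T') in
/-- The tensor `∑ B(T_α, R T_β) T^α ⊗ T^β` of the endomorphism `R`. -/
def endTensor : Module.End ℂ G →ₗ[ℂ] G ⊗[ℂ] G where
  toFun R := ∑ α, ∑ β, B (T α) (R (T β)) • (T' α ⊗ₜ[ℂ] T' β)
  map_add' R S := by simp [add_smul, Finset.sum_add_distrib]
  map_smul' c R := by simp [Finset.smul_sum, smul_smul]

theorem contractRight_endTensor (hT : ∀ α β, B (T α) (T' β) = if α = β then 1 else 0)
    (R : Module.End ℂ G) (y : G) : contractRight B y (endTensor B T T' R) = R y := by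
  have h1 := sum_form_smul' hT y
  calc contractRight B y (endTensor B T T' R)
      = ∑ β, B y (T' β) • ∑ α, B (T α) (R (T β)) • T' α := by
        simp only [endTensor, LinearMap.coe_mk, AddHom.coe_mk, map_sum, map_smul,
          contractRight_tmul, Finset.smul_sum]
        rw [Finset.sum_comm]
        exact Finset.sum_congr rfl fun β _ => Finset.sum_congr rfl fun α _ => smul_comm _ _ _
    _ = R (∑ β, B y (T' β) • T β) := by
        simp only [sum_form_smul hT, map_sum, map_smul]
    _ = R y := by rw [h1]

/-- While contraction of the right leg recovers the operator, contraction of the left leg recovers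
its adjoint `R'` with respect to `B`. -/
theorem contractLeft_endTensor (hT : ∀ α β, B (T α) (T' β) = if α = β then 1 else 0)
    (hB : B.IsSymm) {R R' : Module.End ℂ G} (hR : ∀ x y, B (R' x) y = B x (R y)) (x : G) :
    contractLeft B x (endTensor B T T' R) = R' x := by
  have h1 := sum_form_smul' hT x
  calc contractLeft B x (endTensor B T T' R)
      = ∑ β, B (∑ α, B x (T' α) • T α) (R (T β)) • T' β := by
        simp only [endTensor, LinearMap.coe_mk, AddHom.coe_mk, map_sum, map_smul,
          contractLeft_tmul, LinearMap.sum_apply, LinearMap.smul_apply, Finset.sum_smul]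
        rw [Finset.sum_comm]
        refine Finset.sum_congr rfl fun β _ => Finset.sum_congr rfl fun α _ => ?_
        rw [smul_smul, smul_eq_mul, mul_comm]
    _ = ∑ β, B (T β) (R' x) • T' β := by
        rw [h1]
        refine Finset.sum_congr rfl fun β _ => ?_
        rw [← hR, hB.eq]
    _ = R' x := sum_form_smul hT _

theorem contractRight_rTensor (f : Module.End ℂ G) (y : G) (u : G ⊗[ℂ] G) :
    contractRight B y (LinearMap.rTensor G f u) = f (contractRight B y u) := by
  induction u using TensorProduct.induction_on with
  | zero => simp
  | tmul a b => simp
  | add u u' h h' => simp only [map_add, h, h']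

theorem contractRight_lTensor {f g : Module.End ℂ G} (hfg : ∀ x y, B x (f y) = B (g x) y) (y : G)
    (u : G ⊗[ℂ] G) :
    contractRight B y (LinearMap.lTensor G f u) = contractRight B (g y) u := by
  induction u using TensorProduct.induction_on with
  | zero => simp
  | tmul a b => simp [hfg]
  | add u u' h h' => simp only [map_add, h, h']

end Contraction

/-! ### The grading, the invariant form and the operator R -/

section Grading

open Complex Polynomial

variable {G : Type*} [LieRing G] [LieAlgebra ℂ G] {μ : G ≃ₗ⁅ℂ⁆ G} {N : ℕ}

theorem exp_root_ne_one (hN : 0 < N) {n : ℕ} (h : ¬N ∣ n) : cexp (2 * Real.pi * I * n / N) ≠ 1 := by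
  intro e
  obtain ⟨k, hk⟩ := Complex.exp_eq_one_iff.1 e
  have hN' : (N : ℂ) ≠ 0 := by exact_mod_cast hN.ne'
  have hpi : (2 * Real.pi * I : ℂ) ≠ 0 := two_pi_I_ne_zero
  have h1 : (n : ℂ) = k * N := by
    rw [div_eq_iff hN', mul_comm (k : ℂ), mul_assoc (2 * Real.pi * I : ℂ)] at hk
    exact mul_left_cancel₀ hpi hk
  have h2 : (n : ℤ) = k * N := by exact_mod_cast h1
  exact h (by exact_mod_cast Dvd.intro_left k h2.symm)

theorem exp_root_add (a b : ℕ) : cexp (2 * Real.pi * I * (a + b : ℕ) / N) =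
    cexp (2 * Real.pi * I * a / N) * cexp (2 * Real.pi * I * b / N) := by
  rw [← Complex.exp_add]
  congr 1
  push_cast
  ring

theorem lie_mem_grade_add {b c : ℕ} {y w : G} (hy : y ∈ grade μ N b) (hw : w ∈ grade μ N c) :
    ⁅y, w⁆ ∈ grade μ N (b + c) := by
  rw [mem_grade] at *
  rw [LieEquiv.map_lie, hy, hw, exp_root_add, smul_lie, lie_smul, smul_smul]

/-- Invariance under μ multiplies B(x, y) by exp(2πi(a + b)/N), which is not 1. -/
theorem form_eq_zero_of_mem_grade {B : LinearMap.BilinForm ℂ G} (hN : 0 < N)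
    (hBμ : ∀ x y, B (μ x) (μ y) = B x y) {a b : ℕ} (h : ¬N ∣ a + b) {x y : G}
    (hx : x ∈ grade μ N a) (hy : y ∈ grade μ N b) : B x y = 0 := by
  have h1 := hBμ x y
  rw [mem_grade] at hx hy
  rw [hx, hy, map_smul, map_smul, LinearMap.smul_apply, smul_smul, mul_comm, ← exp_root_add,
    smul_eq_mul] at h1
  have h2 : (cexp (2 * Real.pi * I * (a + b : ℕ) / N) - 1) * B x y = 0 := by
    rw [sub_mul, h1, one_mul, sub_self]
  exact (mul_eq_zero.1 h2).resolve_left (sub_ne_zero.2 (exp_root_ne_one hN h))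

/-- Orthogonality of the characters of ℤ/N: summing over the grades leaves only the term k = 0. -/
theorem sum_gradeProj (hN : 0 < N) (hμ : ∀ x, (⇑μ)^[N] x = x) (x : G) :
    ∑ a ∈ Finset.range N, (gradeProj μ N hμ a x : G) = x := by
  have hN' : (N : ℂ) ≠ 0 := by exact_mod_cast hN.ne'
  have h1 : ∀ a, (gradeProj μ N hμ a x : G) = (N : ℂ)⁻¹ • ∑ k ∈ Finset.range N,
      cexp (-(2 * Real.pi * I * a / N)) ^ k • (⇑μ)^[k] x := fun a => gradeProjFun_apply μ N a x
  simp only [h1]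
  rw [← Finset.smul_sum, Finset.sum_comm]
  have h2 : ∀ k ∈ Finset.range N, ∑ a ∈ Finset.range N,
      cexp (-(2 * Real.pi * I * a / N)) ^ k • (⇑μ)^[k] x = if k = 0 then (N : ℂ) • x else 0 := by
    intro k hk
    rw [← Finset.sum_smul]
    split_ifs with hk0
    · subst hk0
      simp
    · set r := (cexp (2 * Real.pi * I * k / N))⁻¹ with hr
      have hr1 : r - 1 ≠ 0 := by
        rw [sub_ne_zero, hr, Ne, inv_eq_one]
        exact exp_root_ne_one hN fun h => hk0 (Nat.eq_zero_of_dvd_of_lt h (Finset.mem_range.1 hk))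
      have hrN : r ^ N = 1 := by
        rw [hr, inv_pow, ← Complex.exp_nat_mul, inv_eq_one, Complex.exp_eq_one_iff]
        exact ⟨k, by push_cast; field_simp⟩
      have hs : ∀ a ∈ Finset.range N, cexp (-(2 * Real.pi * I * a / N)) ^ k = r ^ a := by
        intro a _
        rw [hr, ← Complex.exp_neg, ← Complex.exp_nat_mul, ← Complex.exp_nat_mul]
        congr 1
        ring
      have hg := geom_sum_mul r N
      rw [hrN, sub_self] at hg
      rw [Finset.sum_congr rfl hs, (mul_eq_zero.1 hg).resolve_right hr1, zero_smul]
  rw [Finset.sum_congr rfl h2, Finset.sum_ite_eq' , if_pos (Finset.mem_range.2 hN), smul_smul,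
    inv_mul_cancel₀ hN', one_smul]

theorem linearMap_ext_grade {V : Type*} [AddCommGroup V] [Module ℂ V] (hN : 0 < N)
    (hμ : ∀ x, (⇑μ)^[N] x = x) {f g : G →ₗ[ℂ] V}
    (h : ∀ a < N, ∀ x ∈ grade μ N a, f x = g x) : f = g := by
  ext x
  rw [← sum_gradeProj hN hμ x, map_sum, map_sum]
  exact Finset.sum_congr rfl fun a ha => h a (Finset.mem_range.1 ha) _ (Subtype.mem _)

/-- All other homogeneous components are orthogonal to u, so nondegeneracy of `B` restricts to the
pairing of opposite grades. -/
theorem eq_zero_of_form_grade_eq_zero {B : LinearMap.BilinForm ℂ G} (hN : 0 < N)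
    (hB : B.Nondegenerate) (hμ : ∀ x, (⇑μ)^[N] x = x) (hBμ : ∀ x y, B (μ x) (μ y) = B x y)
    {a b : ℕ} (ha : a < N) (hab : N ∣ a + b) {u : G} (hu : u ∈ grade μ N b)
    (h : ∀ x ∈ grade μ N a, B x u = 0) : u = 0 := by
  refine hB.2 u fun x => ?_
  have : B.flip u = 0 := by
    refine linearMap_ext_grade hN hμ fun a' ha' x hx => ?_
    change B x u = 0
    by_cases h' : N ∣ a' + b
    · have e : a' = a := by
        have h3 := (Nat.modEq_zero_iff_dvd.2 h').trans (Nat.modEq_zero_iff_dvd.2 hab).symm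
        exact (Nat.ModEq.add_right_cancel' b h3).eq_of_lt_of_lt ha' ha
      subst e
      exact h x hx
    · exact form_eq_zero_of_mem_grade hN hBμ h' hx hu
  exact LinearMap.congr_fun this x

theorem form_lie_left {B : LinearMap.BilinForm ℂ G} (hB : B.lieInvariant G) (w x y : G) :
    B ⁅w, x⁆ y = -B x ⁅w, y⁆ := hB w x y

theorem form_aeval {B : LinearMap.BilinForm ℂ G} {A A' : Module.End ℂ G}
    (h : ∀ x y, B (A x) y = B x (A' y)) (p : ℂ[X]) (x y : G) :
    B (aeval A p x) y = B x (aeval A' p y) := by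
  have hk : ∀ k : ℕ, ∀ x y, B ((A ^ k) x) y = B x ((A' ^ k) y) := by
    intro k
    induction k with
    | zero => simp
    | succ k ih =>
      intro x y
      rw [pow_succ, pow_succ', Module.End.mul_apply, Module.End.mul_apply, ih, h]
  simp only [aeval_eq_sum_range, LinearMap.sum_apply, LinearMap.smul_apply, map_sum, map_smul, hk]

variable (μ N) in
/-- The linear map `ω ↦ (ad ω)_a`. -/
def adGradeLin (a : ℕ) : grade μ N 0 →ₗ[ℂ] Module.End ℂ (grade μ N a) where
  toFun := adGrade μ N a
  map_add' ω ω' := LinearMap.ext fun x => Subtype.ext (add_lie (ω : G) (ω' : G) (x : G))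
  map_smul' c ω := LinearMap.ext fun x => Subtype.ext (smul_lie c (ω : G) (x : G))

@[simp]
theorem coe_adGrade (a : ℕ) (ω : grade μ N 0) (x : grade μ N a) :
    (adGrade μ N a ω x : G) = ⁅(ω : G), (x : G)⁆ := rfl

theorem subtype_comp_pow_adGrade (a : ℕ) (ω : grade μ N 0) (k : ℕ) (x : grade μ N a) :
    ((adGrade μ N a ω ^ k) x : G) = (LieAlgebra.ad ℂ G (ω : G) ^ k) x := by
  induction k generalizing x with
  | zero => rfl
  | succ k ih => rw [pow_succ, pow_succ, Module.End.mul_apply, Module.End.mul_apply, ih]; rfl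

theorem coe_aeval_adGrade (a : ℕ) (ω : grade μ N 0) (p : ℂ[X]) (x : grade μ N a) :
    (aeval (adGrade μ N a ω) p x : G) = aeval (LieAlgebra.ad ℂ G (ω : G)) p x := by
  simp only [aeval_eq_sum_range, LinearMap.sum_apply, LinearMap.smul_apply,
    AddSubmonoidClass.coe_finsetSum, Submodule.coe_smul, subtype_comp_pow_adGrade]

theorem coe_polyDiff_adGrade (a : ℕ) (ω X : grade μ N 0) (p : ℂ[X]) (x : grade μ N a) :
    (polyDiff p (adGrade μ N a ω) (adGrade μ N a X) (adGrade μ N a ω) x : G) =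
      polyDiff p (LieAlgebra.ad ℂ G (ω : G)) (LieAlgebra.ad ℂ G (X : G))
        (LieAlgebra.ad ℂ G (ω : G)) x := by
  simp only [polyDiff, LinearMap.sum_apply, LinearMap.smul_apply, Module.End.mul_apply,
    AddSubmonoidClass.coe_finsetSum, Submodule.coe_smul, subtype_comp_pow_adGrade, coe_adGrade,
    LieAlgebra.ad_apply]

theorem aeval_ad_mem_grade {a : ℕ} (ω : grade μ N 0) (p : ℂ[X]) {x : G} (hx : x ∈ grade μ N a) :
    aeval (LieAlgebra.ad ℂ G (ω : G)) p x ∈ grade μ N a := by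
  rw [← coe_aeval_adGrade a ω p ⟨x, hx⟩]
  exact Subtype.mem _

theorem spectrum_adGrade_subset {τ : ℂ} {ω : grade μ N 0} (hω : ω ∈ admissible μ N τ) {a : ℕ}
    (ha : a < N) : spectrum ℂ (adGrade μ N a ω) ⊆ regularSet τ N a := fun l hl => hω a ha l hl

/-- The endomorphism of `G` which is `A` on `G_a` and zero on the other eigenspaces of `μ`. -/
def gradeLift (hμ : ∀ x, (⇑μ)^[N] x = x) (a : ℕ) :
    Module.End ℂ (grade μ N a) →ₗ[ℂ] Module.End ℂ G where
  toFun A := (grade μ N a).subtype ∘ₗ A ∘ₗ gradeProj μ N hμ a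
  map_add' A A' := by ext; simp
  map_smul' c A := by ext; simp

theorem sum_gradeLift_apply (hμ : ∀ x, (⇑μ)^[N] x = x)
    (A : ∀ a, Module.End ℂ (grade μ N a)) {a : ℕ} (ha : a < N) (x : grade μ N a) :
    (∑ a ∈ Finset.range N, gradeLift hμ a (A a)) (x : G) = A a x := by
  rw [LinearMap.sum_apply, Finset.sum_eq_single a]
  · simp [gradeLift, gradeProj_apply_self (Nat.zero_lt_of_lt ha) hμ]
  · intro b hb hba
    simp [gradeLift, gradeProj_apply_of_ne hμ (Finset.mem_range.1 hb) ha hba]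
  · intro h
    exact absurd (Finset.mem_range.2 ha) h

theorem sum_gradeLift_one (hN : 0 < N) (hμ : ∀ x, (⇑μ)^[N] x = x) :
    ∑ a ∈ Finset.range N, gradeLift hμ a 1 = 1 :=
  linearMap_ext_grade hN hμ fun _ ha x hx => sum_gradeLift_apply hμ (fun _ => 1) ha ⟨x, hx⟩

/-! ### Polynomial representatives of the kernels; skewness, derivative and residue of R -/

variable [FiniteDimensional ℂ G] {τ : ℂ} {hμ : ∀ x, (⇑μ)^[N] x = x}

variable (μ τ) in
/-- `p` agrees with `χ_a(·, z)` to order `n` at the roots of the characteristic polynomial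
of `(ad ω)_a`. -/
def IsKernelPoly (ω : grade μ N 0) (n a : ℕ) (z : ℂ) (p : ℂ[X]) : Prop :=
  ∃ g : ℂ → ℂ, DifferentiableOn ℂ g (regularSet τ N a) ∧ ∀ w ∈ regularSet τ N a,
    chiA τ N a w z = p.eval w + (LinearMap.charpoly (adGrade μ N a ω)).eval w ^ n * g w

theorem exists_isKernelPoly (hτ : 0 < τ.im) {ω : grade μ N 0} (hω : ω ∈ admissible μ N τ) (n : ℕ)
    {a : ℕ} (ha : a < N) {z : ℂ} (hz : z ∉ lattice τ) : ∃ p, IsKernelPoly μ τ ω n a z p :=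
  exists_eval_add_charpoly_pow_mul (isOpen_regularSet hτ ha) (spectrum_adGrade_subset hω ha)
    (differentiableOn_chiA hτ ha hz) n

theorem IsKernelPoly.of_le {ω : grade μ N 0} {n m a : ℕ} (h : n ≤ m) {z : ℂ} {p : ℂ[X]}
    (hp : IsKernelPoly μ τ ω m a z p) : IsKernelPoly μ τ ω n a z p := by
  obtain ⟨g, hg, H⟩ := hp
  refine ⟨fun w => (LinearMap.charpoly (adGrade μ N a ω)).eval w ^ (m - n) * g w,
    (((LinearMap.charpoly _).differentiable.differentiableOn).pow _).mul hg, fun w hw => ?_⟩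
  rw [H w hw, ← mul_assoc, ← pow_add, Nat.add_sub_cancel' h]

theorem ROp_apply_eq_aeval (hτ : 0 < τ.im) {ω : grade μ N 0} (hω : ω ∈ admissible μ N τ) {a : ℕ}
    (ha : a < N) {z : ℂ} {g : ℂ → ℂ} {p c : ℂ[X]} (hc : aeval (adGrade μ N a ω) c = 0)
    (hg : DifferentiableOn ℂ g (regularSet τ N a))
    (H : ∀ w ∈ regularSet τ N a, chiA τ N a w z = p.eval w + c.eval w * g w)
    {x : G} (hx : x ∈ grade μ N a) :
    ROp μ N hμ τ ω z x = aeval (LieAlgebra.ad ℂ G (ω : G)) p x := by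
  rw [ROp_apply_grade μ N hμ τ ω z ha ⟨x, hx⟩, holCalc_eq_aeval_of_aeval_eq_zero
    (isOpen_regularSet hτ ha) (spectrum_adGrade_subset hω ha) hc hg H, coe_aeval_adGrade]

theorem IsKernelPoly.ROp_apply (hτ : 0 < τ.im) {ω : grade μ N 0} (hω : ω ∈ admissible μ N τ)
    {n : ℕ} (hn : n ≠ 0) {a : ℕ} (ha : a < N) {z : ℂ} {p : ℂ[X]}
    (hp : IsKernelPoly μ τ ω n a z p) {x : G} (hx : x ∈ grade μ N a) :
    ROp μ N hμ τ ω z x = aeval (LieAlgebra.ad ℂ G (ω : G)) p x := by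
  obtain ⟨g, hg, H⟩ := hp
  refine ROp_apply_eq_aeval hτ hω ha (c := (LinearMap.charpoly (adGrade μ N a ω)) ^ n) ?_ hg
    (fun w hw => by rw [eval_pow, H w hw]) hx
  rw [map_pow, LinearMap.aeval_self_charpoly, zero_pow hn]

/-- The adjoint of p(ad ω) is p(-ad ω), and by oddness of the kernels -p(-X) represents χ_b(·, -z)
when p represents χ_a(·, z). -/
theorem ROp_skew (hτ : 0 < τ.im) {B : LinearMap.BilinForm ℂ G} (hN : 0 < N) (hB : B.Nondegenerate)
    (hBinv : B.lieInvariant G) (hBμ : ∀ x y, B (μ x) (μ y) = B x y) {ω : grade μ N 0}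
    (hω : ω ∈ admissible μ N τ) {z : ℂ} (hz : z ∉ lattice τ) (x y : G) :
    B (ROp μ N hμ τ ω z x) y = -B x (ROp μ N hμ τ ω (-z) y) := by
  have hz' : -z ∉ lattice τ := by rwa [neg_mem_lattice_iff]
  have hadj : ∀ x y, B (LieAlgebra.ad ℂ G (ω : G) x) y = B x ((-LieAlgebra.ad ℂ G (ω : G)) y) := by
    intro x y
    rw [LieAlgebra.ad_apply, LinearMap.neg_apply, LieAlgebra.ad_apply, map_neg,
      form_lie_left hBinv]
  have hcomp : ∀ q : ℂ[X], aeval (LieAlgebra.ad ℂ G (ω : G)) (q.comp (-X)) =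
      aeval (-LieAlgebra.ad ℂ G (ω : G)) q := by
    intro q
    rw [aeval_comp, map_neg, aeval_X]
  suffices h : B ∘ₗ ROp μ N hμ τ ω z = -(B.compl₂ (ROp μ N hμ τ ω (-z))) by
    have := LinearMap.congr_fun (LinearMap.congr_fun h x) y
    simpa using this
  refine linearMap_ext_grade hN hμ fun a ha x hx => linearMap_ext_grade hN hμ fun b hb y hy => ?_
  simp only [LinearMap.comp_apply, LinearMap.neg_apply, LinearMap.compl₂_apply]
  obtain ⟨p, g, hg, H⟩ := exists_isKernelPoly hτ hω 1 ha hz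
  have hp : IsKernelPoly μ τ ω 1 a z p := ⟨g, hg, H⟩
  rw [hp.ROp_apply hτ hω one_ne_zero ha hx]
  by_cases hab : N ∣ a + b
  · obtain ⟨k, hk⟩ := hab
    have hk' : a + b = k * N := by rw [hk, mul_comm]
    have hk'' : b + a = k * N := by rw [add_comm, hk']
    set c := LinearMap.charpoly (adGrade μ N a ω) with hc
    -- Under the pairing of G_a with G_b the operator (ad ω)_b is the negative transpose of (ad
    -- ω)_a, so the reflected characteristic polynomial annihilates it.
    have hc0 : aeval (adGrade μ N b ω) (c.comp (-X)) = 0 := by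
      ext y'
      rw [coe_aeval_adGrade]
      refine eq_zero_of_form_grade_eq_zero hN hB hμ hBμ ha ⟨k, hk⟩
        (aeval_ad_mem_grade ω _ y'.2) fun x' hx' => ?_
      rw [hcomp, ← form_aeval hadj, ← coe_aeval_adGrade a ω c ⟨x', hx'⟩, hc,
        LinearMap.aeval_self_charpoly]
      simp
    have hreg : ∀ w ∈ regularSet τ N b, -w ∈ regularSet τ N a :=
      fun w hw => neg_mem_regularSet hN hk'' hw
    rw [ROp_apply_eq_aeval hτ hω hb (z := -z) (p := -p.comp (-X)) (c := c.comp (-X))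
      (g := fun w => -g (-w)) hc0 (hg.comp differentiable_neg.differentiableOn hreg).neg ?_ hy,
      form_aeval hadj, map_neg, hcomp]
    · simp
    · intro w hw
      have h1 := chiA_neg hτ ha hb hk' hz' (-w)
      rw [neg_neg, neg_neg, H _ (hreg w hw)] at h1
      rw [h1]
      simp
      ring
  · obtain ⟨q, hq⟩ := exists_isKernelPoly hτ hω 1 hb hz'
    rw [hq.ROp_apply hτ hω one_ne_zero hb hy,
      form_eq_zero_of_mem_grade hN hBμ hab (aeval_ad_mem_grade ω p hx) hy,
      form_eq_zero_of_mem_grade hN hBμ hab hx (aeval_ad_mem_grade ω q hy), neg_zero]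

/-- The derivative of `R_τ(ω, z)` in the direction `X`, when `χ_a(·, z)` is represented by the
polynomial `p a`. -/
def derivROp (hμ : ∀ x, (⇑μ)^[N] x = x) (p : ℕ → ℂ[X]) (ω : grade μ N 0) :
    grade μ N 0 →ₗ[ℂ] Module.End ℂ G where
  toFun X := ∑ a ∈ Finset.range N, gradeLift hμ a
    (polyDiff (p a) (adGrade μ N a ω) (adGradeLin μ N a X) (adGrade μ N a ω))
  map_add' X Y := by simp only [map_add, polyDiff_add, Finset.sum_add_distrib]
  map_smul' c X := by simp only [map_smul, polyDiff_smul, Finset.smul_sum, RingHom.id_apply]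

omit [FiniteDimensional ℂ G] in
theorem derivROp_apply (p : ℕ → ℂ[X]) (ω X : grade μ N 0) {a : ℕ} (ha : a < N) {x : G}
    (hx : x ∈ grade μ N a) : derivROp hμ p ω X x =
      polyDiff (p a) (LieAlgebra.ad ℂ G (ω : G)) (LieAlgebra.ad ℂ G (X : G))
        (LieAlgebra.ad ℂ G (ω : G)) x := by
  have h := sum_gradeLift_apply hμ (fun a => polyDiff (p a) (adGrade μ N a ω)
    (adGradeLin μ N a X) (adGrade μ N a ω)) ha ⟨x, hx⟩
  exact h.trans (coe_polyDiff_adGrade a ω X (p a) ⟨x, hx⟩)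

theorem hasVecDerivAt_ROp (hτ : 0 < τ.im) {ω X : grade μ N 0} (hω : ω ∈ admissible μ N τ) {z : ℂ}
    {p : ℕ → ℂ[X]} (hp : ∀ a < N, IsKernelPoly μ τ ω 2 a z (p a)) {W : ℂ → grade μ N 0}
    (hW : HasVecDerivAt W X 0) (hW0 : W 0 = ω) :
    HasVecDerivAt (fun s => ROp μ N hμ τ (W s) z) (derivROp hμ p ω X) 0 := by
  subst hW0
  refine HasVecDerivAt.sum _ fun a ha => ?_
  have ha' := Finset.mem_range.1 ha
  obtain ⟨g, hg, H⟩ := hp a ha'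
  exact (hasVecDerivAt_holCalc (isOpen_regularSet hτ ha') (hW.map (adGradeLin μ N a))
    (spectrum_adGrade_subset hω ha') hg H).map (gradeLift hμ a)

theorem hasVecResidueAt_ROp (hτ : 0 < τ.im) (hN : 0 < N) {ω : grade μ N 0}
    (hω : ω ∈ admissible μ N τ) : HasVecResidueAt (fun z => ROp μ N hμ τ ω z)
      ((1 / (2 * Real.pi * I) : ℂ) • (1 : Module.End ℂ G)) 0 := by
  rw [← sum_gradeLift_one hN hμ, Finset.smul_sum]
  refine HasVecResidueAt.sum _ fun a ha => ?_
  have ha' := Finset.mem_range.1 ha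
  rw [← map_smul]
  exact (hasVecResidueAt_holCalc_chiA hτ ha' (spectrum_adGrade_subset hω ha')).map (gradeLift hμ a)

variable {B : LinearMap.BilinForm ℂ G} {ι : Type*} [Fintype ι] [DecidableEq ι]
  {T T' : Module.Basis ι ℂ G}

omit [DecidableEq ι] in
theorem hasVecDerivAt_rMat (hτ : 0 < τ.im) {ω X : grade μ N 0} (hω : ω ∈ admissible μ N τ) {z : ℂ}
    {p : ℕ → ℂ[X]} (hp : ∀ a < N, IsKernelPoly μ τ ω 2 a z (p a)) {W : ℂ → grade μ N 0}
    (hW : HasVecDerivAt W X 0) (hW0 : W 0 = ω) :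
    HasVecDerivAt (fun s => rMat B μ N hμ T T' τ (W s) z)
      (endTensor B T T' (derivROp hμ p ω X)) 0 :=
  (hasVecDerivAt_ROp hτ hω hp hW hW0).map (endTensor B T T')

theorem hasVecResidueAt_rMat (hτ : 0 < τ.im) (hN : 0 < N) (hB : B.IsSymm)
    (hT : ∀ α β, B (T α) (T' β) = if α = β then 1 else 0) {ω : grade μ N 0}
    (hω : ω ∈ admissible μ N τ) : HasVecResidueAt (fun z => rMat B μ N hμ T T' τ ω z)
      ((1 / (2 * Real.pi * I) : ℂ) • ∑ α, T' α ⊗ₜ[ℂ] T α) 0 := by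
  have h := (hasVecResidueAt_ROp (hμ := hμ) hτ hN hω).map (endTensor B T T')
  rw [map_smul] at h
  have e : ∑ α, T' α ⊗ₜ[ℂ] T α = endTensor B T T' 1 := by
    refine Finset.sum_congr rfl fun α _ => ?_
    simp only [← TensorProduct.tmul_smul]
    rw [← TensorProduct.tmul_sum]
    congr 1
    conv_lhs => rw [← sum_form_smul hT (T α)]
    exact Finset.sum_congr rfl fun β _ => by rw [Module.End.one_apply, hB.eq]
  rw [e]
  exact h

omit [DecidableEq ι] in
theorem rMatTransposed_add_rMat_neg (hτ : 0 < τ.im) (hN : 0 < N) (hB : B.Nondegenerate)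
    (hBsymm : B.IsSymm) (hBinv : B.lieInvariant G) (hBμ : ∀ x y, B (μ x) (μ y) = B x y)
    {ω : grade μ N 0} (hω : ω ∈ admissible μ N τ) {z : ℂ} (hz : z ∉ lattice τ) :
    rMatTransposed B μ N hμ T T' τ ω z + rMat B μ N hμ T T' τ ω (-z) = 0 := by
  rw [rMatTransposed, Finset.sum_comm, rMat, ← Finset.sum_add_distrib]
  refine Finset.sum_eq_zero fun α _ => ?_
  rw [← Finset.sum_add_distrib]
  refine Finset.sum_eq_zero fun β _ => ?_
  rw [← add_smul, hBsymm.eq, ROp_skew hτ hN hB hBinv hBμ hω hz, neg_add_cancel, zero_smul]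

/-- The orbit has velocity [X, ω] at 0, and the derivative of R in that direction is the commutator
of ad X with R. As ad X is skew, its action on the second leg of the tensor is composition of R with
-ad X on the right. -/
theorem hasVecDerivAt_rMat_endExp (hτ : 0 < τ.im) (hN : 0 < N) (hBinv : B.lieInvariant G)
    (hT : ∀ α β, B (T α) (T' β) = if α = β then 1 else 0) {ω : grade μ N 0}
    (hω : ω ∈ admissible μ N τ) (X : grade μ N 0) {z : ℂ} (hz : z ∉ lattice τ) :
    HasVecDerivAt (fun x : ℂ => rMat B μ N hμ T T' τ (endExp (x • adGrade μ N 0 X) ω) z)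
      (LinearMap.rTensor G (LieAlgebra.ad ℂ G (X : G)) (rMat B μ N hμ T T' τ ω z)
        + LinearMap.lTensor G (LieAlgebra.ad ℂ G (X : G)) (rMat B μ N hμ T T' τ ω z)) 0 := by
  choose! p hp using fun a (ha : a < N) => exists_isKernelPoly hτ hω 2 ha hz
  have hW := (hasVecDerivAt_endExp (adGrade μ N 0 X)).map (LinearMap.applyₗ ω)
  have h := hasVecDerivAt_rMat (hμ := hμ) (B := B) (T := T) (T' := T') hτ hω hp hW
    (by simp [endExp_zero])
  refine cast (congrArg (HasVecDerivAt _ · 0) ?_) h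
  symm
  refine eq_of_contractRight_eq hT fun y => ?_
  have hg : ∀ x y, B x (LieAlgebra.ad ℂ G (X : G) y) = B ((-LieAlgebra.ad ℂ G (X : G)) x) y := by
    intro x y
    rw [LieAlgebra.ad_apply, LinearMap.neg_apply, LieAlgebra.ad_apply, map_neg,
      LinearMap.neg_apply, form_lie_left hBinv, neg_neg]
  have hr : rMat B μ N hμ T T' τ ω z = endTensor B T T' (ROp μ N hμ τ ω z) := rfl
  rw [map_add, contractRight_rTensor, contractRight_lTensor hg, hr, contractRight_endTensor hT,
    contractRight_endTensor hT, contractRight_endTensor hT]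
  have : LieAlgebra.ad ℂ G (X : G) ∘ₗ ROp μ N hμ τ ω z
      + ROp μ N hμ τ ω z ∘ₗ (-LieAlgebra.ad ℂ G (X : G)) =
      derivROp hμ p ω (LinearMap.applyₗ ω (adGrade μ N 0 X)) := by
    refine linearMap_ext_grade hN hμ fun a ha x hx => ?_
    rw [derivROp_apply p ω _ ha hx]
    have e : LieAlgebra.ad ℂ G ((LinearMap.applyₗ ω (adGrade μ N 0 X) : grade μ N 0) : G) =
        LieAlgebra.ad ℂ G (X : G) * LieAlgebra.ad ℂ G (ω : G)
          - LieAlgebra.ad ℂ G (ω : G) * LieAlgebra.ad ℂ G (X : G) := by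
      exact LinearMap.ext fun v => lie_lie (X : G) (ω : G) v
    rw [e, polyDiff_commutator]
    simp only [LinearMap.add_apply, LinearMap.comp_apply, LinearMap.neg_apply, map_neg,
      LinearMap.sub_apply, Module.End.mul_apply]
    rw [(hp a ha).ROp_apply hτ hω two_ne_zero ha hx,
      (hp a ha).ROp_apply hτ hω two_ne_zero ha (x := LieAlgebra.ad ℂ G (X : G) x)
        (lie_mem_grade X.2 hx), sub_eq_add_neg]
  exact LinearMap.congr_fun this y

end Grading

/-! ### Ideal membership from vanishing along lines -/

section Vanishing

open Polynomial Asymptotics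

theorem X_pow_dvd_of_isBigO {q : ℂ[X]} {n : ℕ}
    (h : (fun ε => q.eval ε) =O[𝓝[≠] (0 : ℂ)] fun ε => ε ^ n) : X ^ n ∣ q := by
  induction n with
  | zero => simp
  | succ n ih =>
    have h0 : (fun ε : ℂ => ε) =O[𝓝[≠] (0 : ℂ)] fun _ => (1 : ℂ) :=
      ((continuous_id.tendsto (0 : ℂ)).mono_left nhdsWithin_le_nhds).isBigO_one ℂ
    have h1 := (isBigO_refl (fun ε : ℂ => ε ^ n) (𝓝[≠] 0)).mul h0
    simp only [mul_one, ← pow_succ] at h1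
    obtain ⟨r, rfl⟩ := ih (h.trans h1)
    have h2 : (fun ε => r.eval ε) =O[𝓝[≠] (0 : ℂ)] fun ε => ε := by
      refine ((isBigO_refl (fun ε : ℂ => (ε ^ n)⁻¹) _).mul h).congr' ?_ ?_
      · filter_upwards [self_mem_nhdsWithin] with ε hε
        rw [eval_mul, eval_pow, eval_X, inv_mul_cancel_left₀ (pow_ne_zero n hε)]
      · filter_upwards [self_mem_nhdsWithin] with ε hε
        rw [pow_succ, inv_mul_cancel_left₀ (pow_ne_zero n hε)]
    have h3 : Tendsto (fun ε => r.eval ε) (𝓝[≠] (0 : ℂ)) (𝓝 0) :=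
      h2.trans_tendsto ((continuous_id.tendsto (0 : ℂ)).mono_left nhdsWithin_le_nhds)
    have h4 : r.eval 0 = 0 :=
      tendsto_nhds_unique ((r.continuous.tendsto 0).mono_left nhdsWithin_le_nhds) h3
    rw [pow_succ]
    exact mul_dvd_mul_left _ (X_dvd_iff.2 (by rw [coeff_zero_eq_eval_zero, h4]))

theorem coeff_aeval_line (Q : MvPolynomial (Fin 2) ℂ) (u v : ℂ) (n : ℕ) :
    (MvPolynomial.aeval ![C u * X, C v * X] Q : ℂ[X]).coeff n =
      MvPolynomial.eval ![u, v] (MvPolynomial.homogeneousComponent n Q) := by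
  induction Q using MvPolynomial.induction_on' with
  | monomial d r =>
    have hd : d.degree = d 0 + d 1 := by simp [Finsupp.degree_eq_sum]
    have h1 : (MvPolynomial.aeval ![C u * X, C v * X] (MvPolynomial.monomial d r) : ℂ[X]) =
        C (r * (u ^ d 0 * v ^ d 1)) * X ^ (d 0 + d 1) := by
      rw [MvPolynomial.aeval_monomial, Finsupp.prod_fintype _ _ (by simp)]
      simp [mul_pow, pow_add, algebraMap_eq]
      ring
    rw [h1, coeff_C_mul, coeff_X_pow]
    by_cases h : n = d 0 + d 1
    · rw [MvPolynomial.homogeneousComponent_of_mem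
        (MvPolynomial.isHomogeneous_monomial r (hd.trans h.symm)), if_pos h, if_pos rfl,
        MvPolynomial.eval_monomial, Finsupp.prod_fintype _ _ (by simp)]
      simp
    · rw [MvPolynomial.homogeneousComponent_of_mem
        (MvPolynomial.isHomogeneous_monomial r hd), if_neg h, if_neg h]
      simp
  | add p q hp hq => simp only [map_add, coeff_add, hp, hq]

/-- The coefficient of εⁿ along the line of direction (u, v) is the homogeneous component of degree
n at (u, v). The three excluded directions are harmless: multiplying the component by u v (u + v)
makes it vanish everywhere, and the polynomial ring is a domain. -/
theorem coeff_eq_zero_of_dvd_line {Q : MvPolynomial (Fin 2) ℂ} {n : ℕ}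
    (h : ∀ u v : ℂ, u ≠ 0 → v ≠ 0 → u + v ≠ 0 →
      X ^ n ∣ (MvPolynomial.aeval ![C u * X, C v * X] Q : ℂ[X]))
    {d : Fin 2 →₀ ℕ} (hd : d 0 + d 1 < n) : Q.coeff d = 0 := by
  have h0 : MvPolynomial.homogeneousComponent (d 0 + d 1) Q *
      (MvPolynomial.X 0 * MvPolynomial.X 1 * (MvPolynomial.X 0 + MvPolynomial.X 1)) = 0 := by
    refine MvPolynomial.funext fun x => ?_
    simp only [map_mul, map_add, MvPolynomial.eval_X, map_zero]
    by_cases hx : x 0 * x 1 * (x 0 + x 1) = 0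
    · rw [hx, mul_zero]
    · simp only [mul_eq_zero, not_or] at hx
      have hx' : x = ![x 0, x 1] := by ext i; fin_cases i <;> rfl
      rw [hx', ← coeff_aeval_line, X_pow_dvd_iff.1 (h _ _ hx.1.1 hx.1.2 hx.2) _ hd, zero_mul]
  have hX : (MvPolynomial.X 0 + MvPolynomial.X 1 : MvPolynomial (Fin 2) ℂ) ≠ 0 := by
    intro e
    have := congrArg (MvPolynomial.eval ![1, 0]) e
    simp at this
  have h1 := (mul_eq_zero.1 h0).resolve_right
    (mul_ne_zero (mul_ne_zero (MvPolynomial.X_ne_zero _) (MvPolynomial.X_ne_zero _)) hX)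
  have h2 := congrArg (MvPolynomial.coeff d) h1
  rwa [MvPolynomial.coeff_homogeneousComponent, if_pos (by simp [Finsupp.degree_eq_sum])] at h2

/-- After translation to (β, γ), Q has no monomial of degree less than 2k, and a monomial of degree
at least 2k has exponent at least k in one of the two variables. -/
theorem mem_ideal_of_dvd_line {Q : MvPolynomial (Fin 2) ℂ} {J : Ideal (MvPolynomial (Fin 2) ℂ)}
    {β γ : ℂ} {k : ℕ} (hβ : (MvPolynomial.X 0 - MvPolynomial.C β) ^ k ∈ J)
    (hγ : (MvPolynomial.X 1 - MvPolynomial.C γ) ^ k ∈ J)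
    (h : ∀ u v : ℂ, u ≠ 0 → v ≠ 0 → u + v ≠ 0 →
      X ^ (2 * k) ∣ (MvPolynomial.aeval ![C β + C u * X, C γ + C v * X] Q : ℂ[X])) : Q ∈ J := by
  set σ : MvPolynomial (Fin 2) ℂ →ₐ[ℂ] MvPolynomial (Fin 2) ℂ := MvPolynomial.aeval
    ![MvPolynomial.C β + MvPolynomial.X 0, MvPolynomial.C γ + MvPolynomial.X 1] with hσ
  set σ' : MvPolynomial (Fin 2) ℂ →ₐ[ℂ] MvPolynomial (Fin 2) ℂ := MvPolynomial.aeval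
    ![MvPolynomial.X 0 - MvPolynomial.C β, MvPolynomial.X 1 - MvPolynomial.C γ] with hσ'
  have h1 : σ' (σ Q) = Q := by
    have : σ'.comp σ = AlgHom.id ℂ _ := by
      refine MvPolynomial.algHom_ext fun i => ?_
      fin_cases i <;> simp [hσ, hσ', MvPolynomial.algebraMap_eq]
    exact DFunLike.congr_fun this Q
  have h2 : ∀ u v : ℂ, (MvPolynomial.aeval ![C u * X, C v * X] (σ Q) : ℂ[X]) =
      MvPolynomial.aeval ![C β + C u * X, C γ + C v * X] Q := by
    intro u v
    have : (MvPolynomial.aeval ![C u * X, C v * X] : _ →ₐ[ℂ] ℂ[X]).comp σ =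
        MvPolynomial.aeval ![C β + C u * X, C γ + C v * X] := by
      refine MvPolynomial.algHom_ext fun i => ?_
      fin_cases i <;> simp [hσ, algebraMap_eq]
    exact DFunLike.congr_fun this Q
  rw [← h1, (σ Q).as_sum, map_sum]
  refine J.sum_mem fun d _ => ?_
  by_cases hd : d 0 + d 1 < 2 * k
  · rw [coeff_eq_zero_of_dvd_line (fun u v hu hv huv => by rw [h2]; exact h u v hu hv huv) hd]
    simp
  · rw [hσ', MvPolynomial.aeval_monomial, Finsupp.prod_fintype _ _ (by simp), Fin.prod_univ_two]
    refine J.mul_mem_left _ ?_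
    rcases le_or_gt k (d 0) with h' | h'
    · exact J.mul_mem_right _ (Ideal.mem_of_dvd _ (pow_dvd_pow _ h') hβ)
    · exact J.mul_mem_left _ (Ideal.mem_of_dvd _ (pow_dvd_pow _ (by omega)) hγ)

theorem isBigO_mul_sub_mul {l : Filter ℂ} {A₁ A₂ a₁ a₂ f : ℂ → ℂ}
    (h₁ : (fun ε => A₁ ε - a₁ ε) =O[l] f) (h₂ : (fun ε => A₂ ε - a₂ ε) =O[l] f)
    (b₂ : A₂ =O[l] (1 : ℂ → ℂ)) (b₁ : a₁ =O[l] (1 : ℂ → ℂ)) :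
    (fun ε => A₁ ε * A₂ ε - a₁ ε * a₂ ε) =O[l] f := by
  have e₁ := h₁.mul b₂
  have e₂ := b₁.mul h₂
  simp only [Pi.one_apply, mul_one, one_mul] at e₁ e₂
  exact (e₁.add e₂).congr_left fun ε => by ring

end Vanishing

/-! ### From the kernel identity to a vanishing order -/

section Estimate

open Polynomial Asymptotics

/-- The polynomial expression in which the dynamical Yang-Baxter equation on `G_a × G_b × G_c` can
be written, where `p a z` represents `χ_a(·, z)`. -/
def relPoly {R : Type*} [CommRing R] [Algebra ℂ R] (p : ℕ → ℂ → ℂ[X]) (a b c : ℕ) (s t : ℂ)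
    (y w : R) : R :=
  aeval y (p b s) * aeval w (p c (s + t)) + aeval (-y - w) (p a (-s)) * aeval w (p c t)
    + aeval (-y - w) (p a (-(s + t))) * aeval y (p b (-t))
    - (if a = 0 then polyDiff (p c t) (-y) 1 w else 0)
    - (if b = 0 then polyDiff (p c (s + t)) (y + w) 1 w else 0)
    - (if c = 0 then polyDiff (p b s) (y + w) 1 y else 0)

theorem map_relPoly {R R' : Type*} [CommRing R] [Algebra ℂ R] [CommRing R'] [Algebra ℂ R']
    (φ : R →ₐ[ℂ] R') (p : ℕ → ℂ → ℂ[X]) (a b c : ℕ) (s t : ℂ) (y w : R) :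
    φ (relPoly p a b c s t y w) = relPoly p a b c s t (φ y) (φ w) := by
  simp only [relPoly, map_add, map_sub, map_mul, apply_ite φ, map_zero, map_polyDiff, map_one,
    map_neg, ← aeval_algHom_apply]

variable {G : Type*} [LieRing G] [LieAlgebra ℂ G] [FiniteDimensional ℂ G] {μ : G ≃ₗ⁅ℂ⁆ G} {N : ℕ}
  {τ : ℂ} {ω : grade μ N 0}

theorem tendsto_line (l s : ℂ) : Tendsto (fun ε : ℂ => l + s * ε) (𝓝[≠] 0) (𝓝 l) := by
  have : Continuous fun ε : ℂ => l + s * ε := by fun_prop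
  simpa using (this.tendsto 0).mono_left nhdsWithin_le_nhds

theorem eventually_line_ne_zero (l : ℂ) {s : ℂ} (hs : s ≠ 0) :
    ∀ᶠ ε in 𝓝[≠] (0 : ℂ), l + s * ε ≠ 0 := by
  by_cases hl : l = 0
  · filter_upwards [self_mem_nhdsWithin] with ε hε
    rw [hl, zero_add]
    exact mul_ne_zero hs hε
  · exact (tendsto_line l s).eventually_ne hl

theorem isBigO_line_inv (l : ℂ) {s : ℂ} (hs : s ≠ 0) :
    (fun ε : ℂ => (l + s * ε)⁻¹) =O[𝓝[≠] 0] fun ε => ε⁻¹ := by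
  refine IsBigO.inv_rev ?_ (by filter_upwards [self_mem_nhdsWithin] with ε hε h; exact absurd h hε)
  by_cases hl : l = 0
  · simp only [hl, zero_add]
    exact (isBigO_refl (fun ε : ℂ => ε) _).const_mul_right hs
  · have h1 : (fun ε : ℂ => ε) =O[𝓝[≠] 0] fun _ => (1 : ℂ) :=
      ((continuous_id.tendsto (0 : ℂ)).mono_left nhdsWithin_le_nhds).isBigO_one ℂ
    exact h1.trans ((isBigO_const_left_iff_pos_le_norm one_ne_zero).2
      ⟨‖l‖ / 2, half_pos (norm_pos_iff.2 hl), (tendsto_line l s).norm.eventually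
        (Ici_mem_nhds (half_lt_self (norm_pos_iff.2 hl)))⟩)

theorem isBigO_eval_line (p : ℂ[X]) (l s : ℂ) :
    (fun ε : ℂ => p.eval (l + s * ε)) =O[𝓝[≠] 0] (1 : ℂ → ℂ) :=
  ((p.continuous.tendsto l).comp (tendsto_line l s)).isBigO_one ℂ

theorem isBigO_chiA_line (hτ : 0 < τ.im) {a : ℕ} (ha : a < N) {z : ℂ} (hz : z ∉ lattice τ) {l : ℂ}
    (hl : l ∈ regularSet τ N a) (s : ℂ) :
    (fun ε : ℂ => chiA τ N a (l + s * ε) z) =O[𝓝[≠] 0] (1 : ℂ → ℂ) :=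
  (((differentiableOn_chiA hτ ha hz).differentiableAt
    ((isOpen_regularSet hτ ha).mem_nhds hl)).continuousAt.tendsto.comp
      (tendsto_line l s)).isBigO_one ℂ

theorem IsKernelPoly.isBigO_sub (hτ : 0 < τ.im) {a : ℕ} (ha : a < N) {n : ℕ} {z : ℂ} {p : ℂ[X]}
    (hp : IsKernelPoly μ τ ω n a z p) (hω : ω ∈ admissible μ N τ) {l : ℂ}
    (hl : l ∈ spectrum ℂ (adGrade μ N a ω)) (s : ℂ) :
    (fun ε : ℂ => chiA τ N a (l + s * ε) z - p.eval (l + s * ε)) =O[𝓝[≠] 0] fun ε => ε ^ n := by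
  obtain ⟨g, hg, H⟩ := hp
  have hreg := spectrum_adGrade_subset hω ha hl
  have hnhds := (isOpen_regularSet hτ ha).mem_nhds hreg
  set c := LinearMap.charpoly (adGrade μ N a ω) with hc
  have hc0 : c.eval l = 0 := (Module.End.mem_spectrum_iff_isRoot_charpoly _ l).1 hl
  have h1 : (fun ε : ℂ => c.eval (l + s * ε)) =O[𝓝[≠] 0] fun ε => ε := by
    have hd : DifferentiableAt ℂ (fun ε : ℂ => c.eval (l + s * ε)) 0 :=
      (c.differentiable.comp (f := fun ε : ℂ => l + s * ε) (by fun_prop)) 0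
    have := hd.isBigO_sub
    simp only [mul_zero, add_zero, hc0, sub_zero] at this
    exact this.mono nhdsWithin_le_nhds
  have h2 : (fun ε : ℂ => g (l + s * ε)) =O[𝓝[≠] 0] (fun _ => (1 : ℂ)) :=
    ((hg.differentiableAt hnhds).continuousAt.tendsto.comp (tendsto_line l s)).isBigO_one ℂ
  refine ((h1.pow n).mul h2).congr' ?_ (by simp)
  filter_upwards [(tendsto_line l s).eventually hnhds] with ε hε
  rw [H _ hε]
  ring

theorem isBigO_div_line {f : ℂ → ℂ} {n : ℕ} (hf : f =O[𝓝[≠] 0] fun ε => ε ^ (n + 1)) (l : ℂ)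
    {s : ℂ} (hs : s ≠ 0) : (fun ε => f ε / (l + s * ε)) =O[𝓝[≠] 0] fun ε => ε ^ n := by
  refine (hf.mul (isBigO_line_inv l hs)).congr' (.of_forall fun ε => (div_eq_mul_inv _ _).symm) ?_
  filter_upwards [self_mem_nhdsWithin] with ε hε
  rw [pow_succ, mul_inv_cancel_right₀ hε]

theorem pow_succ_isBigO_pow (n : ℕ) :
    (fun ε : ℂ => ε ^ (n + 1)) =O[𝓝[≠] 0] fun ε => ε ^ n := by
  have h0 : (fun ε : ℂ => ε) =O[𝓝[≠] (0 : ℂ)] fun _ => (1 : ℂ) :=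
    ((continuous_id.tendsto (0 : ℂ)).mono_left nhdsWithin_le_nhds).isBigO_one ℂ
  have h1 := (isBigO_refl (fun ε : ℂ => ε ^ n) (𝓝[≠] 0)).mul h0
  simpa only [mul_one, ← pow_succ] using h1

theorem polyDiff_eq_div (p : ℂ[X]) {x y d : ℂ} (hd : d ≠ 0) (h : x - y = d) :
    polyDiff p x 1 y = (p.eval x - p.eval y) / d := by
  rw [← eval_polyDiff p x y, h, mul_div_cancel_left₀ _ hd]

/-- The exact identity for the χ holds along the line, and χ differs from its polynomial by O(εⁿ⁺¹)
near each eigenvalue. The divided differences may have a denominator vanishing at ε = 0, which costs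
one power of ε. The conditions on u, v and u + v keep the three arguments away from 0 for small ε ≠
0. When an index is zero, a divided difference involves a second point, whence the extra spectral
hypotheses. -/
theorem isBigO_relPoly (hτ : 0 < τ.im) {p : ℕ → ℂ → ℂ[X]} {n : ℕ}
    (hp : ∀ a < N, ∀ z ∉ lattice τ, IsKernelPoly μ τ ω (n + 1) a z (p a z))
    (hω : ω ∈ admissible μ N τ) {a b c k : ℕ} (ha : a < N) (hb : b < N) (hc : c < N)
    (h : a + b + c = k * N) {α β γ : ℂ} (hsum : α + β + γ = 0)
    (hα : α ∈ spectrum ℂ (adGrade μ N a ω)) (hβ : β ∈ spectrum ℂ (adGrade μ N b ω))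
    (hγ : γ ∈ spectrum ℂ (adGrade μ N c ω))
    (ha0 : a = 0 → -β ∈ spectrum ℂ (adGrade μ N c ω))
    (hb0 : b = 0 → -α ∈ spectrum ℂ (adGrade μ N c ω))
    (hc0 : c = 0 → -α ∈ spectrum ℂ (adGrade μ N b ω)) {s t : ℂ} (hs : s ∉ lattice τ)
    (ht : t ∉ lattice τ) (hst : s + t ∉ lattice τ) {u v : ℂ} (hu : u ≠ 0) (hv : v ≠ 0)
    (huv : u + v ≠ 0) :
    (fun ε : ℂ => relPoly p a b c s t (β + u * ε) (γ + v * ε)) =O[𝓝[≠] 0] fun ε => ε ^ n := by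
  have hs' : -s ∉ lattice τ := by rwa [neg_mem_lattice_iff]
  have ht' : -t ∉ lattice τ := by rwa [neg_mem_lattice_iff]
  have hst' : -(s + t) ∉ lattice τ := by rwa [neg_mem_lattice_iff]
  have huv' : -(u + v) ≠ 0 := neg_ne_zero.2 huv
  have low : ∀ {f : ℂ → ℂ}, f =O[𝓝[≠] 0] (fun ε => ε ^ (n + 1)) → f =O[𝓝[≠] 0] fun ε => ε ^ n :=
    fun hf => hf.trans (pow_succ_isBigO_pow n)
  have hrα := spectrum_adGrade_subset hω ha hα
  have hrβ := spectrum_adGrade_subset hω hb hβ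
  have hrγ := spectrum_adGrade_subset hω hc hγ
  have hB := fun z hz => (hp b hb z hz).isBigO_sub hτ hb hω hβ u
  have hC := fun z hz => (hp c hc z hz).isBigO_sub hτ hc hω hγ v
  have hA := fun z hz => (hp a ha z hz).isBigO_sub hτ ha hω hα (-(u + v))
  have t1 := isBigO_mul_sub_mul (low (hB s hs)) (low (hC (s + t) hst))
    (isBigO_chiA_line hτ hc hst hrγ v) (isBigO_eval_line _ _ _)
  have t2 := isBigO_mul_sub_mul (low (hA (-s) hs')) (low (hC t ht))
    (isBigO_chiA_line hτ hc ht hrγ v) (isBigO_eval_line _ _ _)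
  have t3 := isBigO_mul_sub_mul (low (hA _ hst')) (low (hB _ ht'))
    (isBigO_chiA_line hτ hb ht' hrβ u) (isBigO_eval_line _ _ _)
  -- The numerator must be small at both of its points, γ + vε and -β - uε, before it is divided.
  have t4 : (fun ε : ℂ => if a = 0 then
      ((chiA τ N c (γ + v * ε) t - (p c t).eval (γ + v * ε))
        - (chiA τ N c (-β + -u * ε) t - (p c t).eval (-β + -u * ε))) / (α + -(u + v) * ε) else 0)
      =O[𝓝[≠] 0] fun ε => ε ^ n := by
    split_ifs with h0
    · exact isBigO_div_line ((hC t ht).sub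
        ((hp c hc t ht).isBigO_sub hτ hc hω (ha0 h0) (-u))) α huv'
    · exact isBigO_zero _ _
  have t5 : (fun ε : ℂ => if b = 0 then
      ((chiA τ N c (γ + v * ε) (s + t) - (p c (s + t)).eval (γ + v * ε))
        - (chiA τ N c (-α + (u + v) * ε) (s + t)
          - (p c (s + t)).eval (-α + (u + v) * ε))) / (β + u * ε) else 0)
      =O[𝓝[≠] 0] fun ε => ε ^ n := by
    split_ifs with h0
    · exact isBigO_div_line ((hC _ hst).sub
        ((hp c hc _ hst).isBigO_sub hτ hc hω (hb0 h0) (u + v))) β hu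
    · exact isBigO_zero _ _
  have t6 : (fun ε : ℂ => if c = 0 then
      ((chiA τ N b (β + u * ε) s - (p b s).eval (β + u * ε))
        - (chiA τ N b (-α + (u + v) * ε) s - (p b s).eval (-α + (u + v) * ε))) / (γ + v * ε) else 0)
      =O[𝓝[≠] 0] fun ε => ε ^ n := by
    split_ifs with h0
    · exact isBigO_div_line ((hB _ hs).sub
        ((hp b hb _ hs).isBigO_sub hτ hb hω (hc0 h0) (u + v))) γ hv
    · exact isBigO_zero _ _
  refine (((((t1.add t2).add t3).add t4).add t5).add t6).neg_left.congr' ?_ .rfl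
  filter_upwards [eventually_line_ne_zero α huv', eventually_line_ne_zero β hu,
    eventually_line_ne_zero γ hv,
    (tendsto_line α (-(u + v))).eventually ((isOpen_regularSet hτ ha).mem_nhds hrα),
    (tendsto_line β u).eventually ((isOpen_regularSet hτ hb).mem_nhds hrβ),
    (tendsto_line γ v).eventually ((isOpen_regularSet hτ hc).mem_nhds hrγ)]
    with ε hα0 hβ0 hγ0 hαr hβr hγr
  have hid := chiA_identity hτ ha hb hc h (by linear_combination hsum) hα0 hβ0 hγ0 hαr hβr hγr
    hs ht hst
  have e1 : -(β + u * ε) - (γ + v * ε) = α + -(u + v) * ε := by linear_combination -hsum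
  have e2 : -(β + u * ε) = -β + -u * ε := by ring
  have e3 : (β + u * ε) + (γ + v * ε) = -α + (u + v) * ε := by linear_combination hsum
  have e4 : -(α + -(u + v) * ε) = -α + (u + v) * ε := by ring
  rw [e2, e4] at hid
  rw [relPoly, e1, e2, e3,
    polyDiff_eq_div (p c t) hα0 (by linear_combination -hsum),
    polyDiff_eq_div (p c (s + t)) hβ0 (by linear_combination -hsum),
    polyDiff_eq_div (p b s) hγ0 (by linear_combination -hsum)]
  simp only [coe_aeval_eq_eval]
  have hsub : ∀ (P : Prop) [Decidable P] (x y x' y' d : ℂ),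
      (if P then ((x - y) - (x' - y')) / d else 0) =
        (if P then (x - x') / d else 0) + (if P then (y' - y) / d else 0) := by
    intro P _ x y x' y' d
    split_ifs
    · ring
    · simp
  rw [hsub, hsub, hsub]
  linear_combination -hid

end Estimate

/-! ### The action of ad ω on the arguments of the bracket -/

section BivariateAction

open Polynomial

variable {G : Type*} [LieRing G] [LieAlgebra ℂ G]

theorem commute_rTensor_lTensor (A : Module.End ℂ G) (p q : ℂ[X]) :
    Commute (((Module.End.rTensorAlgHom ℂ G G).comp (aeval (R := ℂ) A)) p)
      (((Module.End.lTensorAlgHom ℂ G G).comp (aeval (R := ℂ) A)) q) :=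
  TensorProduct.ext' fun _ _ => rfl

/-- The action of `ℂ[η, ζ]` on `G ⊗ G` in which `η` acts as `A ⊗ 1` and `ζ` as `1 ⊗ A`. -/
def bivariateAct (A : Module.End ℂ G) :
    MvPolynomial (Fin 2) ℂ →ₐ[ℂ] Module.End ℂ (G ⊗[ℂ] G) :=
  (Algebra.TensorProduct.lift ((Module.End.rTensorAlgHom ℂ G G).comp (aeval (R := ℂ) A))
    ((Module.End.lTensorAlgHom ℂ G G).comp (aeval (R := ℂ) A))
    (commute_rTensor_lTensor A)).comp
      (MvPolynomial.aeval ![(X : ℂ[X]) ⊗ₜ[ℂ] (1 : ℂ[X]), (1 : ℂ[X]) ⊗ₜ[ℂ] (X : ℂ[X])])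

theorem bivariateAct_X_zero (A : Module.End ℂ G) :
    bivariateAct A (MvPolynomial.X 0) = Module.End.rTensorAlgHom ℂ G G A := by
  rw [bivariateAct, AlgHom.comp_apply, MvPolynomial.aeval_X, Matrix.cons_val_zero,
    Algebra.TensorProduct.lift_tmul, map_one, mul_one, AlgHom.comp_apply, aeval_X]

theorem bivariateAct_X_one (A : Module.End ℂ G) :
    bivariateAct A (MvPolynomial.X 1) = Module.End.lTensorAlgHom ℂ G G A := by
  rw [bivariateAct, AlgHom.comp_apply, MvPolynomial.aeval_X, Matrix.cons_val_one,
    Matrix.cons_val_fin_one, Algebra.TensorProduct.lift_tmul, map_one, one_mul,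
    AlgHom.comp_apply, aeval_X]

theorem bivariateAct_aeval_zero (A : Module.End ℂ G) (p : ℂ[X]) (y w : G) :
    bivariateAct A (aeval (MvPolynomial.X 0) p) (y ⊗ₜ w) = aeval A p y ⊗ₜ w := by
  rw [← aeval_algHom_apply, bivariateAct_X_zero, aeval_algHom_apply]
  rfl

theorem bivariateAct_aeval_one (A : Module.End ℂ G) (p : ℂ[X]) (y w : G) :
    bivariateAct A (aeval (MvPolynomial.X 1) p) (y ⊗ₜ w) = y ⊗ₜ aeval A p w := by
  rw [← aeval_algHom_apply, bivariateAct_X_one, aeval_algHom_apply]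
  rfl

theorem brk_tmul (y w : G) : brk (y ⊗ₜ[ℂ] w) = ⁅y, w⁆ := rfl

theorem map_aeval_of_intertwine {V W : Type*} [AddCommGroup V] [Module ℂ V] [AddCommGroup W]
    [Module ℂ W] {f : V →ₗ[ℂ] W} {S : Module.End ℂ V} {S' : Module.End ℂ W}
    (h : ∀ v, f (S v) = S' (f v)) (p : ℂ[X]) (v : V) : f (aeval S p v) = aeval S' p (f v) := by
  have hk : ∀ k : ℕ, ∀ v, f ((S ^ k) v) = (S' ^ k) (f v) := by
    intro k
    induction k with
    | zero => simp
    | succ k ih =>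
      intro v
      rw [pow_succ, pow_succ, Module.End.mul_apply, Module.End.mul_apply, ih, h]
  simp only [aeval_eq_sum_range, LinearMap.sum_apply, LinearMap.smul_apply, map_sum, map_smul, hk]

variable (ω : G)

local notation "Aω" => LieAlgebra.ad ℂ G ω

/-- This is the Leibniz rule for ad ω. -/
theorem brk_bivariateAct_add (u : G ⊗[ℂ] G) :
    brk (bivariateAct Aω (MvPolynomial.X 0 + MvPolynomial.X 1) u) = Aω (brk u) := by
  rw [map_add, bivariateAct_X_zero, bivariateAct_X_one]
  induction u using TensorProduct.induction_on with
  | zero => simp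
  | tmul y w =>
    change brk (⁅ω, y⁆ ⊗ₜ[ℂ] w + y ⊗ₜ[ℂ] ⁅ω, w⁆) = ⁅ω, brk (y ⊗ₜ[ℂ] w)⁆
    rw [map_add, brk_tmul, brk_tmul, brk_tmul, leibniz_lie ω y w]
  | add u u' h h' => simp only [map_add, h, h']

theorem brk_bivariateAct_aeval_add (p : ℂ[X]) (P : MvPolynomial (Fin 2) ℂ) (u : G ⊗[ℂ] G) :
    brk (bivariateAct Aω (aeval (MvPolynomial.X 0 + MvPolynomial.X 1) p * P) u) =
      aeval Aω p (brk (bivariateAct Aω P u)) := by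
  rw [map_mul, Module.End.mul_apply, ← aeval_algHom_apply]
  exact map_aeval_of_intertwine (brk_bivariateAct_add ω) p _

variable {B : LinearMap.BilinForm ℂ G}

theorem form_ad_left (hB : B.lieInvariant G) (x y : G) : B (Aω x) y = B x ((-Aω) y) := by
  rw [LieAlgebra.ad_apply, LinearMap.neg_apply, LieAlgebra.ad_apply, map_neg, form_lie_left hB]

-- By invariance of `B`, ad ω acting on x equals the negative of ad ω acting on the bracket, that
-- is, -η - ζ.
variable {ω} in
theorem form_brk_bivariateAct_aeval_sub (hB : B.lieInvariant G) (p : ℂ[X])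
    (P : MvPolynomial (Fin 2) ℂ) (x : G) (u : G ⊗[ℂ] G) :
    B x (brk (bivariateAct Aω (aeval (-MvPolynomial.X 0 - MvPolynomial.X 1) p * P) u)) =
      B (aeval Aω p x) (brk (bivariateAct Aω P u)) := by
  have e : aeval (-MvPolynomial.X 0 - MvPolynomial.X 1 : MvPolynomial (Fin 2) ℂ) p =
      aeval (MvPolynomial.X 0 + MvPolynomial.X 1) (p.comp (-X)) := by
    rw [aeval_comp, map_neg, aeval_X, neg_add, sub_eq_add_neg]
  rw [e, brk_bivariateAct_aeval_add, form_aeval (form_ad_left ω hB), aeval_comp, map_neg, aeval_X]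

/-- A monomial (η + ζ)ⁱ ζʲ applies ad ω to w j times, brackets with y, and then applies ad ω i
times. Summed up, the divided difference is the derivative of p(ad ω) in the direction y. -/
theorem brk_bivariateAct_polyDiff_one (p : ℂ[X]) (y w : G) :
    brk (bivariateAct Aω (polyDiff p (MvPolynomial.X 0 + MvPolynomial.X 1) 1 (MvPolynomial.X 1))
      (y ⊗ₜ w)) = polyDiff p Aω (LieAlgebra.ad ℂ G y) Aω w := by
  simp only [polyDiff, map_sum, map_smul, mul_one, LinearMap.sum_apply, LinearMap.smul_apply]
  refine Finset.sum_congr rfl fun k _ => ?_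
  congr 1
  refine Finset.sum_congr rfl fun i _ => ?_
  have h1 := brk_bivariateAct_aeval_add ω (X ^ i) (aeval (MvPolynomial.X 1) (X ^ (k - 1 - i) : ℂ[X]))
    (y ⊗ₜ w)
  rw [bivariateAct_aeval_one, brk_tmul] at h1
  simpa only [map_pow, aeval_X, Module.End.mul_apply, LieAlgebra.ad_apply] using h1

theorem brk_bivariateAct_polyDiff_zero (p : ℂ[X]) (y w : G) :
    brk (bivariateAct Aω (polyDiff p (MvPolynomial.X 0 + MvPolynomial.X 1) 1 (MvPolynomial.X 0))
      (y ⊗ₜ w)) = -polyDiff p Aω (LieAlgebra.ad ℂ G w) Aω y := by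
  simp only [polyDiff, map_sum, map_smul, mul_one, LinearMap.sum_apply, LinearMap.smul_apply]
  rw [← Finset.sum_neg_distrib]
  refine Finset.sum_congr rfl fun k _ => ?_
  rw [← smul_neg, ← Finset.sum_neg_distrib]
  congr 1
  refine Finset.sum_congr rfl fun i _ => ?_
  have h1 := brk_bivariateAct_aeval_add ω (X ^ i) (aeval (MvPolynomial.X 0) (X ^ (k - 1 - i) : ℂ[X]))
    (y ⊗ₜ w)
  rw [bivariateAct_aeval_zero, brk_tmul, ← lie_skew, map_neg] at h1
  simpa only [map_pow, aeval_X, Module.End.mul_apply, LieAlgebra.ad_apply] using h1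

theorem form_lie_rotate (hB : B.lieInvariant G) (x y w : G) : B x ⁅y, w⁆ = -B y ⁅x, w⁆ := by
  rw [← form_lie_left hB x y w, ← lie_skew x y, map_neg, LinearMap.neg_apply,
    form_lie_left hB y x w, neg_neg]

variable {ω} in
theorem form_brk_bivariateAct_polyDiff (hB : B.lieInvariant G) (p : ℂ[X]) (x y w : G) :
    B x (brk (bivariateAct Aω (polyDiff p (-MvPolynomial.X 0) 1 (MvPolynomial.X 1)) (y ⊗ₜ w))) =
      -B y (polyDiff p Aω (LieAlgebra.ad ℂ G x) Aω w) := by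
  simp only [polyDiff, map_sum, map_smul, mul_one, LinearMap.sum_apply, LinearMap.smul_apply]
  rw [← Finset.sum_neg_distrib]
  refine Finset.sum_congr rfl fun k _ => ?_
  rw [← smul_neg, ← Finset.sum_neg_distrib]
  congr 1
  refine Finset.sum_congr rfl fun i _ => ?_
  have e : ((-MvPolynomial.X 0) ^ i * MvPolynomial.X 1 ^ (k - 1 - i) : MvPolynomial (Fin 2) ℂ) =
      aeval (MvPolynomial.X 0) ((-X) ^ i : ℂ[X]) *
        aeval (MvPolynomial.X 1) (X ^ (k - 1 - i) : ℂ[X]) := by simp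
  rw [e, map_mul, Module.End.mul_apply, bivariateAct_aeval_one, bivariateAct_aeval_zero, brk_tmul,
    form_lie_rotate hB, form_aeval (form_ad_left ω hB)]
  simp only [map_pow, map_neg, aeval_X, neg_neg, Module.End.mul_apply, LieAlgebra.ad_apply]

-- Dictionary between the polynomial relation and the dynamical Yang-Baxter equation contracted with
-- x, y, w: products give the three brackets, divided differences the three derivative terms. The
-- differing signs come from antisymmetry of the bracket and from invariance of `B`.
variable {ω} in
theorem form_brk_bivariateAct_relPoly (hB : B.lieInvariant G) (p : ℕ → ℂ → ℂ[X]) (a b c : ℕ)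
    (s t : ℂ) (x y w : G) :
    B x (brk (bivariateAct Aω
        (relPoly p a b c s t (MvPolynomial.X 0) (MvPolynomial.X 1)) (y ⊗ₜ w))) =
      B x ⁅aeval Aω (p b s) y, aeval Aω (p c (s + t)) w⁆
      + B (aeval Aω (p a (-s)) x) ⁅y, aeval Aω (p c t) w⁆
      + B (aeval Aω (p a (-(s + t))) x) ⁅aeval Aω (p b (-t)) y, w⁆
      + (if a = 0 then B y (polyDiff (p c t) Aω (LieAlgebra.ad ℂ G x) Aω w) else 0)
      - (if b = 0 then B x (polyDiff (p c (s + t)) Aω (LieAlgebra.ad ℂ G y) Aω w) else 0)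
      + (if c = 0 then B x (polyDiff (p b s) Aω (LieAlgebra.ad ℂ G w) Aω y) else 0) := by
  have hite : ∀ (P : Prop) [Decidable P] (Q : MvPolynomial (Fin 2) ℂ),
      B x (brk (bivariateAct Aω (if P then Q else 0) (y ⊗ₜ w))) =
        if P then B x (brk (bivariateAct Aω Q (y ⊗ₜ w))) else 0 := by
    intro P _ Q
    split_ifs <;> simp
  simp only [relPoly, map_add, map_sub, LinearMap.add_apply, LinearMap.sub_apply, hite]
  rw [form_brk_bivariateAct_aeval_sub hB, form_brk_bivariateAct_aeval_sub hB,
    form_brk_bivariateAct_polyDiff hB, brk_bivariateAct_polyDiff_one,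
    brk_bivariateAct_polyDiff_zero, bivariateAct_aeval_one, bivariateAct_aeval_zero, map_mul,
    Module.End.mul_apply, bivariateAct_aeval_one, bivariateAct_aeval_zero, brk_tmul, brk_tmul,
    brk_tmul, map_neg]
  split_ifs <;> ring

end BivariateAction

/-! ### The dynamical Yang-Baxter equation -/

section Dynamical

open Polynomial

variable {G : Type*} [LieRing G] [LieAlgebra ℂ G] {μ : G ≃ₗ⁅ℂ⁆ G} {N : ℕ}
  {B : LinearMap.BilinForm ℂ G} {τ : ℂ} {ω : grade μ N 0}

local notation "A" => LieAlgebra.ad ℂ G (ω : G)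

theorem mem_spectrum_of_aeval_eq_zero {a k : ℕ} {α : ℂ} {x : G} (hx : x ∈ grade μ N a)
    (hx0 : x ≠ 0) (h : aeval A ((X - C α) ^ k) x = 0) : α ∈ spectrum ℂ (adGrade μ N a ω) := by
  by_contra hα
  have hu : IsUnit (aeval (adGrade μ N a ω) ((X - C α) ^ k)) := by
    rw [map_pow, map_sub, aeval_X, aeval_C]
    exact ((IsUnit.sub_iff).1 (spectrum.notMem_iff.1 hα)).pow k
  have hinj := ((Module.End.isUnit_iff _).1 hu).1
  have h0 : aeval (adGrade μ N a ω) ((X - C α) ^ k) ⟨x, hx⟩ = 0 := by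
    ext
    rw [coe_aeval_adGrade, h]
    rfl
  exact hx0 (congrArg Subtype.val (hinj (h0.trans (map_zero _).symm)))

/-- Were -β not an eigenvalue on G_c, every w in G_c would be a value of (-ad ω - β)ᵏ, and moving
this power across `B` to y would make y orthogonal to G_c. -/
theorem neg_mem_spectrum_of_aeval_eq_zero (hN : 0 < N) (hB : B.Nondegenerate) (hBsymm : B.IsSymm)
    (hBinv : B.lieInvariant G) (hμ : ∀ x, (⇑μ)^[N] x = x) (hBμ : ∀ x y, B (μ x) (μ y) = B x y)
    {b c : ℕ} (hc : c < N) (hbc : N ∣ b + c) {k : ℕ} {β : ℂ} {y : G} (hy : y ∈ grade μ N b)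
    (hy0 : y ≠ 0) (h : aeval A ((X - C β) ^ k) y = 0) :
    -β ∈ spectrum ℂ (adGrade μ N c ω) := by
  by_contra hβ
  have hu : IsUnit (aeval (adGrade μ N c ω) (((X - C β) ^ k).comp (-X))) := by
    rw [aeval_comp, map_pow, map_sub, aeval_X, aeval_C, map_neg, aeval_X]
    refine IsUnit.pow k ?_
    have h1 := spectrum.notMem_iff.1 hβ
    rw [map_neg] at h1
    rwa [sub_eq_add_neg, add_comm, ← sub_eq_add_neg]
  have hsurj := ((Module.End.isUnit_iff _).1 hu).2
  refine hy0 (eq_zero_of_form_grade_eq_zero hN hB hμ hBμ hc (by rwa [add_comm]) hy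
    fun w hw => ?_)
  obtain ⟨w', hw'⟩ := hsurj ⟨w, hw⟩
  have h2 : w = aeval A (((X - C β) ^ k).comp (-X)) w' := by
    rw [← coe_aeval_adGrade, hw']
  rw [hBsymm.eq, h2, aeval_comp, map_neg, aeval_X, ← form_aeval (form_ad_left (ω : G) hBinv), h,
    map_zero, LinearMap.zero_apply]

theorem grade_induction [FiniteDimensional ℂ G] (hN : 0 < N) (hμ : ∀ x, (⇑μ)^[N] x = x)
    {P : G → Prop} (h0 : P 0) (hadd : ∀ x x', P x → P x' → P (x + x'))
    (h : ∀ a < N, ∀ x ∈ grade μ N a, ∀ α : ℂ,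
      aeval A ((X - C α) ^ Module.finrank ℂ G) x = 0 → P x) (x : G) : P x := by
  rw [← sum_gradeProj hN hμ x]
  refine Finset.sum_induction _ P hadd h0 fun a ha => ?_
  generalize gradeProj μ N hμ a x = v
  have hv : v ∈ ⨆ α : ℂ, (adGrade μ N a ω).maxGenEigenspace α := by
    rw [Module.End.iSup_maxGenEigenspace_eq_top]
    trivial
  refine Submodule.iSup_induction _ (motive := fun v : grade μ N a => P v) hv ?_ h0
    fun v v' hv hv' => hadd _ _ hv hv'
  intro α v hv
  refine h a (Finset.mem_range.1 ha) v v.2 α ?_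
  rw [Module.End.maxGenEigenspace_eq_genEigenspace_finrank, Module.End.mem_genEigenspace_nat,
    LinearMap.mem_ker] at hv
  -- The exponent is padded from the dimension of G_a to that of G, so that one exponent works for
  -- all grades.
  rw [← coe_aeval_adGrade, map_pow, map_sub, aeval_X, aeval_C, Algebra.algebraMap_eq_smul_one,
    ← Nat.sub_add_cancel (Submodule.finrank_le (grade μ N a)), pow_add, Module.End.mul_apply, hv,
    map_zero]
  rfl

variable (B ω) in
/-- The largest ideal of `ℂ[η, ζ]` annihilating the functional `P ↦ B(x, [P (y ⊗ w)])`. -/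
def formIdeal (x y w : G) : Ideal (MvPolynomial (Fin 2) ℂ) where
  carrier := {Q | ∀ P, B x (brk (bivariateAct A (P * Q) (y ⊗ₜ w))) = 0}
  add_mem' hQ hQ' P := by
    rw [mul_add, map_add, LinearMap.add_apply, map_add, map_add, hQ P, hQ' P, add_zero]
  zero_mem' P := by simp
  smul_mem' R Q hQ P := by
    rw [smul_eq_mul, ← mul_assoc]
    exact hQ _

theorem form_brk_eq_zero_of_not_dvd (hN : 0 < N) (hBμ : ∀ x y, B (μ x) (μ y) = B x y) {a b c : ℕ}
    {x y w : G} (hx : x ∈ grade μ N a) (hy : y ∈ grade μ N b) (hw : w ∈ grade μ N c)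
    (h : ¬N ∣ a + b + c) (P : MvPolynomial (Fin 2) ℂ) :
    B x (brk (bivariateAct A P (y ⊗ₜ w))) = 0 := by
  induction P using MvPolynomial.induction_on' with
  | monomial d r =>
    have e : MvPolynomial.monomial d r = MvPolynomial.C r *
        (aeval (MvPolynomial.X 0) (X ^ d 0 : ℂ[X]) * aeval (MvPolynomial.X 1) (X ^ d 1 : ℂ[X])) := by
      rw [MvPolynomial.monomial_eq, Finsupp.prod_fintype _ _ (by simp)]
      simp
    rw [e, ← MvPolynomial.algebraMap_eq, ← Algebra.smul_def, map_smul, map_mul,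
      LinearMap.smul_apply, Module.End.mul_apply, bivariateAct_aeval_one, bivariateAct_aeval_zero,
      map_smul, map_smul, brk_tmul, form_eq_zero_of_mem_grade hN hBμ
        (by rwa [← add_assoc]) hx
        (lie_mem_grade_add (aeval_ad_mem_grade ω _ hy) (aeval_ad_mem_grade ω _ hw)), smul_zero]
  | add p q hp hq => rw [map_add, LinearMap.add_apply, map_add, map_add, hp, hq, add_zero]

variable [FiniteDimensional ℂ G]

/-- The ideal contains the n-th powers of η - β, ζ - γ and -η - ζ - α. If the eigenvalues do not sum
to zero, the sum of these three linear forms is a nonzero constant in the radical, so the ideal is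
everything. If they do, vanishing to order 2n along generic lines suffices. Representing χ to order
2n + 1 allows for the power lost in the divided differences. -/
theorem relPoly_mem_formIdeal (hτ : 0 < τ.im) (hN : 0 < N) (hB : B.Nondegenerate)
    (hBsymm : B.IsSymm) (hBinv : B.lieInvariant G) (hμ : ∀ x, (⇑μ)^[N] x = x)
    (hBμ : ∀ x y, B (μ x) (μ y) = B x y) (hω : ω ∈ admissible μ N τ) {p : ℕ → ℂ → ℂ[X]} {n : ℕ}
    (hp : ∀ a < N, ∀ z ∉ lattice τ, IsKernelPoly μ τ ω (2 * n + 1) a z (p a z)) {a b c : ℕ}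
    (ha : a < N) (hb : b < N) (hc : c < N) (habc : N ∣ a + b + c) {x y w : G}
    (hx : x ∈ grade μ N a) (hy : y ∈ grade μ N b) (hw : w ∈ grade μ N c) {α β γ : ℂ}
    (hxα : aeval A ((X - C α) ^ n) x = 0) (hyβ : aeval A ((X - C β) ^ n) y = 0)
    (hwγ : aeval A ((X - C γ) ^ n) w = 0) {s t : ℂ} (hs : s ∉ lattice τ) (ht : t ∉ lattice τ)
    (hst : s + t ∉ lattice τ) :
    relPoly p a b c s t (MvPolynomial.X 0) (MvPolynomial.X 1) ∈ formIdeal B ω x y w := by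
  by_cases h0 : x = 0 ∨ y = 0 ∨ w = 0
  · intro P
    rcases h0 with rfl | rfl | rfl <;> simp
  simp only [not_or] at h0
  obtain ⟨hx0, hy0, hw0⟩ := h0
  have hβ : (MvPolynomial.X 0 - MvPolynomial.C β) ^ n ∈ formIdeal B ω x y w := by
    intro P
    have e : (MvPolynomial.X 0 - MvPolynomial.C β) ^ n =
        aeval (MvPolynomial.X 0 : MvPolynomial (Fin 2) ℂ) ((X - C β) ^ n) := by
      simp [MvPolynomial.algebraMap_eq]
    rw [e, map_mul, Module.End.mul_apply, bivariateAct_aeval_zero, hyβ]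
    simp
  have hγ : (MvPolynomial.X 1 - MvPolynomial.C γ) ^ n ∈ formIdeal B ω x y w := by
    intro P
    have e : (MvPolynomial.X 1 - MvPolynomial.C γ) ^ n =
        aeval (MvPolynomial.X 1 : MvPolynomial (Fin 2) ℂ) ((X - C γ) ^ n) := by
      simp [MvPolynomial.algebraMap_eq]
    rw [e, map_mul, Module.End.mul_apply, bivariateAct_aeval_one, hwγ]
    simp
  have hα : (-MvPolynomial.X 0 - MvPolynomial.X 1 - MvPolynomial.C α) ^ n ∈
      formIdeal B ω x y w := by
    intro P
    have e : (-MvPolynomial.X 0 - MvPolynomial.X 1 - MvPolynomial.C α) ^ n =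
        aeval (-MvPolynomial.X 0 - MvPolynomial.X 1 : MvPolynomial (Fin 2) ℂ)
          ((X - C α) ^ n) := by
      simp [MvPolynomial.algebraMap_eq]
    rw [e, mul_comm, form_brk_bivariateAct_aeval_sub hBinv, hxα]
    simp
  by_cases hsum : α + β + γ = 0
  · refine mem_ideal_of_dvd_line hβ hγ fun u v hu hv huv => X_pow_dvd_of_isBigO ?_
    obtain ⟨k, hk⟩ := habc
    have hbc : a = 0 → N ∣ b + c := fun h => ⟨k, by rw [← hk, h, zero_add]⟩
    have hac : b = 0 → N ∣ a + c := fun h => ⟨k, by rw [← hk, h, add_zero]⟩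
    have hab : c = 0 → N ∣ a + b := fun h => ⟨k, by rw [← hk, h, add_zero]⟩
    have key := isBigO_relPoly hτ hp hω ha hb hc (hk.trans (mul_comm _ _)) hsum
      (mem_spectrum_of_aeval_eq_zero hx hx0 hxα) (mem_spectrum_of_aeval_eq_zero hy hy0 hyβ)
      (mem_spectrum_of_aeval_eq_zero hw hw0 hwγ)
      (fun h => neg_mem_spectrum_of_aeval_eq_zero hN hB hBsymm hBinv hμ hBμ hc (hbc h) hy hy0 hyβ)
      (fun h => neg_mem_spectrum_of_aeval_eq_zero hN hB hBsymm hBinv hμ hBμ hc (hac h) hx hx0 hxα)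
      (fun h => neg_mem_spectrum_of_aeval_eq_zero hN hB hBsymm hBinv hμ hBμ hb (hab h) hx hx0 hxα)
      hs ht hst hu hv huv
    refine key.congr_left fun ε => ?_
    rw [← coe_aeval_eq_eval, map_relPoly, map_relPoly, MvPolynomial.aeval_X, MvPolynomial.aeval_X]
    simp
  · have hr : MvPolynomial.C (α + β + γ) ∈ (formIdeal B ω x y w).radical := by
      have e : (MvPolynomial.C (α + β + γ) : MvPolynomial (Fin 2) ℂ) =
          -((-MvPolynomial.X 0 - MvPolynomial.X 1 - MvPolynomial.C α)
            + (MvPolynomial.X 0 - MvPolynomial.C β) + (MvPolynomial.X 1 - MvPolynomial.C γ)) := by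
        rw [map_add, map_add]
        ring
      rw [e]
      exact neg_mem (add_mem (add_mem ⟨n, hα⟩ ⟨n, hβ⟩) ⟨n, hγ⟩)
    have htop := Ideal.eq_top_of_isUnit_mem _ hr
      ((isUnit_iff_ne_zero.2 hsum).map MvPolynomial.C)
    rw [Ideal.radical_eq_top.1 htop]
    trivial

theorem form_brk_relPoly_eq_zero (hτ : 0 < τ.im) (hN : 0 < N) (hB : B.Nondegenerate)
    (hBsymm : B.IsSymm) (hBinv : B.lieInvariant G) (hμ : ∀ x, (⇑μ)^[N] x = x)
    (hBμ : ∀ x y, B (μ x) (μ y) = B x y) (hω : ω ∈ admissible μ N τ) {p : ℕ → ℂ → ℂ[X]} {n : ℕ}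
    (hp : ∀ a < N, ∀ z ∉ lattice τ, IsKernelPoly μ τ ω (2 * n + 1) a z (p a z)) {a b c : ℕ}
    (ha : a < N) (hb : b < N) (hc : c < N) {x y w : G}
    (hx : x ∈ grade μ N a) (hy : y ∈ grade μ N b) (hw : w ∈ grade μ N c) {α β γ : ℂ}
    (hxα : aeval A ((X - C α) ^ n) x = 0) (hyβ : aeval A ((X - C β) ^ n) y = 0)
    (hwγ : aeval A ((X - C γ) ^ n) w = 0) {s t : ℂ} (hs : s ∉ lattice τ) (ht : t ∉ lattice τ)
    (hst : s + t ∉ lattice τ) :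
    B x (brk (bivariateAct A (relPoly p a b c s t (MvPolynomial.X 0) (MvPolynomial.X 1))
      (y ⊗ₜ w))) = 0 := by
  by_cases habc : N ∣ a + b + c
  · have := relPoly_mem_formIdeal hτ hN hB hBsymm hBinv hμ hBμ hω hp ha hb hc habc hx hy hw hxα hyβ
      hwγ hs ht hst 1
    rwa [one_mul] at this
  · exact form_brk_eq_zero_of_not_dvd hN hBμ hx hy hw habc _

variable {hμ : ∀ x, (⇑μ)^[N] x = x} {κ : Type*} [Fintype κ] [DecidableEq κ]
  {t t' : Module.Basis κ ℂ (grade μ N 0)}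

-- Dual bases reassemble x from its coordinates, so the sum over j is the derivative in the
-- direction x if x lies in G_0. All other grades are orthogonal to G_0.
omit [FiniteDimensional ℂ G] in
theorem sum_form_mul_derivROp (hN : 0 < N) (hBsymm : B.IsSymm)
    (hBμ : ∀ x y, B (μ x) (μ y) = B x y)
    (ht : ∀ i j, B (t i) (t' j) = if i = j then 1 else 0) (q : ℕ → ℂ[X]) {a c : ℕ} (ha : a < N)
    (hc : c < N) {x w : G} (hx : x ∈ grade μ N a) (hw : w ∈ grade μ N c) (y : G) :
    ∑ j, B x (t j) * B y (derivROp hμ q ω (t' j) w) =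
      if a = 0 then B y (polyDiff (q c) A (LieAlgebra.ad ℂ G x) A w) else 0 := by
  split_ifs with h
  · subst h
    have h1 : ∀ v : grade μ N 0, ∑ j, B v (t j) • t' j = v := by
      intro v
      have : (∑ j, (LinearMap.toSpanSingleton ℂ (grade μ N 0) (t' j)) ∘ₗ
          (B.flip (t j)) ∘ₗ (grade μ N 0).subtype) = LinearMap.id := by
        refine t'.ext fun i => ?_
        simp [LinearMap.sum_apply, hBsymm.eq (t' i : G), ht]
      simpa [LinearMap.sum_apply] using LinearMap.congr_fun this v
    have h2 := derivROp_apply (hμ := hμ) q ω ⟨x, hx⟩ hc hw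
    rw [← h2]
    conv_rhs => rw [← h1 ⟨x, hx⟩]
    simp [LinearMap.sum_apply]
  · refine Finset.sum_eq_zero fun j _ => ?_
    rw [form_eq_zero_of_mem_grade hN hBμ (fun h' => h ?_) hx (t j).2, zero_mul]
    exact Nat.eq_zero_of_dvd_of_lt (by simpa using h') ha

variable {ι : Type*} [Fintype ι] [DecidableEq ι] {T T' : Module.Basis ι ℂ G}

theorem contractRight_rMat (hT : ∀ α β, B (T α) (T' β) = if α = β then 1 else 0) (z : ℂ) (y : G) :
    contractRight B y (rMat B μ N hμ T T' τ ω z) = ROp μ N hμ τ ω z y :=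
  contractRight_endTensor hT _ y

theorem contractLeft_rMat (hτ : 0 < τ.im) (hN : 0 < N) (hB : B.Nondegenerate)
    (hBsymm : B.IsSymm) (hBinv : B.lieInvariant G) (hBμ : ∀ x y, B (μ x) (μ y) = B x y)
    (hω : ω ∈ admissible μ N τ) (hT : ∀ α β, B (T α) (T' β) = if α = β then 1 else 0) {z : ℂ}
    (hz : z ∉ lattice τ) (x : G) :
    contractLeft B x (rMat B μ N hμ T T' τ ω z) = -ROp μ N hμ τ ω (-z) x := by
  refine contractLeft_endTensor hT hBsymm (R' := -ROp μ N hμ τ ω (-z)) (fun x y => ?_) x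
  rw [LinearMap.neg_apply, map_neg, LinearMap.neg_apply,
    ROp_skew hτ hN hB hBinv hBμ hω (neg_mem_lattice_iff.not.2 hz), neg_neg, neg_neg]

omit [Fintype ι] in
theorem eq_zero_of_contract3_grade_eq_zero (hN : 0 < N) (hμ : ∀ x, (⇑μ)^[N] x = x)
    (hT : ∀ α β, B (T α) (T' β) = if α = β then 1 else 0) {u : G ⊗[ℂ] (G ⊗[ℂ] G)}
    (h : ∀ a < N, ∀ x ∈ grade μ N a, ∀ α : ℂ, aeval A ((X - C α) ^ Module.finrank ℂ G) x = 0 →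
      ∀ b < N, ∀ y ∈ grade μ N b, ∀ β : ℂ, aeval A ((X - C β) ^ Module.finrank ℂ G) y = 0 →
      ∀ c < N, ∀ w ∈ grade μ N c, ∀ γ : ℂ, aeval A ((X - C γ) ^ Module.finrank ℂ G) w = 0 →
      contract3 B x y w u = 0) : u = 0 := by
  refine eq_zero_of_contract3_eq_zero hT fun x y w => ?_
  refine grade_induction (ω := ω) hN hμ (P := fun x => contract3 B x y w u = 0)
    (contract3_zero B 0 y w u).1
    (fun x x' e e' => by rw [contract3_add₁, e, e', add_zero]) (fun a ha x hx α hxα => ?_) x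
  refine grade_induction (ω := ω) hN hμ (P := fun y => contract3 B x y w u = 0)
    (contract3_zero B x 0 w u).2.1
    (fun y y' e e' => by rw [contract3_add₂, e, e', add_zero]) (fun b hb y hy β hyβ => ?_) y
  exact grade_induction (ω := ω) hN hμ (P := fun w => contract3 B x y w u = 0)
    (contract3_zero B x y 0 u).2.2
    (fun w w' e e' => by rw [contract3_add₃, e, e', add_zero])
    (fun c hc w hw γ hwγ => h a ha x hx α hxα b hb y hy β hyβ c hc w hw γ hwγ) w

/-- It suffices to contract with homogeneous generalised eigenvectors of ad ω. The contraction is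
then the value of the form on the polynomial relation. -/
theorem dynamical_yangBaxter (hτ : 0 < τ.im) (hN : 0 < N) (hB : B.Nondegenerate)
    (hBsymm : B.IsSymm) (hBinv : B.lieInvariant G) (hBμ : ∀ x y, B (μ x) (μ y) = B x y)
    (hω : ω ∈ admissible μ N τ) (hT : ∀ α β, B (T α) (T' β) = if α = β then 1 else 0)
    (ht : ∀ i j, B (t i) (t' j) = if i = j then 1 else 0) {p : ℕ → ℂ → ℂ[X]}
    (hp : ∀ a < N, ∀ z ∉ lattice τ,
      IsKernelPoly μ τ ω (2 * Module.finrank ℂ G + 1) a z (p a z))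
    {z₁₂ z₂₃ : ℂ} (h₁₂ : z₁₂ ∉ lattice τ) (h₂₃ : z₂₃ ∉ lattice τ) (h₁₃ : z₁₂ + z₂₃ ∉ lattice τ) :
    brk1213 (rMat B μ N hμ T T' τ ω z₁₂) (rMat B μ N hμ T T' τ ω (z₁₂ + z₂₃))
      + brk1223 (rMat B μ N hμ T T' τ ω z₁₂) (rMat B μ N hμ T T' τ ω z₂₃)
      + brk1323 (rMat B μ N hμ T T' τ ω (z₁₂ + z₂₃)) (rMat B μ N hμ T T' τ ω z₂₃)
      + ∑ j, (ins1 (t j : G) (endTensor B T T' (derivROp hμ (fun a => p a z₂₃) ω (t' j)))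
        - ins2 (t j : G) (endTensor B T T' (derivROp hμ (fun a => p a (z₁₂ + z₂₃)) ω (t' j)))
        + ins3 (t j : G) (endTensor B T T' (derivROp hμ (fun a => p a z₁₂) ω (t' j)))) = 0 := by
  have h₁₂' := neg_mem_lattice_iff.not.2 h₁₂
  have h₂₃' := neg_mem_lattice_iff.not.2 h₂₃
  have h₁₃' := neg_mem_lattice_iff.not.2 h₁₃
  refine eq_zero_of_contract3_grade_eq_zero (ω := ω) hN hμ hT
    fun a ha x hx α hxα b hb y hy β hyβ c hc w hw γ hwγ => ?_
  have key := form_brk_relPoly_eq_zero hτ hN hB hBsymm hBinv hμ hBμ hω hp ha hb hc hx hy hw hxα hyβ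
    hwγ h₁₂ h₂₃ h₁₃
  rw [form_brk_bivariateAct_relPoly hBinv] at key
  have hR : ∀ {a : ℕ}, a < N → ∀ {x : G}, x ∈ grade μ N a → ∀ {z : ℂ}, z ∉ lattice τ →
      ROp μ N hμ τ ω z x = aeval A (p a z) x := fun ha _ hx _ hz =>
    (hp _ ha _ hz).ROp_apply hτ hω (by omega) ha hx
  simp only [map_add, map_sum, map_sub, contract3_brk1213, contract3_brk1223, contract3_brk1323,
    contract3_ins1, contract3_ins2, contract3_ins3, contractRight_endTensor hT,
    contractRight_rMat hT, contractLeft_rMat hτ hN hB hBsymm hBinv hBμ hω hT h₁₂,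
    contractLeft_rMat hτ hN hB hBsymm hBinv hBμ hω hT h₂₃,
    contractLeft_rMat hτ hN hB hBsymm hBinv hBμ hω hT h₁₃, Finset.sum_add_distrib,
    Finset.sum_sub_distrib, sum_form_mul_derivROp hN hBsymm hBμ ht _ ha hc hx hw,
    sum_form_mul_derivROp hN hBsymm hBμ ht _ hb hc hy hw,
    sum_form_mul_derivROp hN hBsymm hBμ ht _ hc hb hw hy]
  -- Left contractions produce -R(-z). Rotating the invariant trilinear form B(x, [y, w]) absorbs
  -- these signs and brings all three brackets to the same shape.
  have e₂ : ∀ x y w : G, B y ⁅-x, w⁆ = B x ⁅y, w⁆ := by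
    intro x y w
    rw [neg_lie, map_neg, form_lie_rotate hBinv x y w]
  have e₃ : ∀ x y w : G, B w ⁅-x, -y⁆ = B x ⁅y, w⁆ := by
    intro x y w
    rw [neg_lie, lie_neg, neg_neg, form_lie_rotate hBinv w x y, ← lie_skew w y, map_neg, neg_neg]
  rw [e₂, e₃, hR hb hy h₁₂, hR hc hw h₁₃, hR ha hx h₁₂', hR hc hw h₂₃, hR ha hx h₁₃', hR hb hy h₂₃']
  linear_combination key

end Dynamical

end EllipticRMatrix

end

/-! ### The theorem -/

open EllipticRMatrix in
theorem proposition2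
    {G : Type*} [LieRing G] [LieAlgebra ℂ G] [FiniteDimensional ℂ G]
    (B : LinearMap.BilinForm ℂ G) (hB : B.Nondegenerate) (hBsymm : B.IsSymm)
    (hBinv : B.lieInvariant G)
    (μ : G ≃ₗ⁅ℂ⁆ G) (hBμ : ∀ x y, B (μ x) (μ y) = B x y)
    (N : ℕ) (hN : 0 < N) (hμ : ∀ x, (⇑μ)^[N] x = x)
    (τ : ℂ) (hτ : 0 < τ.im)
    {ι : Type*} [Fintype ι] [DecidableEq ι] (T T' : Module.Basis ι ℂ G)
    (hT : ∀ α β, B (T α) (T' β) = if α = β then 1 else 0)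
    {κ : Type*} [Fintype κ] [DecidableEq κ] (t t' : Module.Basis κ ℂ (grade μ N 0))
    (ht : ∀ i j, B (t i) (t' j) = if i = j then 1 else 0)
    (ω : grade μ N 0) (hω : ω ∈ admissible μ N τ) :
    -- the partial derivatives with respect to the coordinates `ω_j = B(ω, T_j)`, which are the
    -- derivatives in the directions of the dual basis `T^j`, exist and satisfy the CDYBE
    (∃ D : κ → ℂ → G ⊗[ℂ] G,
      (∀ j, ∀ z ∉ lattice τ,
        HasVecDerivAt (fun s : ℂ => rMat B μ N hμ T T' τ (ω + s • t' j) z) (D j z) 0) ∧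
      ∀ z₁ z₂ z₃ : ℂ, z₁ - z₂ ∉ lattice τ → z₁ - z₃ ∉ lattice τ → z₂ - z₃ ∉ lattice τ →
        brk1213 (rMat B μ N hμ T T' τ ω (z₁ - z₂)) (rMat B μ N hμ T T' τ ω (z₁ - z₃))
        + brk1223 (rMat B μ N hμ T T' τ ω (z₁ - z₂)) (rMat B μ N hμ T T' τ ω (z₂ - z₃))
        + brk1323 (rMat B μ N hμ T T' τ ω (z₁ - z₃)) (rMat B μ N hμ T T' τ ω (z₂ - z₃))
        + ∑ j, (ins1 (t j : G) (D j (z₂ - z₃)) - ins2 (t j : G) (D j (z₁ - z₃))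
            + ins3 (t j : G) (D j (z₁ - z₂))) = 0) ∧
    -- the residue at `z = 0`
    HasVecResidueAt (fun z => rMat B μ N hμ T T' τ ω z)
      ((1 / (2 * Real.pi * Complex.I) : ℂ) • ∑ α, T' α ⊗ₜ[ℂ] T α) 0 ∧
    -- unitarity
    (∀ z ∉ lattice τ,
      rMatTransposed B μ N hμ T T' τ ω z + rMat B μ N hμ T T' τ ω (-z) = 0) ∧
    -- equivariance under `G_0`
    (∀ X : grade μ N 0, ∀ z ∉ lattice τ,
      HasVecDerivAt (fun x : ℂ => rMat B μ N hμ T T' τ (endExp (x • adGrade μ N 0 X) ω) z)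
        (LinearMap.rTensor G (LieAlgebra.ad ℂ G (X : G)) (rMat B μ N hμ T T' τ ω z)
          + LinearMap.lTensor G (LieAlgebra.ad ℂ G (X : G)) (rMat B μ N hμ T T' τ ω z)) 0) := by
  -- One family of polynomials must serve both the equation, which needs order 2 dim G + 1, and the
  -- derivatives, which need order 2. The additional 1 covers the latter also when G = 0.
  choose! p hp using fun (a : ℕ) (ha : a < N) (z : ℂ) (hz : z ∉ lattice τ) =>
    exists_isKernelPoly hτ hω (2 * Module.finrank ℂ G + 1 + 1) ha hz
  have hp' : ∀ a < N, ∀ z ∉ lattice τ, IsKernelPoly μ τ ω (2 * Module.finrank ℂ G + 1) a z (p a z) :=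
    fun a ha z hz => (hp a ha z hz).of_le (Nat.le_succ _)
  refine ⟨⟨fun j z => endTensor B T T' (derivROp hμ (fun a => p a z) ω (t' j)), fun j z hz => ?_,
    fun z₁ z₂ z₃ h₁₂ h₁₃ h₂₃ => ?_⟩, hasVecResidueAt_rMat hτ hN hBsymm hT hω,
    fun z hz => rMatTransposed_add_rMat_neg hτ hN hB hBsymm hBinv hBμ hω hz,
    fun X z hz => hasVecDerivAt_rMat_endExp hτ hN hBinv hT hω X hz⟩
  · have hW : HasVecDerivAt (fun s : ℂ => ω + s • t' j) (t' j) 0 := by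
      intro φ
      simpa using ((hasDerivAt_id (0 : ℂ)).mul_const (φ (t' j))).const_add (φ ω)
    exact hasVecDerivAt_rMat hτ hω (fun a ha => (hp a ha z hz).of_le (by omega)) hW (by simp)
  · have e : z₁ - z₃ = (z₁ - z₂) + (z₂ - z₃) := by ring
    rw [e] at h₁₃ ⊢
    exact dynamical_yangBaxter hτ hN hB hBsymm hBinv hBμ hω hT ht hp' h₁₂ h₂₃ h₁₃
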